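/- Let $k$ be a field of characteristic $\neq 2$ and let $B$ be a smooth variety over $k$ (integral, separated, of finite type) of dimension $n$. Let $X$ be a variety and $\rho:X\to B$ a double cover, i.e. a finite flat morphism of rank $2$. Locally on $B$ the cover is given by $z^2=h$ (that is, $\rho_*\mathcal O_X=\mathcal O_B\oplus\mathcal O_B z$ with $z^2=h$), and the equations $h=0$ define the branch divisor $\underline O\subset B$. Let $Z\subset B$ be a smooth integral closed subvariety of codimension $r\ge 1$, and let $m\ge 0$ be the multiplicity of $\underline O$ along $Z$, i.e. the largest $l$ such that a local equation $h$ of $\underline O$ lies in $\mathfrak m^l$, where $\mathfrak m$ is the maximal ideal of the local ring of $B$ at the generic point of $Z$. Assume that $X$ is normal outside $\rho^{-1}(Z)$ (equivalently, $\underline O$ is reduced outside $Z$). If $r=1$ and $m\ge 2$, assume also that $B$ is proper over $k$. Let $j:B_Z\to B$ be the blow-up of $B$ along $Z$, let $\tilde X_Z$ be the normalization of $X\times_B B_Z$, and let $\pi:\tilde X_Z\to X$ and $\rho_Z:\tilde X_Z\to B_Z$ be the induced morphisms. The canonical class of $X$ is the class $K_X$ of its dualizing sheaf $\omega_X$, given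 by $\rho_*\omega_X=\mathcal{H}om_{\mathcal O_B}(\rho_*\mathcal O_X,\Omega^n_{B/k})$; that of $\tilde X_Z$ is defined in the same way from $\rho_Z$. Then $B_Z$ is integral, the morphisms $\rho$, $\rho_Z$, $\pi$ are dominant, the canonical divisors of $X$ and of $\tilde X_Z$ are Cartier, and $$K_{\tilde X_Z}=\pi^*K_X \text{ as divisor classes}\quad\Longleftrightarrow\quad m=2r-2\ \text{ or }\ m=2r-1 .$$ In particular, the canonical class is preserved if and only if - $m\in\{0,1\}$, when $r=1$; - $m\in\{2,3\}$, when $r=2$; - $m\in\{4,5\}$, when $r=3$. -/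

import Mathlib

open AlgebraicGeometry CategoryTheory CategoryTheory.Limits

universe u

namespace DoubleCover

/-! ### Rees algebras and blow-ups -/

section Rees

variable {R : Type u} [CommRing R] (I : Ideal R)

/-- The degree `n` part `Iⁿ tⁿ` of the Rees algebra `⨁ₙ Iⁿ tⁿ ⊆ R[t]`. -/
def reesGrading (n : ℕ) : Submodule R (reesAlgebra I) where
  carrier := {f | ∀ i, i ≠ n → f.1.coeff i = 0}
  add_mem' {f g} hf hg i hi := by simp [hf i hi, hg i hi]
  zero_mem' i _ := by simp
  smul_mem' r f hf i hi := by simp [hf i hi]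

/-- The homogeneous component of degree `n` of an element of the Rees algebra. -/
noncomputable def reesComponent (n : ℕ) (f : reesAlgebra I) : reesGrading I n :=
  ⟨⟨Polynomial.monomial n (f.1.coeff n), reesAlgebra.monomial_mem.mpr (f.2 n)⟩,
    fun i hi => by simp [Polynomial.coeff_monomial, hi.symm]⟩

theorem coeff_coeAddMonoidHom (x : DirectSum ℕ fun n => reesGrading I n) (i : ℕ) :
    (DirectSum.coeAddMonoidHom (reesGrading I) x).1.coeff i = (x i).1.1.coeff i := by
  classical
  induction x using DirectSum.induction_on with
  | zero => simp
  | of n y =>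
    rw [DirectSum.coeAddMonoidHom_of]
    by_cases h : n = i
    · subst h
      simp
    · rw [DirectSum.of_eq_of_ne _ _ _ (Ne.symm h)]
      simpa using y.2 i (Ne.symm h)
  | add x y hx hy => simp [hx, hy]

theorem reesComponent_coeff (f : reesAlgebra I) (n : ℕ) :
    (DirectSum.mk (fun n => reesGrading I n) f.1.support
      (fun n => reesComponent I n f)) n = reesComponent I n f := by
  classical
  by_cases h : n ∈ f.1.support
  · exact DirectSum.mk_apply_of_mem h
  · rw [DirectSum.mk_apply_of_notMem h]
    apply Subtype.ext
    apply Subtype.ext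
    simp [reesComponent, Polynomial.notMem_support_iff.mp h]

noncomputable instance : DirectSum.Decomposition (reesGrading I) where
  decompose' f := DirectSum.mk (fun n => reesGrading I n) f.1.support
    (fun n => reesComponent I n f)
  left_inv f := by
    apply Subtype.ext
    ext i
    rw [coeff_coeAddMonoidHom, reesComponent_coeff]
    simp [reesComponent]
  right_inv x := by
    refine DFinsupp.ext fun n => ?_
    refine (reesComponent_coeff I _ n).trans ?_
    apply Subtype.ext
    apply Subtype.ext
    ext i
    by_cases h : i = n
    · subst h
      simp [reesComponent, coeff_coeAddMonoidHom]
    · rw [(x n).2 i h]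
      simp [reesComponent, Polynomial.coeff_monomial, Ne.symm h]

instance : SetLike.GradedMonoid (reesGrading I) where
  one_mem i hi := by simp [Polynomial.coeff_one, hi]
  mul_mem m n f g hf hg i hi := by
    change (f.1 * g.1).coeff i = 0
    rw [Polynomial.coeff_mul]
    refine Finset.sum_eq_zero fun p hp => ?_
    by_cases h : p.1 = m
    · have : p.2 ≠ n := by
        rintro rfl
        exact hi (by rw [← h, Finset.HasAntidiagonal.mem_antidiagonal.mp hp])
      rw [hg _ this, mul_zero]
    · rw [hf _ h, zero_mul]

noncomputable instance : GradedAlgebra (reesGrading I) where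

end Rees

/-- The structure morphism `Proj (⨁ₙ Iⁿ) ⟶ Spec R` of the blow-up of `Spec R` in `I`. -/
noncomputable def affineBlowup {R : CommRingCat.{u}} (I : Ideal R) :
    Proj (reesGrading I) ⟶ Spec R :=
  Proj.toSpecZero (reesGrading I) ≫
    Spec.map (CommRingCat.ofHom (algebraMap R (reesGrading I 0)))

/-- `j : B' ⟶ B` is the blow-up of the scheme `B` in the ideal sheaf `I`: over every affine open
`U` of `B` it is isomorphic to `Proj (⨁ₙ I(U)ⁿ) ⟶ Spec Γ(B, U) ≅ U`. -/
def IsBlowup {B B' : Scheme.{u}} (I : B.IdealSheafData) (j : B' ⟶ B) : Prop :=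
  ∀ U : B.affineOpens, ∃ e : (j ⁻¹ᵁ U.1).toScheme ≅ Proj (reesGrading (I.ideal U)),
    e.hom ≫ affineBlowup (I.ideal U) = (j ∣_ U.1) ≫ U.2.isoSpec.hom

/-- `ν : Y ⟶ X` is the normalization of the integral scheme `X`: `Y` is integral and normal, `ν` is
an integral morphism, and `ν` is birational. -/
structure IsNormalization {Y X : Scheme.{u}} (ν : Y ⟶ X) : Prop where
  isIntegral : IsIntegral Y
  isIntegrallyClosed (y : Y) : IsIntegrallyClosed (Y.presheaf.stalk y)
  isIntegralHom : IsIntegralHom ν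
  birational : ∃ U : X.Opens, Dense (U : Set X) ∧ IsIso (ν ∣_ U)

/-! ### Double covers and their branch divisors -/

/-- A double cover: a finite flat morphism of rank two. -/
structure IsDoubleCover {X B : Scheme.{u}} (ρ : X ⟶ B) : Prop where
  isFinite : IsFinite ρ
  flat : Flat ρ
  finrank_eq (b : B) : ρ.finrank b = 2

/-- `h ∈ Γ(B, U)` is an equation on `U` of the branch divisor of `ρ : X ⟶ B`: over `U`, the cover
is given by `z² = h`, i.e. `Γ(X, ρ⁻¹ U) = Γ(B, U) ⊕ Γ(B, U) z` with `z² = h`. -/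
def IsBranchEquation {X B : Scheme.{u}} (ρ : X ⟶ B) (U : B.Opens) (h : Γ(B, U)) : Prop :=
  ∃ z : Γ(X, ρ ⁻¹ᵁ U), z ^ 2 = (ρ.app U).hom h ∧
    ∀ a : Γ(X, ρ ⁻¹ᵁ U), ∃! p : Γ(B, U) × Γ(B, U),
      a = (ρ.app U).hom p.1 + (ρ.app U).hom p.2 * z

/-- The branch divisor of `ρ : X ⟶ B` has multiplicity `m` at the point `ζ` of `B` (equivalently,
along the closed subvariety with generic point `ζ`): an equation of it on an affine neighbourhood
of `ζ` lies in the `m`-th but not in the `(m+1)`-st power of the maximal ideal at `ζ`. -/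
def HasBranchMultiplicity {X B : Scheme.{u}} (ρ : X ⟶ B) (ζ : B) (m : ℕ) : Prop :=
  ∃ (U : B.Opens) (hζ : ζ ∈ U) (h : Γ(B, U)), IsAffineOpen U ∧ IsBranchEquation ρ U h ∧
    (B.presheaf.germ U ζ hζ).hom h ∈ IsLocalRing.maximalIdeal (B.presheaf.stalk ζ) ^ m ∧
    (B.presheaf.germ U ζ hζ).hom h ∉ IsLocalRing.maximalIdeal (B.presheaf.stalk ζ) ^ (m + 1)

/-! ### Local rings inside the function field -/

/-- The local ring `𝒪_{X,x}`, as a subring of the function field. -/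
noncomputable def localRing (X : Scheme.{u}) [IsIntegral X] (x : X) : Subring X.functionField :=
  (algebraMap (X.presheaf.stalk x) X.functionField).range

/-- The stalk `(f_* 𝒪_X)_y`, as a subring of the function field of `X`, for an affine morphism
`f`: it is the intersection of the local rings of `X` at the points over `y`. -/
noncomputable def pushforwardLocalRing {X Y : Scheme.{u}} [IsIntegral X] (f : X ⟶ Y) (y : Y) :
    Subring X.functionField :=
  ⨅ x : {x : X // f x = y}, localRing X x.1

theorem map_genericPoint {X Y : Scheme.{u}} [IsIntegral X] [IsIntegral Y] (f : X ⟶ Y)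
    [IsDominant f] : f (genericPoint X) = genericPoint Y := by
  apply ((genericPoint_spec Y).eq _).symm
  have h := (genericPoint_spec X).image f.continuous
  rwa [Set.image_univ, f.denseRange.closure_range] at h

/-- The inclusion of function fields `f^♯ : K(Y) → K(X)` given by a dominant morphism
`f : X ⟶ Y` of integral schemes. -/
noncomputable def functionFieldMap {X Y : Scheme.{u}} [IsIntegral X] [IsIntegral Y] (f : X ⟶ Y)
    [IsDominant f] : Y.functionField →+* X.functionField :=
  (Y.presheaf.stalkSpecializes (specializes_of_eq (map_genericPoint f)) ≫
    f.stalkMap (genericPoint X)).hom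

/-- The map from the ground field `k` to the function field of an integral `k`-scheme. -/
noncomputable def scalarMap {k : Type u} [Field k] {Y : Scheme.{u}} [IsIntegral Y]
    (s : Y ⟶ Spec (.of k)) : k →+* Y.functionField :=
  ((Scheme.ΓSpecIso (.of k)).inv ≫ s.appTop ≫ Y.presheaf.germ ⊤ (genericPoint Y) trivial).hom

/-! ### Divisors -/

/-- A divisor `D` on an integral scheme `X`, given by its sheaf `𝒪_X(D)`, that is, by the
`𝒪_{X,x}`-submodules `𝒪_X(D)_x` of the function field. -/
def Divisor (X : Scheme.{u}) [IsIntegral X] : Type u :=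
  ∀ x : X, Submodule (localRing X x) X.functionField

/-- `D` is a Cartier divisor, that is, `𝒪_X(D)` is invertible. -/
def Divisor.IsCartier {X : Scheme.{u}} [IsIntegral X] (D : Divisor X) : Prop :=
  ∀ x : X, ∃ g : X.functionField, g ≠ 0 ∧ D x = Submodule.span (localRing X x) {g}

/-- The pull-back `π^* D` of a divisor along a dominant morphism `π : Y ⟶ X`, given by
`𝒪_Y(π^* D)_y = 𝒪_{Y,y} · π^♯(𝒪_X(D)_{π y})`. -/
noncomputable def Divisor.pullback {X Y : Scheme.{u}} [IsIntegral X] [IsIntegral Y] (π : Y ⟶ X)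
    [IsDominant π] (D : Divisor X) : Divisor Y := fun y =>
  Submodule.span (localRing Y y)
    (functionFieldMap π '' (D (π y) : Set X.functionField))

/-! ### Canonical divisors -/

/-- The lattice `Ωⁿ_R ⊆ Ωⁿ_{K/k}`, `R`-spanned by all `da₁ ∧ ⋯ ∧ daₙ` with `aᵢ ∈ R`, of a subring
`R` of `K`. If `R` is a local ring of a smooth `n`-dimensional `k`-variety with function field `K`,
it is the stalk of the sheaf of `n`-forms on the variety. -/
noncomputable def formLattice (k K : Type u) [Field k] [Field K] [Algebra k K] (n : ℕ) (R : Subring K) :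
    Submodule R (⋀[K]^n Ω[K⁄k]) :=
  Submodule.span R {ω | ∃ a : Fin n → K, (∀ i, a i ∈ R) ∧
    ω = exteriorPower.ιMulti K n fun i => KaehlerDifferential.D k K (a i)}

/-- The canonical divisors of an integral scheme `X` that is finite over a smooth variety `Y` of
dimension `n` by a surjective morphism `f : X ⟶ Y`. The canonical (dualizing) sheaf of `X` is
`ω_X = f^! Ωⁿ_Y`, i.e. `f_* ω_X = ℋom(f_* 𝒪_X, Ωⁿ_Y)` with `𝒪_X` acting through the first
argument; its nonzero rational sections are the nonzero `K(Y)`-linear maps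
`φ : K(X) → Ωⁿ_{K(Y)/k}`. The divisor `D = div φ` is the one with
`𝒪_X(D)_x = {θ ∈ K(X) | θ φ ∈ ω_{X,x}}`; here `ω_{X,x}` is generated over `𝒪_{X,x}` by
`(f_* ω_X)_y`, where `y = f x`. -/
def canonicalDivisors {k : Type u} [Field k] {X Y : Scheme.{u}} [IsIntegral X] [IsIntegral Y]
    (n : ℕ) (s : Y ⟶ Spec (.of k)) (f : X ⟶ Y) [IsDominant f] : Set (Divisor X) :=
  letI : Algebra k Y.functionField := (scalarMap s).toAlgebra
  letI : Algebra Y.functionField X.functionField := (functionFieldMap f).toAlgebra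
  {D | ∃ φ : X.functionField →ₗ[Y.functionField] ⋀[Y.functionField]^n Ω[Y.functionField⁄k],
    φ ≠ 0 ∧ ∀ x : X, D x = Submodule.span (localRing X x)
      {θ | ∀ a ∈ pushforwardLocalRing f (f x),
        φ (θ * a) ∈ formLattice k Y.functionField n (localRing Y (f x))}}

/-- `K_{X'} = π^* K_X` as divisor classes: the pull-back of some canonical divisor of `X` is a
canonical divisor of `X'`. Here `X` and `X'` are finite over the smooth `n`-dimensional
`k`-varieties `Y` and `Y'`. -/
def PreservesCanonicalClass {k : Type u} [Field k] {X Y X' Y' : Scheme.{u}}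
    [IsIntegral X] [IsIntegral Y] [IsIntegral X'] [IsIntegral Y'] (n : ℕ)
    (s : Y ⟶ Spec (.of k)) (f : X ⟶ Y) [IsDominant f]
    (s' : Y' ⟶ Spec (.of k)) (f' : X' ⟶ Y') [IsDominant f']
    (π : X' ⟶ X) [IsDominant π] : Prop :=
  ∃ D ∈ canonicalDivisors n s f, D.pullback π ∈ canonicalDivisors n s' f'

end DoubleCover

-- Near a point of Z choose coordinates x_1, ..., x_n on B such that x_1, ..., x_r cut out Z, put ω
-- = dx_1 ∧ ... ∧ dx_n, and write the cover as z² = h. The dualizing module Hom(O ⊕ O z, O ω) is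
-- free of rank one over O ⊕ O z, generated by the functional that kills 1 and sends z to ω
-- (`IsCanonicalGenerator`). On the chart of the blow-up where t = x_l generates the exceptional
-- ideal, each of the other r - 1 equations of Z has the form x_i = t (x_i / t), so the forms are
-- generated by ω / t^(r-1) (`IsBlowupLocalRing.formLattice_eq`). The normalized cover is R ⊕ R z /
-- t^⌊m/2⌋: the quotient h / t^(2⌊m/2⌋) is not divisible by t², and where t is invertible X is
-- already normal (`IsBlowupLocalRing.isIntegral_iff`). The new canonical functional is therefore
-- t^(⌊m/2⌋-(r-1)) times the old one, and the classes agree as soon as ⌊m/2⌋ = r - 1, that is, m =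
-- 2r - 2 or m = 2r - 1.
--
-- Conversely, if the classes agree, two canonical functionals differ by a factor g in the function
-- field of the normalized cover. The norm of g is a rational function f on B that is a unit outside
-- Z and for which f t^(2(r-1)-2⌊m/2⌋) is a unit at the points over Z
-- (`PreservesCanonicalClass.exists_norm`). If r ≥ 2, then f and 1/f have no pole along the
-- exceptional divisor, by a Hartogs argument, so the exponent is zero (`div_two_eq_of_two_le`). If
-- r = 1 and m ≥ 2, then f is a global function on the proper variety B that vanishes along Z, which
-- is absurd (`lt_two_of_codim_one`).
--
-- The commutative algebra rests on one fact: the adic order of the ideal I of Z is additive on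
-- products (`HasAdditiveOrder`). This makes t behave like a prime element of R
-- (`IsBlowupLocalRing.div_mem_or_div_mem`). It is deduced from formal smoothness: the derivations
-- dual to x_1, ..., x_r lift to a homomorphism from O to a truncated polynomial ring over
-- (O/I)[X_1, ..., X_r], under which an element of order p acquires a nonzero leading form of degree
-- p. The coordinates themselves come from the Jacobian criterion and Nakayama's lemma
-- (`exists_adapted_coordinates`).

universe v w

namespace DoubleCover

/-! ### Leading forms of ring elements. -/

section LeadingForms

variable {O S Q' : Type*} [CommRing O] [CommRing S] [CommRing Q']

/-- `F` is the coefficient of `τ ^ p` in `ψ a`, and the lower ones vanish. -/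
def IsLeadingForm (ψ : O →+* S) (c : Q' →+* S) (τ : S) (a : O) (p : ℕ) (F : Q') : Prop :=
  ∃ g, ψ a = τ ^ p * (c F + τ * g)

variable {ψ : O →+* S} {c : Q' →+* S} {τ : S}

theorem IsLeadingForm.mul {a b : O} {p q : ℕ} {F G : Q'} (ha : IsLeadingForm ψ c τ a p F)
    (hb : IsLeadingForm ψ c τ b q G) : IsLeadingForm ψ c τ (a * b) (p + q) (F * G) := by
  obtain ⟨f, hf⟩ := ha
  obtain ⟨g, hg⟩ := hb
  exact ⟨c F * g + f * c G + τ * f * g, by rw [map_mul, hf, hg, map_mul]; ring⟩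

theorem IsLeadingForm.zero (p : ℕ) : IsLeadingForm ψ c τ 0 p 0 := ⟨0, by simp⟩

theorem IsLeadingForm.one : IsLeadingForm ψ c τ 1 0 1 := ⟨0, by simp⟩

theorem IsLeadingForm.add {a b : O} {p : ℕ} {F G : Q'} (ha : IsLeadingForm ψ c τ a p F)
    (hb : IsLeadingForm ψ c τ b p G) : IsLeadingForm ψ c τ (a + b) p (F + G) := by
  obtain ⟨f, hf⟩ := ha
  obtain ⟨g, hg⟩ := hb
  exact ⟨f + g, by rw [map_add, hf, hg, map_add]; ring⟩

theorem IsLeadingForm.sum {ι : Type*} (s : Finset ι) {a : ι → O} {p : ℕ} {F : ι → Q'}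
    (h : ∀ i ∈ s, IsLeadingForm ψ c τ (a i) p (F i)) :
    IsLeadingForm ψ c τ (∑ i ∈ s, a i) p (∑ i ∈ s, F i) := by
  classical
  induction s using Finset.induction_on with
  | empty => simpa using IsLeadingForm.zero p
  | insert i s hi ih =>
    rw [Finset.sum_insert hi, Finset.sum_insert hi]
    exact (h i (by simp)).add (ih fun j hj => h j (by simp [hj]))

theorem IsLeadingForm.pow {a : O} {p : ℕ} {F : Q'} (ha : IsLeadingForm ψ c τ a p F) (k : ℕ) :
    IsLeadingForm ψ c τ (a ^ k) (k * p) (F ^ k) := by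
  induction k with
  | zero => simpa using IsLeadingForm.one
  | succ k ih => rw [pow_succ, pow_succ, add_mul, one_mul]; exact ih.mul ha

theorem IsLeadingForm.prod {ι : Type*} (s : Finset ι) {a : ι → O} {p : ι → ℕ} {F : ι → Q'}
    (h : ∀ i ∈ s, IsLeadingForm ψ c τ (a i) (p i) (F i)) :
    IsLeadingForm ψ c τ (∏ i ∈ s, a i) (∑ i ∈ s, p i) (∏ i ∈ s, F i) := by
  classical
  induction s using Finset.induction_on with
  | empty => simpa using IsLeadingForm.one
  | insert i s hi ih =>
    rw [Finset.prod_insert hi, Finset.sum_insert hi, Finset.prod_insert hi]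
    exact (h i (by simp)).mul (ih fun j hj => h j (by simp [hj]))

/-- Each monomial of degree `e` contributes `τ ^ e` times the monomial in the variables, and
coefficients matter only modulo the ideal. -/
theorem IsLeadingForm.eval {Q ι : Type*} [CommRing Q] {ψ : O →+* S}
    {c : MvPolynomial ι Q →+* S} {π : O →+* Q} {x : ι → O}
    (h0 : ∀ a, IsLeadingForm ψ c τ a 0 (MvPolynomial.C (π a)))
    (h1 : ∀ i, IsLeadingForm ψ c τ (x i) 1 (MvPolynomial.X i))
    {P : MvPolynomial ι O} {e : ℕ} (hP : P.IsHomogeneous e) :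
    IsLeadingForm ψ c τ (P.eval x) e (P.map π) := by
  rw [MvPolynomial.eval_eq, ← P.support_sum_monomial_coeff, map_sum]
  simp only [P.support_sum_monomial_coeff]
  refine IsLeadingForm.sum _ fun α hα => ?_
  rw [MvPolynomial.map_monomial, MvPolynomial.monomial_eq]
  have : e = 0 + ∑ i ∈ α.support, α i * 1 := by
    have h := hP (MvPolynomial.mem_support_iff.mp hα)
    rw [Finsupp.weight_apply] at h
    simpa [Finsupp.sum] using h.symm
  rw [this]
  exact (h0 _).mul (IsLeadingForm.prod _ fun i _ => (h1 i).pow _)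

end LeadingForms

/-! ### Lifting a derivation to a truncated polynomial ring. -/

section Lift

open Polynomial

variable {k O Q : Type*} [Field k] [CommRing O] [Algebra k O] [CommRing Q] [Algebra k Q]

/-- The homomorphism `a ↦ π a + d a ε` given by a derivation `d` along `π`. -/
noncomputable def dualNumberHom (π : O →ₐ[k] Q) (d : O →ₗ[k] Q)
    (hd : ∀ a b, d (a * b) = π a * d b + π b * d a) : O →ₐ[k] DualNumber Q :=
  AlgHom.ofLinearMap
    ((TrivSqZeroExt.inlAlgHom k Q Q).toLinearMap ∘ₗ π.toLinearMap +
      (TrivSqZeroExt.inrHom Q Q).restrictScalars k ∘ₗ d)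
    (by
      have : d 1 = 0 := by simpa using hd 1 1
      ext <;> simp [this])
    (by
      intro a b
      ext <;> simp [hd, mul_comm])

/-- The map `a ↦ π a + d a ε` to the dual numbers lifts along the surjection `X ↦ ε`, whose kernel
is nilpotent, by formal smoothness. The exponent `N + 2` is at least two, so that the surjection
exists, and keeps all coefficients up to degree `N`. -/
theorem exists_leadingForm_hom [Algebra.FormallySmooth k O] (π : O →ₐ[k] Q) (d : O →ₗ[k] Q)
    (hd : ∀ a b, d (a * b) = π a * d b + π b * d a) (N : ℕ) :
    ∃ ψ : O →+* Q[X] ⧸ Ideal.span {(X : Q[X]) ^ (N + 2)},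
      ∀ a, ∃ g, ψ a = Ideal.Quotient.mk _ (C (π a) + C (d a) * X + X ^ 2 * g) := by
  set J := Ideal.span {(X : Q[X]) ^ (N + 2)}
  let f := dualNumberHom π d hd
  let g : (Q[X] ⧸ J) →ₐ[k] DualNumber Q :=
    Ideal.Quotient.liftₐ J ((aeval (R := Q) (DualNumber.eps : DualNumber Q)).restrictScalars k) (by
      intro a ha
      obtain ⟨b, rfl⟩ := Ideal.mem_span_singleton'.mp ha
      simp [pow_add, pow_two])
  have key (p : Q[X]) : aeval (DualNumber.eps : DualNumber Q) p =
      algebraMap Q _ (p.coeff 0) + algebraMap Q _ (p.coeff 1) * DualNumber.eps := by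
    obtain ⟨q, hq⟩ : ∃ q, p = C (p.coeff 0) + X * (C (p.coeff 1) + X * q) := by
      refine ⟨p.divX.divX, ?_⟩
      conv_lhs => rw [← divX_mul_X_add p, ← divX_mul_X_add p.divX]
      rw [coeff_divX]
      ring
    conv_lhs => rw [hq]
    simp only [map_add, map_mul, aeval_C, aeval_X, mul_add, ← mul_assoc, DualNumber.eps_mul_eps,
      zero_mul, add_zero]
    rw [mul_comm (DualNumber.eps)]
  have hgmk (p : Q[X]) : g (Ideal.Quotient.mk J p) =
      algebraMap Q _ (p.coeff 0) + algebraMap Q _ (p.coeff 1) * DualNumber.eps := by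
    rw [← key]; rfl
  have hsurj : Function.Surjective g := by
    intro y
    refine ⟨Ideal.Quotient.mk J (C y.fst + C y.snd * X), ?_⟩
    rw [hgmk]
    ext <;> simp [TrivSqZeroExt.algebraMap_eq_inl]
  have hker (p : Q[X]) (hp : g (Ideal.Quotient.mk J p) = 0) : p.coeff 0 = 0 ∧ p.coeff 1 = 0 := by
    rw [hgmk] at hp
    have h1 := congrArg TrivSqZeroExt.fst hp
    have h2 := congrArg TrivSqZeroExt.snd hp
    simpa [TrivSqZeroExt.algebraMap_eq_inl] using And.intro h1 h2
  -- The kernel is contained in the ideal generated by `X`, whose power of exponent `N + 2` is zero.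
  have hnil : IsNilpotent (RingHom.ker (g : (Q[X] ⧸ J) →+* DualNumber Q)) := by
    refine ⟨N + 2, ?_⟩
    have hle : RingHom.ker (g : (Q[X] ⧸ J) →+* DualNumber Q) ≤
        Ideal.span {Ideal.Quotient.mk J X} := by
      intro y hy
      obtain ⟨p, rfl⟩ := Ideal.Quotient.mk_surjective y
      obtain ⟨q, hq⟩ := X_dvd_iff.mpr (hker p hy).1
      exact Ideal.mem_span_singleton.mpr ⟨Ideal.Quotient.mk J q, by rw [← map_mul, ← hq]⟩
    have := Ideal.pow_right_mono hle (N + 2)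
    rw [Ideal.span_singleton_pow, ← map_pow, Ideal.Quotient.eq_zero_iff_mem.mpr
      (Ideal.mem_span_singleton_self _)] at this
    simpa using this
  let ψ := Algebra.FormallySmooth.liftOfSurjective f g hsurj hnil
  refine ⟨ψ.toRingHom, fun a => ?_⟩
  obtain ⟨p, hp⟩ := Ideal.Quotient.mk_surjective (ψ a)
  have h : g (ψ a) = f a := Algebra.FormallySmooth.liftOfSurjective_apply f g hsurj hnil a
  have h' : f a = TrivSqZeroExt.inl (π a) + TrivSqZeroExt.inr (d a) := rfl
  rw [← hp, hgmk, h'] at h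
  have h1 := congrArg TrivSqZeroExt.fst h
  have h2 := congrArg TrivSqZeroExt.snd h
  simp [TrivSqZeroExt.algebraMap_eq_inl] at h1 h2
  refine ⟨p.divX.divX, ?_⟩
  change ψ a = _
  rw [← hp, ← h1, ← h2]
  congr 1
  conv_lhs => rw [← divX_mul_X_add p, ← divX_mul_X_add p.divX]
  rw [coeff_divX]
  ring

end Lift

/-! ### The adic order of an ideal generated by coordinates. -/

section Order

variable {k : Type*} {O : Type v} {ι : Type w} [Field k] [CommRing O] [Algebra k O] [Algebra.FormallySmooth k O]
  [Fintype ι] [DecidableEq ι] {I : Ideal O} {x : ι → O}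

/-- The derivation to lift is `a ↦ ∑ d i a · X i`, the generic tangent direction normal to the
ideal. The coordinate `x i` then starts with `τ X i`, and coefficients of `τ ^ p` are well defined
for `p ≤ N`. -/
theorem exists_leadingForms (hx : ∀ i, x i ∈ I)
    (d : ι → Derivation k O (O ⧸ I)) (hd : ∀ i j, d i (x j) = if i = j then 1 else 0) (N : ℕ) :
    ∃ (S : Type (max v w)) (_ : CommRing S) (ψ : O →+* S) (c : MvPolynomial ι (O ⧸ I) →+* S) (τ : S),
      (∀ a, IsLeadingForm ψ c τ a 0 (MvPolynomial.C (Ideal.Quotient.mk I a))) ∧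
      (∀ i, IsLeadingForm ψ c τ (x i) 1 (MvPolynomial.X i)) ∧
      ∀ a p F G, p ≤ N → IsLeadingForm ψ c τ a p F → IsLeadingForm ψ c τ a p G → F = G := by
  let π : O →ₐ[k] MvPolynomial ι (O ⧸ I) :=
    (Algebra.ofId (O ⧸ I) (MvPolynomial ι (O ⧸ I))).restrictScalars k |>.comp
      (Ideal.Quotient.mkₐ k I)
  have hπ (a : O) : π a = MvPolynomial.C (Ideal.Quotient.mk I a) := rfl
  let D : O →ₗ[k] MvPolynomial ι (O ⧸ I) :=
    ∑ i, ((LinearMap.toSpanSingleton (O ⧸ I) _ (MvPolynomial.X i)).restrictScalars k) ∘ₗ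
      (d i).toLinearMap
  have hD (a : O) : D a = ∑ i, MvPolynomial.C (d i a) * MvPolynomial.X i := by
    simp [D, MvPolynomial.smul_eq_C_mul]
  obtain ⟨ψ, hψ⟩ := exists_leadingForm_hom π D (by
    intro a b
    simp only [hD, hπ, Finset.mul_sum, ← Finset.sum_add_distrib]
    refine Finset.sum_congr rfl fun i _ => ?_
    rw [Derivation.leibniz, Algebra.smul_def, Algebra.smul_def, map_add, map_mul, map_mul,
      Ideal.Quotient.algebraMap_eq]
    ring) N
  refine ⟨_, inferInstance, ψ, (Ideal.Quotient.mk (Ideal.span {Polynomial.X ^ (N + 2)})).comp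
    Polynomial.C,
    Ideal.Quotient.mk _ Polynomial.X, fun a => ?_, fun i => ?_, ?_⟩
  · obtain ⟨g, hg⟩ := hψ a
    refine ⟨Ideal.Quotient.mk _ (Polynomial.C (D a) + Polynomial.X * g), ?_⟩
    rw [hg, RingHom.comp_apply, ← hπ, ← map_mul, ← map_add, ← map_pow, ← map_mul]
    congr 1
    ring
  · obtain ⟨g, hg⟩ := hψ (x i)
    refine ⟨Ideal.Quotient.mk _ g, ?_⟩
    have h0 : π (x i) = 0 := by rw [hπ, Ideal.Quotient.eq_zero_iff_mem.mpr (hx i), map_zero]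
    have h1 : D (x i) = MvPolynomial.X i := by
      rw [hD, Finset.sum_eq_single i]
      · simp [hd]
      · intro j _ hj
        simp [hd, hj]
      · simp
    rw [hg, RingHom.comp_apply, h0, h1, ← map_mul, ← map_add, ← map_pow, ← map_mul]
    congr 1
    simp
    ring
  · rintro a p F G hp ⟨f, hf⟩ ⟨g, hg⟩
    obtain ⟨f, rfl⟩ := Ideal.Quotient.mk_surjective f
    obtain ⟨g, rfl⟩ := Ideal.Quotient.mk_surjective g
    have h := hf.symm.trans hg
    simp only [RingHom.comp_apply, ← map_mul, ← map_add, ← map_pow] at h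
    rw [Ideal.Quotient.mk_eq_mk_iff_sub_mem, Ideal.mem_span_singleton,
      Polynomial.X_pow_dvd_iff] at h
    have := h p (by omega)
    simpa [Polynomial.coeff_X_pow_mul', sub_eq_zero] using this

/-- An ideal whose adic order is additive on products. -/
def HasAdditiveOrder {O : Type*} [CommRing O] (I : Ideal O) : Prop :=
  ∀ ⦃a b : O⦄ ⦃p q : ℕ⦄, a ∈ I ^ p → a ∉ I ^ (p + 1) → b ∈ I ^ q → b ∉ I ^ (q + 1) →
    a * b ∉ I ^ (p + q + 1)

variable {S Q' : Type*} [CommRing S] {ψ : O →+* S} {c : MvPolynomial ι (O ⧸ I) →+* S} {τ : S}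

-- Write `a` as a homogeneous polynomial in the generators and reduce its coefficients. If the
-- reduction vanishes, all coefficients lie in `I`, which gains one order. Thus a nonzero leading
-- form detects the exact order.
omit [Fintype ι] [DecidableEq ι] in
theorem exists_leadingForm_of_mem_pow {O : Type v} [CommRing O] {I : Ideal O} {x : ι → O}
    {ψ : O →+* S} {c : MvPolynomial ι (O ⧸ I) →+* S} (hI : I = Ideal.span (Set.range x))
    (h0 : ∀ a, IsLeadingForm ψ c τ a 0 (MvPolynomial.C (Ideal.Quotient.mk I a)))
    (h1 : ∀ i, IsLeadingForm ψ c τ (x i) 1 (MvPolynomial.X i)) {a : O} {p : ℕ} (ha : a ∈ I ^ p) :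
    ∃ F : MvPolynomial ι (O ⧸ I), F.IsHomogeneous p ∧ IsLeadingForm ψ c τ a p F ∧
      (F = 0 → a ∈ I ^ (p + 1)) := by
  have ha' := ha
  rw [hI, Ideal.mem_span_pow_iff_exists_isHomogeneous] at ha'
  obtain ⟨P, hP, rfl⟩ := ha'
  refine ⟨P.map (Ideal.Quotient.mk I), hP.map _, IsLeadingForm.eval h0 h1 hP, fun h => ?_⟩
  rw [MvPolynomial.eval_eq]
  refine Ideal.sum_mem _ fun α hα => ?_
  have hc : P.coeff α ∈ I := by
    rw [← Ideal.Quotient.eq_zero_iff_mem, ← MvPolynomial.coeff_map, h, MvPolynomial.coeff_zero]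
  have hm : ∏ i ∈ α.support, x i ^ α i ∈ I ^ p := by
    have h := hP (MvPolynomial.mem_support_iff.mp hα)
    rw [Finsupp.weight_apply] at h
    have h2 : ∑ i ∈ α.support, α i = p := by simpa [Finsupp.sum] using h
    rw [← h2, ← Finset.prod_pow_eq_pow_sum]
    refine Ideal.prod_mem_prod fun i _ => Ideal.pow_mem_pow ?_ _
    rw [hI]
    exact Ideal.subset_span ⟨i, rfl⟩
  rw [pow_succ']
  exact Ideal.mul_mem_mul hc hm

omit [Fintype ι] [DecidableEq ι] in
theorem isLeadingForm_zero_of_mem_pow_succ {O : Type v} [CommRing O] {I : Ideal O} {x : ι → O}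
    {ψ : O →+* S} {c : MvPolynomial ι (O ⧸ I) →+* S} (hI : I = Ideal.span (Set.range x))
    (h0 : ∀ a, IsLeadingForm ψ c τ a 0 (MvPolynomial.C (Ideal.Quotient.mk I a)))
    (h1 : ∀ i, IsLeadingForm ψ c τ (x i) 1 (MvPolynomial.X i)) {a : O} {p : ℕ}
    (ha : a ∈ I ^ (p + 1)) : IsLeadingForm ψ c τ a p 0 := by
  obtain ⟨F, -, ⟨g, hg⟩, -⟩ := exists_leadingForm_of_mem_pow hI h0 h1 ha
  exact ⟨c F + τ * g, by rw [hg, map_zero]; ring⟩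

variable [I.IsPrime]

/-- The leading form of a product is the product of the leading forms, and polynomials over the
domain `O ⧸ I` form a domain. -/
theorem hasAdditiveOrder_of_derivations (hI : I = Ideal.span (Set.range x))
    (d : ι → Derivation k O (O ⧸ I)) (hd : ∀ i j, d i (x j) = if i = j then 1 else 0) :
    HasAdditiveOrder I := by
  intro a b p q ha ha' hb hb' hab
  have hx (i) : x i ∈ I := hI ▸ Ideal.subset_span ⟨i, rfl⟩
  obtain ⟨S, _, ψ, c, τ, h0, h1, huniq⟩ := exists_leadingForms hx d hd (p + q)
  obtain ⟨F, -, hF, hF'⟩ := exists_leadingForm_of_mem_pow hI h0 h1 ha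
  obtain ⟨G, -, hG, hG'⟩ := exists_leadingForm_of_mem_pow hI h0 h1 hb
  have := huniq _ _ _ _ le_rfl (hF.mul hG) (isLeadingForm_zero_of_mem_pow_succ hI h0 h1 hab)
  rcases mul_eq_zero.mp this with h | h
  · exact ha' (hF' h)
  · exact hb' (hG' h)

theorem coordinate_notMem_sq (hI : I = Ideal.span (Set.range x))
    (d : ι → Derivation k O (O ⧸ I)) (hd : ∀ i j, d i (x j) = if i = j then 1 else 0) (i : ι) :
    x i ∉ I ^ 2 := by
  intro h
  have hx (i) : x i ∈ I := hI ▸ Ideal.subset_span ⟨i, rfl⟩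
  obtain ⟨S, _, ψ, c, τ, h0, h1, huniq⟩ := exists_leadingForms hx d hd 1
  exact MvPolynomial.X_ne_zero i
    (huniq _ _ _ _ le_rfl (h1 i) (isLeadingForm_zero_of_mem_pow_succ hI h0 h1 h))

/-- This is the algebraic form of Hartogs' theorem: a fraction that can be written with denominator
a power of `x i` and also with denominator a power of `x j` has nonnegative order. On leading forms,
`X i ^ e` divides `F * X j ^ e`, hence `F`, which has degree `p`. -/
theorem le_order_of_mul_pow_eq (hI : I = Ideal.span (Set.range x))
    (d : ι → Derivation k O (O ⧸ I)) (hd : ∀ i j, d i (x j) = if i = j then 1 else 0) {i j : ι}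
    (hij : i ≠ j) {a b : O} {p e : ℕ} (ha : a ∈ I ^ p) (ha' : a ∉ I ^ (p + 1))
    (hab : a * x j ^ e = b * x i ^ e) : e ≤ p := by
  have hx (i) : x i ∈ I := hI ▸ Ideal.subset_span ⟨i, rfl⟩
  have hgr := hasAdditiveOrder_of_derivations hI d hd
  have hi : x i ^ e ∉ I ^ (e + 1) := by
    intro h
    obtain ⟨S, _, ψ, c, τ, h0, h1, huniq⟩ := exists_leadingForms hx d hd e
    have := huniq _ _ _ _ le_rfl (by simpa using (h1 i).pow e)
      (isLeadingForm_zero_of_mem_pow_succ hI h0 h1 h)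
    exact pow_ne_zero e (MvPolynomial.X_ne_zero i) this
  -- If `b` had order `q < p`, additivity would give `b * x i ^ e` the order `q + e`, although it
  -- equals `a * x j ^ e`, of order at least `p + e`.
  have hb : ∀ q ≤ p, b ∈ I ^ q := by
    intro q hq
    induction q with
    | zero => simp
    | succ q ih =>
      by_contra h
      refine hgr (ih (by omega)) h (Ideal.pow_mem_pow (hx i) e) hi ?_
      rw [← hab]
      exact Ideal.pow_le_pow_right (by omega)
        (by rw [pow_add]; exact Ideal.mul_mem_mul ha (Ideal.pow_mem_pow (hx j) e) : _ ∈ I ^ (p + e))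
  obtain ⟨S, _, ψ, c, τ, h0, h1, huniq⟩ := exists_leadingForms hx d hd (p + e)
  obtain ⟨F, hFh, hF, hF'⟩ := exists_leadingForm_of_mem_pow hI h0 h1 ha
  obtain ⟨G, -, hG, -⟩ := exists_leadingForm_of_mem_pow hI h0 h1 (hb p le_rfl)
  have h := huniq (a * x j ^ e) (p + e) _ _ le_rfl (by simpa using hF.mul ((h1 j).pow e))
    (by rw [hab]; simpa using hG.mul ((h1 i).pow e))
  have hF0 : F ≠ 0 := fun h => ha' (hF' h)
  have hdvd : (MvPolynomial.X i : MvPolynomial ι (O ⧸ I)) ^ e ∣ F := by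
    refine (MvPolynomial.X_prime (i := i)).pow_dvd_of_dvd_mul_right e ?_ ⟨G, by rw [h, mul_comm]⟩
    intro hdvd
    have := (MvPolynomial.X_prime (i := i)).dvd_of_dvd_pow hdvd
    rw [MvPolynomial.X_dvd_X] at this
    simp [hij] at this
  obtain ⟨H, rfl⟩ := hdvd
  have h2 := hFh.totalDegree hF0
  rw [MvPolynomial.totalDegree_mul_of_isDomain (left_ne_zero_of_mul hF0)
    (right_ne_zero_of_mul hF0), MvPolynomial.totalDegree_X_pow] at h2
  omega

end Order

/-! ### Divisibility by the exceptional equation in a local ring of the blow-up. -/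

section BlowupLocalRing

variable {O K : Type*} [CommRing O] [Field K] [Algebra O K]

/-- The subring `R` of `K` is a local ring of the blow-up of `O` in the ideal `I`, at a point of the
chart given by `t ∈ I`. -/
structure IsBlowupLocalRing (I : Ideal O) (t : O) (R : Subring K) : Prop where
  mem : t ∈ I
  ne_zero : algebraMap O K t ≠ 0
  algebraMap_mem (a : O) : algebraMap O K a ∈ R
  div_mem : ∀ a ∈ I, algebraMap O K a / algebraMap O K t ∈ R
  exists_fraction : ∀ x ∈ R, ∃ e : ℕ, ∃ a ∈ I ^ e, ∃ s ∈ I ^ e, algebraMap O K s ≠ 0 ∧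
    (algebraMap O K s / algebraMap O K t ^ e)⁻¹ ∈ R ∧ x * algebraMap O K s = algebraMap O K a

namespace IsBlowupLocalRing

variable {I : Ideal O} {t : O} {R : Subring K} (H : IsBlowupLocalRing I t R)

include H

theorem div_pow_mem {e : ℕ} {a : O} (ha : a ∈ I ^ e) :
    algebraMap O K a / algebraMap O K t ^ e ∈ R := by
  induction e generalizing a with
  | zero => simpa using H.algebraMap_mem a
  | succ e ih =>
    rw [pow_succ] at ha
    refine Submodule.mul_induction_on ha (fun b hb c hc => ?_) fun b c hb hc => ?_
    · rw [map_mul, pow_succ, mul_div_mul_comm]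
      exact R.mul_mem (ih hb) (H.div_mem c hc)
    · rw [map_add, add_div]
      exact R.add_mem hb hc

theorem change_chart {x : O} (hx : x ∈ I) (hx0 : algebraMap O K x ≠ 0)
    (h : algebraMap O K t / algebraMap O K x ∈ R) : IsBlowupLocalRing I x R where
  mem := hx
  ne_zero := hx0
  algebraMap_mem := H.algebraMap_mem
  div_mem a ha := by
    have := R.mul_mem (H.div_mem a ha) h
    rwa [div_mul_div_cancel₀ H.ne_zero] at this
  exists_fraction y hy := by
    obtain ⟨e, a, ha, s, hs, hs0, hsu, hys⟩ := H.exists_fraction y hy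
    refine ⟨e, a, ha, s, hs, hs0, ?_, hys⟩
    have := R.mul_mem (R.pow_mem (H.div_mem x hx) e) hsu
    rwa [div_pow, inv_div, div_mul_div_cancel₀ (pow_ne_zero _ H.ne_zero), ← inv_div] at this

variable (hinj : Function.Injective (algebraMap O K)) (hI : HasAdditiveOrder I)

include hinj hI

/-- The hypothesis `ht` says that the point lies on the exceptional divisor. Write the quotient as
`b / s` with `s / t ^ f` a unit of `R`. Then `s` has order exactly `f`, since otherwise `t` would be
invertible. So `a * s` has order `e + f`, while it equals `b * t ^ (e + 1)`. -/
theorem div_pow_succ_notMem (ht : (algebraMap O K t)⁻¹ ∉ R) {e : ℕ}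
    {a : O} (ha : a ∈ I ^ e) (ha' : a ∉ I ^ (e + 1)) :
    algebraMap O K a / algebraMap O K t ^ (e + 1) ∉ R := by
  intro h
  obtain ⟨f, b, hb, s, hs, hs0, hsu, hbs⟩ := H.exists_fraction _ h
  have ht0 := H.ne_zero
  by_cases hs' : s ∈ I ^ (f + 1)
  · apply ht
    have := R.mul_mem hsu (H.div_pow_mem hs')
    convert this using 1
    field_simp
    ring
  · refine hI ha ha' hs hs' ?_
    have : a * s = b * t ^ (e + 1) := by
      apply hinj
      rw [map_mul, map_mul, map_pow, ← hbs]
      field_simp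
    rw [this, show e + f + 1 = f + (e + 1) by ring, pow_add]
    exact Ideal.mul_mem_mul hb (Ideal.pow_mem_pow H.mem _)

/-- The exceptional equation generates a prime ideal, or is a unit. Up to units of `R`, elements not
divisible by `t` are `a / t ^ e` with `a` of exact order `e`, and these are stable under products
because the order is additive. -/
theorem div_mem_or_div_mem {x y : K} (hx : x ∈ R) (hy : y ∈ R)
    (hxy : x * y / algebraMap O K t ∈ R) :
    x / algebraMap O K t ∈ R ∨ y / algebraMap O K t ∈ R := by
  by_cases ht : (algebraMap O K t)⁻¹ ∈ R
  · exact .inl (div_eq_mul_inv x _ ▸ R.mul_mem hx ht)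
  have ht0 := H.ne_zero
  by_contra! hcon
  have key {x : K} (hx : x ∈ R) (hx' : x / algebraMap O K t ∉ R) :
      ∃ e : ℕ, ∃ a ∈ I ^ e, a ∉ I ^ (e + 1) ∧ ∃ u ∈ R, x * u = algebraMap O K a /
        algebraMap O K t ^ e := by
    obtain ⟨e, a, ha, s, hs, hs0, hsu, has⟩ := H.exists_fraction _ hx
    refine ⟨e, a, ha, fun ha' => hx' ?_, _, H.div_pow_mem hs, by rw [← has]; ring⟩
    have := R.mul_mem hsu (H.div_pow_mem ha')
    convert this using 1
    rw [← has]
    field_simp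
    ring
  obtain ⟨e, a, ha, ha', u, hu, hxu⟩ := key hx hcon.1
  obtain ⟨f, b, hb, hb', v, hv, hyv⟩ := key hy hcon.2
  refine H.div_pow_succ_notMem hinj hI ht (e := e + f) (a := a * b)
    (by rw [pow_add]; exact Ideal.mul_mem_mul ha hb) (hI ha ha' hb hb') ?_
  have := R.mul_mem hxy (R.mul_mem hu hv)
  convert this using 1
  calc algebraMap O K (a * b) / algebraMap O K t ^ (e + f + 1)
      = (algebraMap O K a / algebraMap O K t ^ e) * (algebraMap O K b / algebraMap O K t ^ f) /
        algebraMap O K t := by rw [map_mul]; field_simp; ring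
    _ = _ := by rw [← hxu, ← hyv]; ring

theorem div_mem_of_pow_div_mem {x : K} (hx : x ∈ R) {N : ℕ} (h : x ^ N / algebraMap O K t ∈ R)
    : x / algebraMap O K t ∈ R := by
  induction N with
  | zero => simpa [div_eq_mul_inv] using R.mul_mem hx h
  | succ N ih =>
    rw [pow_succ] at h
    rcases H.div_mem_or_div_mem hinj hI (R.pow_mem hx N) hx h with h | h
    · exact ih h
    · exact h

-- This selects the exact power of `t` in the denominator of `x`.
omit H hinj hI in
theorem induction_denominator {x : K} {P : Prop} (e : ℕ) (h : algebraMap O K t ^ e * x ∈ R)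
    (hx : x ∉ R) (step : ∀ f, algebraMap O K t ^ (f + 1) * x ∈ R →
      algebraMap O K t ^ f * x ∉ R → P) : P := by
  induction e with
  | zero => exact absurd (by simpa using h) hx
  | succ e ih =>
    by_cases h' : algebraMap O K t ^ e * x ∈ R
    · exact ih h'
    · exact step e h h'

/-- If `x` had a pole along `t`, clearing it minimally would give `c` prime to `t` with `t²`
dividing `c² h`. Primality then moves both factors `t` to `h`, contrary to `hh'`. -/
theorem mem_of_sq_mul_mem {x h : K} (e : ℕ) (hx : algebraMap O K t ^ e * x ∈ R) (hh : h ∈ R)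
    (hh' : h / algebraMap O K t ^ 2 ∈ R → (algebraMap O K t)⁻¹ ∈ R)
    (hxh : x ^ 2 * h ∈ R) : x ∈ R := by
  by_contra hcon
  have ht0 := H.ne_zero
  refine induction_denominator e hx hcon fun f hf hf' => ?_
  have hc : algebraMap O K t ^ (f + 1) * x / algebraMap O K t ∉ R := by
    convert hf' using 2
    field_simp
    ring
  set c := algebraMap O K t ^ (f + 1) * x
  have h1 : c ^ 2 * h / algebraMap O K t ^ 2 ∈ R := by
    have := R.mul_mem hxh (R.pow_mem (H.algebraMap_mem t) (2 * f))
    convert this using 1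
    simp only [c]
    field_simp
    ring
  have step {g : K} (hg : g ∈ R) (hcg : c ^ 2 * g / algebraMap O K t ∈ R) :
      g / algebraMap O K t ∈ R := by
    rw [pow_two, mul_assoc] at hcg
    rcases H.div_mem_or_div_mem hinj hI hf (R.mul_mem hf hg) hcg with h | h
    · exact absurd h hc
    rcases H.div_mem_or_div_mem hinj hI hf hg h with h | h
    · exact absurd h hc
    · exact h
  have h2 : h / algebraMap O K t ∈ R := by
    refine step hh ?_
    have := R.mul_mem h1 (H.algebraMap_mem t)
    convert this using 1
    field_simp
  have h3 : h / algebraMap O K t / algebraMap O K t ∈ R := by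
    refine step h2 ?_
    convert h1 using 1
    field_simp
  have h4 := hh' (by rwa [div_div, ← pow_two] at h3)
  exact hc (div_eq_mul_inv c _ ▸ R.mul_mem hf h4)

/-- Primality of `t` makes `R` integrally closed in `R[1/t]`. Normality of `R` in its whole fraction
field is not needed. -/
theorem mem_of_isIntegral {x : K} (e : ℕ) (hx : algebraMap O K t ^ e * x ∈ R)
    (hint : IsIntegral R x) : x ∈ R := by
  by_contra hcon
  have ht0 := H.ne_zero
  refine induction_denominator e hx hcon fun f hf hf' => hf' ?_
  have hint' : IsIntegral R (algebraMap O K t ^ f * x) :=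
    (isIntegral_algebraMap (x := (⟨_, R.pow_mem (H.algebraMap_mem t) f⟩ : R))).mul hint
  set y := algebraMap O K t ^ f * x
  have hc : algebraMap O K t * y ∈ R := by
    convert hf using 1
    simp only [y]
    ring
  have : y = algebraMap O K t * y / algebraMap O K t := by field_simp
  rw [this]
  obtain ⟨p, hp, hpy⟩ := hint'
  refine H.div_mem_of_pow_div_mem hinj hI hc (N := p.natDegree) ?_
  by_cases hN : p.natDegree = 0
  · rw [hp.natDegree_eq_zero.mp hN] at hpy
    simp at hpy
  rw [Polynomial.eval₂_eq_sum_range, Finset.sum_range_succ, hp.coeff_natDegree, map_one, one_mul]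
    at hpy
  -- The monic equation of `y`, of degree `N`, multiplied by `t ^ (N - 1)`: every lower term becomes
  -- a polynomial in `t * y` and `t` over `R`.
  have h1 : (algebraMap O K t * y) ^ p.natDegree / algebraMap O K t =
      - ∑ i ∈ Finset.range p.natDegree, (algebraMap R K (p.coeff i) * (algebraMap O K t * y) ^ i *
        algebraMap O K t ^ (p.natDegree - 1 - i)) := by
    rw [mul_pow, eq_neg_of_add_eq_zero_right hpy, mul_neg, neg_div, Finset.mul_sum,
      Finset.sum_div]
    congr 1
    refine Finset.sum_congr rfl fun i hi => ?_
    obtain ⟨j, hj⟩ := Nat.exists_eq_add_of_lt (Finset.mem_range.mp hi)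
    rw [hj, show i + j + 1 - 1 - i = j by omega, mul_pow]
    field_simp
    ring
  rw [h1]
  exact R.neg_mem (R.sum_mem fun i _ => R.mul_mem (R.mul_mem (p.coeff i).2 (R.pow_mem hc i))
    (R.pow_mem (H.algebraMap_mem t) _))

end IsBlowupLocalRing

end BlowupLocalRing

/-! ### Quadratic extensions and the normalization over a chart of the blow-up. -/

section Quadratic

variable {K L : Type*} [Field K] [Field L] [Algebra K L]

/-- `L = K ⊕ K z` with `z² = h ∈ K`. -/
structure IsSquareRootGenerator (z : L) (h : K) : Prop where
  sq_eq : z ^ 2 = algebraMap K L h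
  notMem : ∀ a : K, z ≠ algebraMap K L a
  exists_eq : ∀ x : L, ∃ a b : K, x = algebraMap K L a + algebraMap K L b * z

namespace IsSquareRootGenerator

variable {z : L} {h : K} (H : IsSquareRootGenerator z h)

include H

theorem smul {a : K} (ha : a ≠ 0) :
    IsSquareRootGenerator (algebraMap K L a * z) (a ^ 2 * h) where
  sq_eq := by rw [mul_pow, H.sq_eq, map_mul, map_pow]
  notMem b hb := by
    have ha' : algebraMap K L a ≠ 0 := by simpa using ha
    exact H.notMem (b / a) (by rw [map_div₀, eq_div_iff ha', mul_comm, hb])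
  exists_eq x := by
    obtain ⟨b, c, rfl⟩ := H.exists_eq x
    have ha' : algebraMap K L a ≠ 0 := by simpa using ha
    refine ⟨b, c / a, ?_⟩
    rw [map_div₀]
    field_simp

theorem eq_and_eq {a b c d : K} (hab : algebraMap K L a + algebraMap K L b * z =
    algebraMap K L c + algebraMap K L d * z) : a = c ∧ b = d := by
  have hbd : b = d := by
    by_contra hbd
    have h0 : algebraMap K L (b - d) ≠ 0 := by simpa [sub_eq_zero] using hbd
    refine H.notMem ((c - a) / (b - d)) ?_
    rw [map_div₀, eq_div_iff h0, map_sub, map_sub]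
    linear_combination hab
  subst hbd
  simpa using hab

/-- The basis `1, z`. -/
noncomputable def basis : Module.Basis (Fin 2) K L :=
  Module.Basis.mk (v := ![1, z])
    (by
      rw [LinearIndependent.pair_iff]
      intro a b hab
      have := H.eq_and_eq (a := a) (b := b) (c := 0) (d := 0) (by simpa [Algebra.smul_def] using hab)
      exact this)
    (by
      rintro x -
      obtain ⟨a, b, rfl⟩ := H.exists_eq x
      rw [← Algebra.smul_def, Algebra.algebraMap_eq_smul_one]
      exact Submodule.add_mem _ (Submodule.smul_mem _ _ (Submodule.subset_span ⟨0, rfl⟩))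
        (Submodule.smul_mem _ _ (Submodule.subset_span ⟨1, rfl⟩)))

theorem leftMulMatrix_eq (a b : K) :
    Algebra.leftMulMatrix H.basis (algebraMap K L a + algebraMap K L b * z) =
      !![a, b * h; b, a] := by
  have h0 : H.basis 0 = 1 := by simp [basis]
  have h1 : H.basis 1 = z := by simp [basis]
  have hr (c d : K) : H.basis.repr (algebraMap K L c + algebraMap K L d * z) =
      Finsupp.single 0 c + Finsupp.single 1 d := by
    have : algebraMap K L c + algebraMap K L d * z = c • H.basis 0 + d • H.basis 1 := by
      rw [h0, h1, Algebra.smul_def, Algebra.smul_def, mul_one]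
    rw [this, map_add, map_smul, map_smul, Module.Basis.repr_self, Module.Basis.repr_self]
    simp
  have e0 : (algebraMap K L a + algebraMap K L b * z) * H.basis 0 =
      algebraMap K L a + algebraMap K L b * z := by rw [h0, mul_one]
  have e1 : (algebraMap K L a + algebraMap K L b * z) * H.basis 1 =
      algebraMap K L (b * h) + algebraMap K L a * z := by
    rw [h1, map_mul, ← H.sq_eq]
    ring
  ext i j
  rw [Algebra.leftMulMatrix_eq_repr_mul]
  fin_cases j
  · simp only [Fin.zero_eta, e0, hr]
    fin_cases i <;> simp
  · simp only [Fin.mk_one, e1, hr]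
    fin_cases i <;> simp

theorem trace_eq (a b : K) :
    Algebra.trace K L (algebraMap K L a + algebraMap K L b * z) = 2 * a := by
  rw [Algebra.trace_eq_matrix_trace H.basis, H.leftMulMatrix_eq, Matrix.trace_fin_two]
  simp [two_mul]

theorem norm_eq (a b : K) :
    Algebra.norm K (algebraMap K L a + algebraMap K L b * z) = a ^ 2 - b ^ 2 * h := by
  rw [Algebra.norm_eq_matrix_det H.basis, H.leftMulMatrix_eq, Matrix.det_fin_two]
  simp
  ring

theorem finiteDimensional : FiniteDimensional K L := Module.Finite.of_basis H.basis

end IsSquareRootGenerator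

/-- `R ⊕ R z`, as a subset of `L`. -/
def doubleCoverRing (R : Subring K) (z : L) : Set L :=
  {x | ∃ a ∈ R, ∃ b ∈ R, x = algebraMap K L a + algebraMap K L b * z}

variable {O : Type*} [CommRing O] [Algebra O K]

variable (K) in
/-- The subring `O[1/t]` of `K`. -/
def invSubring (t : O) : Subring K where
  carrier := {x | ∃ e : ℕ, ∃ a : O, algebraMap O K t ^ e * x = algebraMap O K a}
  mul_mem' := by
    rintro x y ⟨e, a, ha⟩ ⟨f, b, hb⟩
    exact ⟨e + f, a * b, by rw [map_mul, ← ha, ← hb]; ring⟩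
  one_mem' := ⟨0, 1, by simp⟩
  add_mem' := by
    rintro x y ⟨e, a, ha⟩ ⟨f, b, hb⟩
    exact ⟨e + f, a * t ^ f + b * t ^ e, by simp only [map_mul, map_pow, map_add, ← ha, ← hb]; ring⟩
  zero_mem' := ⟨0, 0, by simp⟩
  neg_mem' := by
    rintro x ⟨e, a, ha⟩
    exact ⟨e, -a, by rw [map_neg, ← ha]; ring⟩

/-- `R` is the localization of `R ∩ O[1/t]` at the elements whose inverse lies in `R`. An integral
equation over a localization becomes integral over the ring itself after multiplication by a
denominator. -/
theorem IsBlowupLocalRing.exists_isIntegral_invSubring {I : Ideal O} {t : O} {R : Subring K}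
    (H : IsBlowupLocalRing I t R) {x : L} (hx : IsIntegral R x) :
    ∃ s ∈ invSubring K t, s⁻¹ ∈ R ∧ s ∈ R ∧ s ≠ 0 ∧
      IsIntegral (invSubring K t) (algebraMap K L s * x) := by
  let T : Subring K := R ⊓ invSubring K t
  let M : Submonoid T :=
    { carrier := {s | (s : K)⁻¹ ∈ R ∧ (s : K) ≠ 0}
      mul_mem' := fun {a b} ha hb => ⟨by
        rw [Subring.coe_mul, mul_inv]
        exact R.mul_mem ha.1 hb.1, by rw [Subring.coe_mul]; exact mul_ne_zero ha.2 hb.2⟩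
      one_mem' := ⟨by simp, by simp⟩ }
  let _ : Algebra T R := (Subring.inclusion inf_le_left).toAlgebra
  have : IsScalarTower T R L := .of_algebraMap_eq fun _ => rfl
  have : IsLocalization M R :=
    { map_units := fun s => by
        refine IsUnit.of_mul_eq_one (⟨_, s.2.1⟩ : R) ?_
        exact Subtype.ext (mul_inv_cancel₀ s.2.2)
      surj := fun y => by
        obtain ⟨e, a, ha, s, hs, hs0, hsu, h⟩ := H.exists_fraction y.1 y.2
        have mem {a : O} (ha : a ∈ I ^ e) : algebraMap O K a / algebraMap O K t ^ e ∈ T :=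
          ⟨H.div_pow_mem ha, e, a, by have := H.ne_zero; field_simp⟩
        refine ⟨(⟨_, mem ha⟩, ⟨⟨_, mem hs⟩, hsu, ?_⟩), Subtype.ext ?_⟩
        · exact div_ne_zero hs0 (pow_ne_zero _ H.ne_zero)
        · change y.1 * (algebraMap O K s / algebraMap O K t ^ e) = _
          rw [← mul_div_assoc, h]
          rfl
      exists_of_eq := fun {a b} hab => ⟨1, by
        have h : (a : K) = b := congrArg (fun y : R => (y : K)) hab
        rw [Subtype.ext h]⟩ }
  obtain ⟨s, hs⟩ := IsIntegral.exists_multiple_integral_of_isLocalization M x hx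
  refine ⟨s.1.1, s.1.2.2, s.2.1, s.1.2.1, s.2.2, ?_⟩
  let _ : Algebra T (invSubring K t) := (Subring.inclusion inf_le_right).toAlgebra
  have : IsScalarTower T (invSubring K t) L := .of_algebraMap_eq fun _ => rfl
  have := hs.tower_top (A := invSubring K t)
  rwa [Submonoid.smul_def, Algebra.smul_def, IsScalarTower.algebraMap_apply T K L] at this

/-- Condition `hN` says that the cover is already normal where `t` is invertible, so only powers of
`t` can occur as denominators. The trace `2 α` and the norm `α² - β² h'` of an integral element are
integral over `R`, hence in `R`. Since `t²` does not divide `h'` unless `t` is a unit, `β` has no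
pole either. -/
theorem IsBlowupLocalRing.isIntegral_iff {I : Ideal O} {t : O} {R : Subring K}
    (H : IsBlowupLocalRing I t R) (hinj : Function.Injective (algebraMap O K))
    (hI : HasAdditiveOrder I) {z : L} {h : O} {m : ℕ} (hz : IsSquareRootGenerator z (algebraMap O K h))
    (hm : h ∈ I ^ m) (hm' : h ∉ I ^ (m + 1)) (h2 : (2 : K)⁻¹ ∈ R) (h2' : (2 : K) ≠ 0)
    (hN : ∀ x : L, IsIntegral (invSubring K t) x →
      ∃ (e : ℕ) (a b : O), algebraMap K L (algebraMap O K t) ^ e * x =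
        algebraMap K L (algebraMap O K a) + algebraMap K L (algebraMap O K b) * z) (x : L) :
    IsIntegral R x ↔
      x ∈ doubleCoverRing R (algebraMap K L (algebraMap O K t ^ (m / 2))⁻¹ * z) := by
  have ht0 := H.ne_zero
  have hmq : m = m / 2 + m / 2 + m % 2 := by omega
  set q := m / 2
  have hz' := hz.smul (a := (algebraMap O K t ^ q)⁻¹) (inv_ne_zero (pow_ne_zero _ ht0))
  set z' := algebraMap K L (algebraMap O K t ^ q)⁻¹ * z with hz'def
  set h' := ((algebraMap O K t ^ q)⁻¹) ^ 2 * algebraMap O K h with hh'def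
  have hh' : h' ∈ R := by
    have := R.mul_mem (H.div_pow_mem hm) (R.pow_mem (H.algebraMap_mem t) (m % 2))
    convert this using 1
    rw [hh'def]
    field_simp
    have e : algebraMap O K t ^ m = (algebraMap O K t ^ q) ^ 2 * algebraMap O K t ^ (m % 2) := by
      rw [← pow_mul, ← pow_add]
      congr 1
      omega
    linear_combination algebraMap O K h * e
  -- Here `h' / t²` is `h / t ^ (2q + 2)`, and `2q + 2` exceeds `m + 1` by `1 - m % 2`; after
  -- correcting by that power of `t`, the exact order of `h` gives the contradiction.
  have hh'' : h' / algebraMap O K t ^ 2 ∈ R → (algebraMap O K t)⁻¹ ∈ R := by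
    intro hmem
    by_contra ht
    refine H.div_pow_succ_notMem hinj hI ht hm hm' ?_
    have := R.mul_mem hmem (R.pow_mem (H.algebraMap_mem t) (1 - m % 2))
    convert this using 1
    rw [hh'def]
    field_simp
    have e : (algebraMap O K t ^ q) ^ 2 * algebraMap O K t ^ 2 =
        algebraMap O K t ^ (m + 1) * algebraMap O K t ^ (1 - m % 2) := by
      rw [← pow_mul, ← pow_add, ← pow_add]
      congr 1
      omega
    linear_combination algebraMap O K h * e
  constructor
  · intro hx
    obtain ⟨s, ⟨e₁, a₁, hs₁⟩, hsu, hs, hs0, hsx⟩ := H.exists_isIntegral_invSubring hx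
    obtain ⟨e, a, b, hab⟩ := hN _ hsx
    obtain ⟨α, β, rfl⟩ := hz'.exists_eq x
    have hL (y : K) : y ≠ 0 → algebraMap K L y ≠ 0 := by simp
    have h1 : algebraMap K L (algebraMap O K t ^ e * s * α) +
        algebraMap K L (algebraMap O K t ^ e * s * β * (algebraMap O K t ^ q)⁻¹) * z =
        algebraMap K L (algebraMap O K a) + algebraMap K L (algebraMap O K b) * z := by
      rw [← hab, hz'def]
      simp only [map_mul, map_pow]
      ring
    obtain ⟨hα, hβ⟩ := hz.eq_and_eq h1
    have hα' : algebraMap O K t ^ e * α ∈ R := by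
      have := R.mul_mem (H.algebraMap_mem a) hsu
      convert this using 1
      rw [← hα]
      field_simp
    have hβ' : algebraMap O K t ^ e * β ∈ R := by
      have := R.mul_mem (R.mul_mem (H.algebraMap_mem b) hsu)
        (R.pow_mem (H.algebraMap_mem t) q)
      convert this using 1
      rw [← hβ]
      field_simp
    have := hz.finiteDimensional
    have hαR : α ∈ R := by
      have := Algebra.isIntegral_trace (R := R) (L := K) hx
      rw [hz'.trace_eq] at this
      have h3 := H.mem_of_isIntegral hinj hI e (by
        have := R.add_mem hα' hα'
        rwa [← two_mul, mul_left_comm] at this) this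
      have h4 := R.mul_mem h2 h3
      rwa [inv_mul_cancel_left₀ h2'] at h4
    have hnorm : α ^ 2 - β ^ 2 * h' ∈ R := by
      have := Algebra.isIntegral_norm (R := R) K hx
      rw [hz'.norm_eq] at this
      refine H.mem_of_isIntegral hinj hI (2 * e) ?_ this
      have := R.sub_mem (R.pow_mem hα' 2) (R.mul_mem (R.pow_mem hβ' 2) hh')
      convert this using 1
      ring
    have hβR : β ∈ R := by
      refine H.mem_of_sq_mul_mem hinj hI e hβ' hh' hh'' ?_
      have := R.sub_mem (R.pow_mem hαR 2) hnorm
      convert this using 1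
      ring
    exact ⟨α, hαR, β, hβR, rfl⟩
  · rintro ⟨a, ha, b, hb, rfl⟩
    have hint : IsIntegral R z' := by
      refine IsIntegral.of_pow two_pos ?_
      rw [hz'.sq_eq]
      exact isIntegral_algebraMap (x := (⟨h', hh'⟩ : R))
    exact (isIntegral_algebraMap (x := (⟨a, ha⟩ : R))).add
      ((isIntegral_algebraMap (x := (⟨b, hb⟩ : R))).mul hint)

end Quadratic

/-! ### Determinants and alternating maps. -/

section AlternatingMaps

/-- Both sides are alternating in the rows of `A`, so it suffices to compare them on permutations of
the standard basis. -/
theorem alternatingMap_sum_smul {R M N ι : Type*} [CommRing R] [AddCommGroup M] [Module R M]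
    [AddCommGroup N] [Module R N] [Fintype ι] [DecidableEq ι] (g : M [⋀^ι]→ₗ[R] N)
    (A : Matrix ι ι R) (v : ι → M) : g (fun i => ∑ j, A i j • v j) = A.det • g v := by
  let T : (ι → R) →ₗ[R] M := Fintype.linearCombination R v
  have h : g.compLinearMap T =
      (LinearMap.toSpanSingleton R N (g v)).compAlternatingMap Matrix.detRowAlternating := by
    refine Module.Basis.ext_alternating (Pi.basisFun R ι) fun σ hσ => ?_
    let σ' := Equiv.ofBijective σ (Finite.injective_iff_bijective.mp hσ)
    have h1 : (fun i => (Pi.basisFun R ι) (σ i)) = (fun i => (Pi.basisFun R ι) i) ∘ σ' := rfl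
    rw [h1, AlternatingMap.map_perm, AlternatingMap.map_perm]
    congr 1
    have h2 : (fun i => T (Pi.basisFun R ι i)) = v := by
      ext i
      simp [T, Fintype.linearCombination_apply]
    have h3 : Matrix.detRowAlternating (fun i => Pi.basisFun R ι i) = 1 := by
      have : (fun i => Pi.basisFun R ι i) = (1 : Matrix ι ι R) := by
        ext i j
        simp [Matrix.one_apply, Pi.single_apply, eq_comm]
      rw [this]
      exact Matrix.det_one
    change g (fun i => T (Pi.basisFun R ι i)) =
      (Matrix.detRowAlternating (fun i => Pi.basisFun R ι i)) • g v
    rw [h2, h3, one_smul]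
  exact congrArg (fun f : (ι → R) [⋀^ι]→ₗ[R] N => f A) h

/-- The terms `c i • v l` drop out against the entry `v l`, which is kept. Each index of `T` leaves
one factor `t`; on the blow-up this produces the exponent `r - 1`. -/
theorem alternatingMap_eq_pow_smul {R M N ι : Type*} [CommRing R] [AddCommGroup M] [Module R M]
    [AddCommGroup N] [Module R N] [DecidableEq ι] (g : M [⋀^ι]→ₗ[R] N) {v w : ι → M} {l : ι}
    {c : ι → R} {t : R} (T : Finset ι) (hl : l ∉ T) (hT : ∀ i ∈ T, v i = c i • v l + t • w i)
    (hT' : ∀ i ∉ T, v i = w i) : g v = t ^ T.card • g w := by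
  induction T using Finset.induction_on generalizing v with
  | empty => simp [show v = w from funext fun i => hT' i (by simp)]
  | insert i T hi ih =>
    have hli : l ≠ i := fun h => hl (by simp [h])
    have h1 : v = Function.update v i (c i • v l + t • w i) := by
      rw [← hT i (by simp), Function.update_eq_self]
    rw [h1, AlternatingMap.map_update_add, AlternatingMap.map_update_smul,
      AlternatingMap.map_update_smul, AlternatingMap.map_update_self g v hli.symm, smul_zero,
      zero_add, ih (v := Function.update v i (w i)) (fun h => hl (by simp [h])), smul_smul,
      Finset.card_insert_of_notMem hi, pow_succ']
    · intro j hj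
      have hji : j ≠ i := fun h => hi (h ▸ hj)
      rw [Function.update_of_ne hji, Function.update_of_ne hli, hT j (by simp [hj])]
    · intro j hj
      by_cases hji : j = i
      · subst hji
        simp
      · rw [Function.update_of_ne hji, hT' j (by simp [hji, hj])]

end AlternatingMaps

/-! ### Top differential forms on the base and on the blow-up. -/

section Forms

open KaehlerDifferential

variable {k K : Type u} [Field k] [Field K] [Algebra k K] {n : ℕ}

/-- If the `dw i` generate all differentials of elements of `R`, every generating form of the
lattice is a determinant over `R` times their wedge product. -/
theorem formLattice_eq_span_singleton (R : Subring K) (w : Fin n → K) (hw : ∀ i, w i ∈ R)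
    (h : ∀ a ∈ R, D k K a ∈ Submodule.span R (Set.range fun i => D k K (w i))) :
    formLattice k K n R =
      Submodule.span R {exteriorPower.ιMulti K n fun i => D k K (w i)} := by
  apply le_antisymm
  · refine Submodule.span_le.mpr ?_
    rintro _ ⟨a, ha, rfl⟩
    have (i : Fin n) : ∃ c : Fin n → R, ∑ j, c j • D k K (w j) = D k K (a i) :=
      (Submodule.mem_span_range_iff_exists_fun R).mp (h _ (ha i))
    choose c hc using this
    have h1 : (fun i => D k K (a i)) =
        fun i => ∑ j, (Matrix.of c).map (algebraMap R K) i j • D k K (w j) := by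
      ext1 i
      rw [← hc]
      rfl
    rw [h1, alternatingMap_sum_smul, ← RingHom.mapMatrix_apply, ← RingHom.map_det]
    exact Submodule.smul_mem _ (Matrix.of c).det (Submodule.mem_span_singleton_self _)
  · refine Submodule.span_le.mpr ?_
    rintro _ rfl
    exact Submodule.subset_span ⟨w, hw, rfl⟩

theorem exteriorPower_eq_smul_ιMulti {M : Type*} [AddCommGroup M] [Module K M]
    (e : Module.Basis (Fin n) K M) (v : ⋀[K]^n M) : ∃ c : K, v = c • exteriorPower.ιMulti K n e := by
  have hv : v ∈ Submodule.span K (Set.range (exteriorPower.ιMulti K n (M := M))) := by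
    rw [exteriorPower.ιMulti_span]; trivial
  induction hv using Submodule.span_induction with
  | mem x hx =>
    obtain ⟨a, rfl⟩ := hx
    refine ⟨e.det a, ?_⟩
    rw [Module.Basis.det_apply, ← Matrix.det_transpose, ← alternatingMap_sum_smul]
    congr 1
    ext1 i
    conv_lhs => rw [← e.sum_repr (a i)]
    rfl
  | zero => exact ⟨0, by simp⟩
  | add x y _ _ hx hy =>
    obtain ⟨c, rfl⟩ := hx
    obtain ⟨d, rfl⟩ := hy
    exact ⟨c + d, by rw [add_smul]⟩
  | smul a x _ hx =>
    obtain ⟨c, rfl⟩ := hx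
    exact ⟨a * c, by rw [mul_smul]⟩

theorem ιMulti_basis_ne_zero {M : Type*} [AddCommGroup M] [Module K M]
    (e : Module.Basis (Fin n) K M) : exteriorPower.ιMulti K n e ≠ 0 := by
  intro h
  have := exteriorPower.alternatingMapLinearEquiv_apply_ιMulti e.det e
  rw [h, map_zero, e.det_self] at this
  exact zero_ne_one this

variable {O : Type u} [CommRing O] [Algebra k O] [Algebra O K] [IsScalarTower k O K]

theorem algebraMap_D_mem_span {x : Fin n → O} (hx : Submodule.span O (Set.range fun i => D k O (x i)) = ⊤)
    {R : Subring K} (hR : ∀ a, algebraMap O K a ∈ R) {N : Submodule R (Ω[K⁄k])}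
    (hN : ∀ i, D k K (algebraMap O K (x i)) ∈ N) (a : O) : D k K (algebraMap O K a) ∈ N := by
  have ha : D k O a ∈ Submodule.span O (Set.range fun i => D k O (x i)) := by rw [hx]; trivial
  obtain ⟨c, hc⟩ := (Submodule.mem_span_range_iff_exists_fun O).mp ha
  have := congrArg (KaehlerDifferential.map k k O K) hc
  rw [map_sum, map_D] at this
  rw [← this]
  refine Submodule.sum_mem _ fun i _ => ?_
  rw [map_smul, map_D, ← algebraMap_smul K (c i)]
  exact N.smul_mem (⟨_, hR _⟩ : R) (hN i)

/-- A basis of the differentials over a domain gives a basis over its fraction field. -/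
noncomputable def kaehlerBasis [IsDomain O] [IsFractionRing O K]
    (e : Module.Basis (Fin n) O (Ω[O⁄k])) : Module.Basis (Fin n) K (Ω[K⁄k]) :=
  have := KaehlerDifferential.isLocalizedModule_map (R := k) (S := O) (T := K) (nonZeroDivisors O)
  e.ofIsLocalizedModule K (nonZeroDivisors O) (KaehlerDifferential.map k k O K)

theorem kaehlerBasis_apply [IsDomain O] [IsFractionRing O K]
    (e : Module.Basis (Fin n) O (Ω[O⁄k])) {x : Fin n → O} (hx : ∀ i, e i = D k O (x i)) (i : Fin n) :
    kaehlerBasis (K := K) e i = D k K (algebraMap O K (x i)) := by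
  have := KaehlerDifferential.isLocalizedModule_map (R := k) (S := O) (T := K) (nonZeroDivisors O)
  rw [kaehlerBasis, Module.Basis.ofIsLocalizedModule_apply, hx, map_D]

/-- Coordinates on the chart of the blow-up given by `x l`. -/
noncomputable def blowupCoordinates (K : Type u) [Field K] [Algebra O K] (x : Fin n → O) (r : ℕ) (l : Fin n) (i : Fin n) : K :=
  if i.val < r ∧ i ≠ l then algebraMap O K (x i) / algebraMap O K (x l) else algebraMap O K (x i)

omit [Algebra k O] [IsScalarTower k O K] in
theorem D_coordinate {x : Fin n → O} {r : ℕ} {l : Fin n} (hl : algebraMap O K (x l) ≠ 0)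
    {i : Fin n} (hi : i.val < r ∧ i ≠ l) :
    D k K (algebraMap O K (x i)) =
      (algebraMap O K (x i) / algebraMap O K (x l)) • D k K (algebraMap O K (x l)) +
        algebraMap O K (x l) • D k K (blowupCoordinates K x r l i) := by
  have : algebraMap O K (x i) =
      algebraMap O K (x l) * (algebraMap O K (x i) / algebraMap O K (x l)) := by field_simp
  rw [blowupCoordinates, if_pos hi]
  conv_lhs => rw [this]
  rw [Derivation.leibniz, add_comm]

/-- The elements of `R` with differential in `N`. -/
def differentialSubring (R : Subring K) (N : Submodule R (Ω[K⁄k])) : Subring K where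
  carrier := {a | a ∈ R ∧ D k K a ∈ N}
  mul_mem' {a b} ha hb := ⟨R.mul_mem ha.1 hb.1, by
    rw [Derivation.leibniz]
    exact N.add_mem (N.smul_mem (⟨a, ha.1⟩ : R) hb.2) (N.smul_mem (⟨b, hb.1⟩ : R) ha.2)⟩
  one_mem' := ⟨R.one_mem, by simp⟩
  add_mem' {a b} ha hb := ⟨R.add_mem ha.1 hb.1, by
    rw [map_add]
    exact N.add_mem ha.2 hb.2⟩
  zero_mem' := ⟨R.zero_mem, by simp⟩
  neg_mem' {a} ha := ⟨R.neg_mem ha.1, by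
    rw [map_neg]
    exact N.neg_mem ha.2⟩

theorem inv_mem_differentialSubring {R : Subring K} {N : Submodule R (Ω[K⁄k])} {a : K}
    (ha : a ∈ differentialSubring R N) (ha' : a⁻¹ ∈ R) : a⁻¹ ∈ differentialSubring R N := by
  refine ⟨ha', ?_⟩
  rw [Derivation.leibniz_inv, neg_smul]
  exact N.neg_mem (N.smul_mem (⟨a⁻¹ ^ 2, R.pow_mem ha' 2⟩ : R) ha.2)

-- Every element of `R` is a quotient of elements `a / t ^ e` whose denominator is a unit of `R`. A
-- subring with `O`, `I / t` and the relevant inverses therefore exhausts `R`.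
omit [Algebra k O] [IsScalarTower k O K] in
theorem IsBlowupLocalRing.le_subring {I : Ideal O} {t : O} {R : Subring K}
    (H : IsBlowupLocalRing I t R) {T : Subring K} (hTO : ∀ a, algebraMap O K a ∈ T)
    (hTI : ∀ a ∈ I, algebraMap O K a / algebraMap O K t ∈ T)
    (hinv : ∀ a ∈ T, a⁻¹ ∈ R → a⁻¹ ∈ T) : R ≤ T := by
  have hpow (e : ℕ) : ∀ a ∈ I ^ e, algebraMap O K a / algebraMap O K t ^ e ∈ T := by
    induction e with
    | zero => intro a _; simpa using hTO a
    | succ e ih =>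
      intro a ha
      rw [pow_succ] at ha
      refine Submodule.mul_induction_on ha (fun b hb c hc => ?_) fun b c hb hc => ?_
      · rw [map_mul, pow_succ, mul_div_mul_comm]
        exact T.mul_mem (ih b hb) (hTI c hc)
      · rw [map_add, add_div]
        exact T.add_mem hb hc
  intro y hy
  obtain ⟨e, a, ha, s, hs, hs0, hsu, h⟩ := H.exists_fraction y hy
  have hy' : y = algebraMap O K a / algebraMap O K t ^ e *
      (algebraMap O K s / algebraMap O K t ^ e)⁻¹ := by
    have := H.ne_zero
    rw [← h]
    field_simp
  rw [hy']
  exact T.mul_mem (hpow e a ha) (hinv _ (hpow e s hs) hsu)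

/-- The elements whose differential lies in the span form a subring closed under inverses in `R`, by
the Leibniz and quotient rules. It contains `O` because `dx i = (x i / x l) dx l + x l d(x i / x
l)`, and it contains the quotients `x i / x l`, which generate `I / x l`. -/
theorem IsBlowupLocalRing.D_mem_span {I : Ideal O} {x : Fin n → O} {r : ℕ} {l : Fin n}
    (hlr : l.val < r) {R : Subring K} (H : IsBlowupLocalRing I (x l) R)
    (hI : I = Ideal.span {y | ∃ i : Fin n, i.val < r ∧ x i = y})
    (hx : Submodule.span O (Set.range fun i => D k O (x i)) = ⊤) {y : K} (hy : y ∈ R) :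
    D k K y ∈ Submodule.span R (Set.range fun i => D k K (blowupCoordinates K x r l i)) := by
  set N := Submodule.span R (Set.range fun i => D k K (blowupCoordinates K x r l i))
  have hN (i) : D k K (blowupCoordinates K x r l i) ∈ N := Submodule.subset_span ⟨i, rfl⟩
  have hxI (i : Fin n) (hi : i.val < r) : x i ∈ I := hI ▸ Ideal.subset_span ⟨i, hi, rfl⟩
  have hNl : D k K (algebraMap O K (x l)) ∈ N := by
    simpa [blowupCoordinates] using hN l
  have hO (a : O) : algebraMap O K a ∈ differentialSubring R N := by
    refine ⟨H.algebraMap_mem a, algebraMap_D_mem_span hx H.algebraMap_mem (fun i => ?_) a⟩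
    by_cases hi : i.val < r ∧ i ≠ l
    · rw [D_coordinate (r := r) H.ne_zero hi]
      exact N.add_mem (N.smul_mem (⟨_, H.div_mem _ (hxI i hi.1)⟩ : R) hNl)
        (N.smul_mem (⟨_, H.algebraMap_mem _⟩ : R) (hN i))
    · simpa [blowupCoordinates, hi] using hN i
  refine (H.le_subring hO (fun a ha => ?_) (fun a => inv_mem_differentialSubring) hy).2
  rw [hI] at ha
  induction ha using Submodule.span_induction with
  | mem y hy =>
    obtain ⟨i, hi, rfl⟩ := hy
    by_cases hil : i = l
    · subst hil
      rw [div_self H.ne_zero]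
      exact Subring.one_mem _
    · exact ⟨H.div_mem _ (hxI i hi), by simpa [blowupCoordinates, hi, hil] using hN i⟩
  | zero => simp
  | add a b _ _ ha hb =>
    rw [map_add, add_div]
    exact Subring.add_mem _ ha hb
  | smul a b hb hb' =>
    rw [smul_eq_mul, map_mul, mul_div_assoc]
    exact Subring.mul_mem _ (hO a) hb'

/-- Passing to the chart coordinates divides `r - 1` of the differentials by `x l`: all the
equations of the centre except `x l` itself. This is the discrepancy of the blow-up. -/
theorem IsBlowupLocalRing.formLattice_eq {I : Ideal O} {x : Fin n → O} {r : ℕ} {l : Fin n}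
    (hlr : l.val < r) (hrn : r ≤ n) {R : Subring K} (H : IsBlowupLocalRing I (x l) R)
    (hI : I = Ideal.span {y | ∃ i : Fin n, i.val < r ∧ x i = y})
    (hx : Submodule.span O (Set.range fun i => D k O (x i)) = ⊤) :
    formLattice k K n R = Submodule.span R {(algebraMap O K (x l) ^ (r - 1))⁻¹ •
      exteriorPower.ιMulti K n fun i => D k K (algebraMap O K (x i))} := by
  have hxI (i : Fin n) (hi : i.val < r) : x i ∈ I := hI ▸ Ideal.subset_span ⟨i, hi, rfl⟩
  have key := alternatingMap_eq_pow_smul (exteriorPower.ιMulti K n)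
    (v := fun i => D k K (algebraMap O K (x i)))
    (w := fun i => D k K (blowupCoordinates K x r l i)) (l := l)
    (c := fun i => algebraMap O K (x i) / algebraMap O K (x l)) (t := algebraMap O K (x l))
    ((Finset.univ.filter fun i : Fin n => i.val < r).erase l) (by simp)
    (fun i hi => by
      simp only [Finset.mem_erase, Finset.mem_filter, Finset.mem_univ, true_and] at hi
      exact D_coordinate H.ne_zero ⟨hi.2, hi.1⟩)
    (fun i hi => by
      simp only [Finset.mem_erase, Finset.mem_filter, Finset.mem_univ, true_and] at hi
      rw [blowupCoordinates, if_neg (fun h => hi ⟨h.2, h.1⟩)])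
  rw [Finset.card_erase_of_mem (by simpa using hlr), Fin.card_filter_val_lt, min_eq_right hrn]
    at key
  rw [formLattice_eq_span_singleton R (blowupCoordinates K x r l) ?_
    fun a ha => H.D_mem_span hlr hI hx ha]
  · rw [key, inv_smul_smul₀ (pow_ne_zero _ H.ne_zero)]
  · intro i
    rw [blowupCoordinates]
    split_ifs with hi
    · exact H.div_mem _ (hxI i hi.1)
    · exact H.algebraMap_mem _

theorem formLattice_range_eq {x : Fin n → O} {R : Subring K} (hR : ∀ a, a ∈ R ↔ ∃ b, algebraMap O K b = a)
    (hx : Submodule.span O (Set.range fun i => D k O (x i)) = ⊤) :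
    formLattice k K n R = Submodule.span R
      {exteriorPower.ιMulti K n fun i => D k K (algebraMap O K (x i))} := by
  refine formLattice_eq_span_singleton R (fun i => algebraMap O K (x i))
    (fun i => (hR (algebraMap O K (x i))).mpr ⟨x i, rfl⟩) fun a ha => ?_
  obtain ⟨b, rfl⟩ := (hR _).mp ha
  exact algebraMap_D_mem_span hx (fun a => (hR (algebraMap O K a)).mpr ⟨a, rfl⟩)
    (fun i => Submodule.subset_span (Set.mem_range_self i)) b

end Forms

/-! ### Functoriality of differential forms. -/

section Functoriality

open KaehlerDifferential

variable {k K K' : Type u} [Field k] [Field K] [Algebra k K] [Field K'] [Algebra k K']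
  [Algebra K K'] [IsScalarTower k K K']

/-- The map on `n`-forms induced by a homomorphism of fields. -/
noncomputable def formMap (k K K' : Type u) [Field k] [Field K] [Algebra k K] [Field K']
    [Algebra k K'] [Algebra K K'] [IsScalarTower k K K'] (n : ℕ) :
    ⋀[K]^n Ω[K⁄k] →ₗ[K] ⋀[K']^n Ω[K'⁄k] :=
  exteriorPower.alternatingMapLinearEquiv
    ((AlternatingMap.mk ((exteriorPower.ιMulti K' n (M := Ω[K'⁄k])).toMultilinearMap.restrictScalars K)
      (exteriorPower.ιMulti K' n (M := Ω[K'⁄k])).map_eq_zero_of_eq').compLinearMap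
      (KaehlerDifferential.map k k K K'))

theorem formMap_ιMulti (n : ℕ) (a : Fin n → K) :
    formMap k K K' n (exteriorPower.ιMulti K n fun i => D k K (a i)) =
      exteriorPower.ιMulti K' n fun i => D k K' (algebraMap K K' (a i)) := by
  rw [formMap, exteriorPower.alternatingMapLinearEquiv_apply_ιMulti]
  simp only [AlternatingMap.compLinearMap_apply, map_D]
  rfl

end Functoriality

/-! ### Coordinates adapted to a smooth subvariety. -/

section Coordinates

open KaehlerDifferential TensorProduct IsLocalRing

variable {k O Q : Type u} [Field k] [CommRing O] [IsLocalRing O] [IsNoetherianRing O] [Algebra k O]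
  [Module.Finite O (Ω[O⁄k])] [Module.Free O (Ω[O⁄k])]

/-- Over a local ring a basis of a finite free module can be extracted from any generating set, here
from the exact differentials. -/
theorem exists_basis_D : ∃ (x : Fin (Module.finrank O (Ω[O⁄k])) → O)
    (e : Module.Basis (Fin (Module.finrank O (Ω[O⁄k]))) O (Ω[O⁄k])), ∀ i, e i = D k O (x i) := by
  have : Module.FinitePresentation O (Ω[O⁄k]) := Module.finitePresentation_of_finite _ _
  obtain ⟨ι, a, b, hb⟩ := Module.exists_basis_of_span_of_flat (R := O) (D k O)
    (span_range_derivation k O)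
  have : Finite ι := Module.Finite.finite_basis b
  have := Fintype.ofFinite ι
  have e : ι ≃ Fin (Module.finrank O (Ω[O⁄k])) :=
    Fintype.equivFinOfCardEq (Module.finrank_eq_card_basis b).symm
  exact ⟨a ∘ e.symm, b.reindex e, fun i => by simp [hb]⟩

/-- The differential of a function, in the fibre of the cotangent space at the closed point. -/
noncomputable def cotangentFibre (k : Type u) {O : Type u} [Field k] [CommRing O] [IsLocalRing O]
    [Algebra k O] : O →+ ResidueField O ⊗[O] Ω[O⁄k] :=
  (TensorProduct.mk O (ResidueField O) (Ω[O⁄k]) 1).toAddMonoidHom.comp (D k O).toLinearMap.toAddMonoidHom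

omit [IsNoetherianRing O] [Module.Finite O (Ω[O⁄k])] [Module.Free O (Ω[O⁄k])] in
theorem cotangentFibre_apply (a : O) : cotangentFibre k a = (1 : ResidueField O) ⊗ₜ[O] D k O a := rfl

omit [IsNoetherianRing O] [Module.Finite O (Ω[O⁄k])] [Module.Free O (Ω[O⁄k])] in
theorem cotangentFibre_mul {a b : O} (hb : b ∈ maximalIdeal O) :
    cotangentFibre k (a * b) = residue O a • cotangentFibre k b := by
  simp only [cotangentFibre_apply, Derivation.leibniz, tmul_add, ← smul_tmul]
  have : b • (1 : ResidueField O) = 0 := by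
    rw [Algebra.smul_def, mul_one]
    exact (residue_eq_zero_iff b).mpr hb
  rw [this, zero_tmul, add_zero, Algebra.smul_def, mul_one, smul_tmul', smul_eq_mul, mul_one]
  rfl

omit [IsNoetherianRing O] [Module.Finite O (Ω[O⁄k])] [Module.Free O (Ω[O⁄k])] in
theorem span_range_cotangentFibre :
    Submodule.span (ResidueField O) (Set.range (cotangentFibre k (O := O))) = ⊤ := by
  rw [eq_top_iff]
  rintro x -
  induction x with
  | zero => simp
  | add x y hx hy => exact Submodule.add_mem _ hx hy
  | tmul c ω =>
    have hω : ω ∈ Submodule.span O (Set.range (D k O)) := by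
      rw [span_range_derivation]; trivial
    induction hω using Submodule.span_induction with
    | mem ω h =>
      obtain ⟨a, rfl⟩ := h
      have := Submodule.smul_mem _ c (Submodule.subset_span (R := ResidueField O)
        (Set.mem_range_self (f := cotangentFibre k (O := O)) a))
      rwa [cotangentFibre_apply, smul_tmul', smul_eq_mul, mul_one] at this
    | zero => simp
    | add x y _ _ hx hy => rw [tmul_add]; exact Submodule.add_mem _ hx hy
    | smul a x _ hx =>
      rw [tmul_smul, algebra_compatible_smul (ResidueField O) a]
      exact Submodule.smul_mem _ _ hx

variable [CommRing Q] [Algebra k Q] [Algebra O Q] [IsScalarTower k O Q]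

omit [IsNoetherianRing O] [Module.Finite O (Ω[O⁄k])] [Module.Free O (Ω[O⁄k])] in
/-- Modulo the maximal ideal, an element of the kernel of `O → Q` is determined by its
differential, if `Q` is formally smooth. -/
theorem mem_maximalIdeal_mul_ker [Algebra.FormallySmooth k O] [Algebra.FormallySmooth k Q]
    [Nontrivial Q]
    (hsurj : Function.Surjective (algebraMap O Q)) {a : O} (ha : a ∈ RingHom.ker (algebraMap O Q))
    (h : cotangentFibre k a = 0) : a ∈ maximalIdeal O * RingHom.ker (algebraMap O Q) := by
  set I := RingHom.ker (algebraMap O Q)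
  have hIm : I ≤ maximalIdeal O := le_maximalIdeal (RingHom.ker_ne_top _)
  -- Jacobian criterion: formal smoothness of `Q` provides a retraction of `I/I² → Q ⊗ Ω`. It
  -- recovers the class of `a` from its differential, so that `a ∈ 𝔪 I + I² = 𝔪 I`.
  obtain ⟨l, hl⟩ := (Algebra.FormallySmooth.iff_split_injection (R := k) hsurj).mp ‹_›
  let F : Ω[O⁄k] →ₗ[O] I.Cotangent := l ∘ₗ TensorProduct.mk O Q (Ω[O⁄k]) 1
  have hF : F (D k O a) = I.toCotangent ⟨a, ha⟩ :=
    LinearMap.congr_fun hl (I.toCotangent ⟨a, ha⟩)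
  have hDa : D k O a ∈ maximalIdeal O • (⊤ : Submodule O (Ω[O⁄k])) := by
    rw [← LinearMap.ker_tensorProductMk]
    exact h
  have h1 : I.toCotangent ⟨a, ha⟩ ∈ (maximalIdeal O • (⊤ : Submodule O I)).map I.toCotangent := by
    rw [Submodule.map_smul'', Submodule.map_top, I.toCotangent_range, ← hF]
    have := Submodule.mem_map_of_mem (f := F) hDa
    rw [Submodule.map_smul''] at this
    exact Submodule.smul_mono le_rfl le_top this
  obtain ⟨b, hb, hab⟩ := h1
  have hb' : (b : O) ∈ maximalIdeal O * I := by
    have := Submodule.mem_map_of_mem (f := I.subtype) hb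
    rw [Submodule.map_smul'', Submodule.map_top, Submodule.range_subtype] at this
    exact this
  have hab' : (b : O) - a ∈ I ^ 2 := (I.toCotangent_eq (x := b) (y := ⟨a, ha⟩)).mp hab
  rw [pow_two] at hab'
  have := Ideal.sub_mem _ hb' (Ideal.mul_mono_left hIm hab')
  simpa using this

/-- Local coordinates adapted to a smooth quotient. -/
theorem exists_adapted_coordinates [Algebra.FormallySmooth k O] [Algebra.FormallySmooth k Q]
    [Nontrivial Q] [Module.Finite Q (Ω[Q⁄k])] [Module.Free Q (Ω[Q⁄k])]
    (hsurj : Function.Surjective (algebraMap O Q)) {n r d : ℕ}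
    (hn : Module.finrank O (Ω[O⁄k]) = n) (hd : Module.finrank Q (Ω[Q⁄k]) = d) (hdr : d + r = n) :
    ∃ (x : Fin n → O) (e : Module.Basis (Fin n) O (Ω[O⁄k])), (∀ i, e i = D k O (x i)) ∧
      RingHom.ker (algebraMap O Q) = Ideal.span {y | ∃ i : Fin n, i.val < r ∧ x i = y} := by
  classical
  have : IsLocalRing Q := .of_surjective' _ hsurj
  have : IsNoetherianRing Q := isNoetherianRing_of_surjective _ _ _ hsurj
  set I := RingHom.ker (algebraMap O Q) with hIdef
  have hIm : I ≤ maximalIdeal O := le_maximalIdeal (RingHom.ker_ne_top _)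
  set κ := ResidueField O
  -- coordinates on the quotient
  subst hd
  set d := Module.finrank Q (Ω[Q⁄k])
  obtain ⟨q, b, hb⟩ := exists_basis_D (k := k) (O := Q)
  choose x hx using fun j => hsurj (q j)
  -- functions in `I` with independent differentials
  obtain ⟨ι, y, -, hyspan, hyli⟩ := exists_linearIndependent' κ fun a : I => cotangentFibre k a.1
  have hfin : Module.finrank κ (κ ⊗[O] Ω[O⁄k]) = n := by
    rw [Module.finrank_baseChange, hn]
  have : Finite ι := hyli.finite
  have := Fintype.ofFinite ι
  set W := Submodule.span κ (Set.range fun a : I => cotangentFibre k a.1)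
  have hcardW : Fintype.card ι = Module.finrank κ W := by
    rw [← hyspan, finrank_span_eq_card hyli]
  have hWsub (a : O) (ha : a ∈ I) : cotangentFibre k a ∈ W := Submodule.subset_span ⟨⟨a, ha⟩, rfl⟩
  -- the dual coordinates
  have hres : ∀ a ∈ I, residue O a = 0 := fun a ha => (residue_eq_zero_iff a).mpr (hIm ha)
  let g₀ : Q →+* κ := (Ideal.Quotient.lift I (residue O) hres).comp
      (RingHom.quotientKerEquivOfSurjective hsurj).symm.toRingHom
  have hg₀ (a : O) : g₀ (algebraMap O Q a) = residue O a := by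
    have : (RingHom.quotientKerEquivOfSurjective hsurj).symm (algebraMap O Q a) =
        Ideal.Quotient.mk _ a := by
      rw [RingEquiv.symm_apply_eq]
      rfl
    change Ideal.Quotient.lift I (residue O) hres ((RingHom.quotientKerEquivOfSurjective hsurj).symm
      (algebraMap O Q a)) = _
    rw [this]
    rfl
  let g : Q →ₗ[O] κ :=
    { toFun := g₀
      map_add' := map_add g₀
      map_smul' := fun a b => by
        rw [Algebra.smul_def, map_mul, hg₀, RingHom.id_apply, Algebra.smul_def]
        rfl }
  let lam (j : Fin d) : κ ⊗[O] Ω[O⁄k] →ₗ[κ] κ :=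
    (TensorProduct.isBaseChange O (Ω[O⁄k]) κ).lift
      (g ∘ₗ (b.coord j).restrictScalars O ∘ₗ KaehlerDifferential.map k k O Q)
  have hlam (j : Fin d) (a : O) :
      lam j (cotangentFibre k a) = g₀ (b.repr (D k Q (algebraMap O Q a)) j) := by
    have := (TensorProduct.isBaseChange O (Ω[O⁄k]) κ).lift_eq
      (g ∘ₗ (b.coord j).restrictScalars O ∘ₗ KaehlerDifferential.map k k O Q) (D k O a)
    refine this.trans ?_
    simp only [LinearMap.comp_apply, map_D]
    rfl
  have hlamx (i j : Fin d) : lam j (cotangentFibre k (x i)) = if i = j then 1 else 0 := by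
    rw [hlam, hx, ← hb, Module.Basis.repr_self, Finsupp.single_apply]
    split_ifs <;> simp
  have hlamW (j : Fin d) : ∀ w ∈ W, lam j w = 0 := by
    intro w hw
    induction hw using Submodule.span_induction with
    | mem w hw =>
      obtain ⟨a, rfl⟩ := hw
      rw [hlam, show algebraMap O Q a = 0 from a.2]
      simp
    | zero => simp
    | add u v _ _ hu hv => rw [map_add, hu, hv, add_zero]
    | smul c u _ hu => rw [map_smul, hu, smul_zero]
  -- The `d` functionals `lam j` are independent, being dual to the `x j`, and vanish on `W`. Hence
  -- `W` has dimension at most `n - d = r`.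
  have hle : Fintype.card ι ≤ r := by
    let Lam : κ ⊗[O] Ω[O⁄k] →ₗ[κ] (Fin d → κ) := LinearMap.pi lam
    have hLam : Function.Surjective Lam := by
      intro c
      refine ⟨∑ i, c i • cotangentFibre k (x i), ?_⟩
      ext j
      simp [Lam, hlamx]
    have h1 := Lam.finrank_range_add_finrank_ker
    rw [LinearMap.range_eq_top.mpr hLam, finrank_top, Module.finrank_fin_fun, hfin] at h1
    have h2 : Module.finrank κ W ≤ Module.finrank κ (LinearMap.ker Lam) :=
      Submodule.finrank_mono fun w hw => by
        ext j
        exact hlamW j w hw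
    omega
  -- together they span
  have hspan : W ⊔ Submodule.span κ (Set.range fun j => cotangentFibre k (x j)) = ⊤ := by
    rw [eq_top_iff, ← span_range_cotangentFibre, Submodule.span_le]
    rintro _ ⟨a, rfl⟩
    choose c hc using fun j => hsurj (b.repr (D k Q (algebraMap O Q a)) j)
    -- After subtracting the lifted expansion along the quotient, the remainder dies in the
    -- differentials of `Q`. By the conormal sequence it comes from an element of `I`.
    have hker : D k O a - ∑ j, c j • D k O (x j) ∈
        LinearMap.ker (KaehlerDifferential.map k k O Q) := by
      rw [LinearMap.mem_ker, map_sub, map_sum, sub_eq_zero]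
      simp only [map_smul, map_D, hx, ← hb]
      conv_lhs => rw [← b.sum_repr (D k Q (algebraMap O Q a))]
      refine Finset.sum_congr rfl fun j _ => ?_
      rw [← hc, algebraMap_smul]
    have hker' : (1 : Q) ⊗ₜ[O] (D k O a - ∑ j, c j • D k O (x j)) ∈
        LinearMap.ker (KaehlerDifferential.mapBaseChange k O Q) := by
      rw [LinearMap.mem_ker, mapBaseChange_tmul, one_smul]
      exact hker
    obtain ⟨w, hw⟩ := (exact_kerCotangentToTensor_mapBaseChange k O Q hsurj _).mp hker'
    obtain ⟨w, rfl⟩ := Ideal.toCotangent_surjective _ w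
    rw [kerCotangentToTensor_toCotangent] at hw
    have hg1 : g 1 = 1 := map_one g₀
    have := congrArg (g.rTensor (Ω[O⁄k])) hw
    simp only [LinearMap.rTensor_tmul, hg1] at this
    rw [tmul_sub, tmul_sum] at this
    simp only [tmul_smul] at this
    have hrw : cotangentFibre k a =
        cotangentFibre k w.1 + ∑ j, residue O (c j) • cotangentFibre k (x j) := by
      simp only [cotangentFibre_apply, this]
      rw [eq_comm, sub_add, sub_eq_self, sub_eq_zero]
      rfl
    rw [hrw]
    refine Submodule.add_mem_sup (hWsub _ w.2) (Submodule.sum_mem _ fun j _ => ?_)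
    exact Submodule.smul_mem _ _ (Submodule.subset_span ⟨j, rfl⟩)
  have hcard : Fintype.card ι = r := by
    have h1 := Submodule.finrank_add_le_finrank_add_finrank W
      (Submodule.span κ (Set.range fun j => cotangentFibre k (x j)))
    rw [hspan, finrank_top, hfin, ← hcardW] at h1
    have h2 := finrank_range_le_card (R := κ) fun j => cotangentFibre k (x j)
    rw [Fintype.card_fin] at h2
    unfold Set.finrank at h2
    omega
  let ei : Fin r ≃ ι := (Fintype.equivFinOfCardEq hcard).symm
  let σ : Fin r ⊕ Fin d ≃ Fin n := finSumFinEquiv.trans (finCongr (by omega))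
  let X : Fin r ⊕ Fin d → O := Sum.elim (fun l => (y (ei l)).1) x
  have hWr : W = Submodule.span κ (Set.range fun l : Fin r => cotangentFibre k (y (ei l)).1) := by
    rw [← hyspan, ← ei.surjective.range_comp]
    rfl
  -- Nakayama's lemma: generating the fibre at the closed point is enough.
  have htop : Submodule.span O (Set.range fun i => D k O (X (σ.symm i))) = ⊤ := by
    rw [← map_tensorProduct_mk_eq_top, Submodule.map_span, ← Submodule.restrictScalars_span O κ
      Ideal.Quotient.mk_surjective, Submodule.restrictScalars_eq_top_iff, ← Set.range_comp,
      eq_top_iff, ← hspan, hWr]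
    refine sup_le (Submodule.span_mono ?_) (Submodule.span_mono ?_)
    · rintro _ ⟨l, rfl⟩
      exact ⟨σ (.inl l), by simp [X, cotangentFibre_apply]⟩
    · rintro _ ⟨l, rfl⟩
      exact ⟨σ (.inr l), by simp [X, cotangentFibre_apply]⟩
  refine ⟨X ∘ σ.symm, basisOfTopLeSpanOfCardEqFinrank _ htop.ge (by simp [hn]),
    fun i => by rw [coe_basisOfTopLeSpanOfCardEqFinrank]; rfl, ?_⟩
  have hset : {z | ∃ i : Fin n, i.val < r ∧ (X ∘ σ.symm) i = z} =
      Set.range fun l : Fin r => (y (ei l)).1 := by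
    ext z
    constructor
    · rintro ⟨i, hi, rfl⟩
      refine ⟨⟨i, hi⟩, ?_⟩
      have : σ (.inl ⟨i, hi⟩) = i := by ext; simp [σ]
      change _ = X (σ.symm i)
      rw [show σ.symm i = .inl ⟨i, hi⟩ from (Equiv.symm_apply_eq σ).mpr this.symm]
      rfl
    · rintro ⟨l, rfl⟩
      exact ⟨σ (.inl l), by simp [σ], by simp [X]⟩
  rw [hset]
  apply le_antisymm
  -- Nakayama once more, for `I`: subtracting from `a ∈ I` a combination of the chosen functions
  -- kills its differential in the fibre, so the difference lies in `𝔪 I` by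
  -- `mem_maximalIdeal_mul_ker`.
  · apply Submodule.le_of_le_smul_of_le_jacobson_bot (I := maximalIdeal O)
      (IsNoetherian.noetherian _) (maximalIdeal_le_jacobson _)
    intro a ha
    have := hWsub a ha
    rw [hWr, Submodule.mem_span_range_iff_exists_fun] at this
    obtain ⟨c, hc⟩ := this
    choose c' hc' using fun l => residue_surjective (c l)
    have hmem : ∑ l, c' l * (y (ei l)).1 ∈ Ideal.span (Set.range fun l : Fin r => (y (ei l)).1) :=
      Submodule.sum_mem _ fun l _ => Ideal.mul_mem_left _ _ (Ideal.subset_span ⟨l, rfl⟩)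
    have hmemI : ∑ l, c' l * (y (ei l)).1 ∈ I :=
      Submodule.sum_mem _ fun l _ => Ideal.mul_mem_left _ _ (y (ei l)).2
    have hz : cotangentFibre k (a - ∑ l, c' l * (y (ei l)).1) = 0 := by
      rw [map_sub, map_sum, sub_eq_zero, ← hc]
      refine Finset.sum_congr rfl fun l _ => ?_
      rw [cotangentFibre_mul (hIm (y (ei l)).2), hc']
    have := mem_maximalIdeal_mul_ker hsurj (Ideal.sub_mem _ ha hmemI) hz
    rw [← sub_add_cancel a (∑ l, c' l * (y (ei l)).1), add_comm]
    exact Submodule.add_mem_sup hmem this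
  · rw [Ideal.span_le]
    rintro _ ⟨l, rfl⟩
    exact (y (ei l)).2

/-- The derivations dual to local coordinates. -/
theorem exists_dual_derivations {R : Type u} [CommRing R] [Algebra k R] {ι : Type*}
    [Finite ι] [DecidableEq ι] {x : ι → R} (e : Module.Basis ι R (Ω[R⁄k])) (he : ∀ i, e i = D k R (x i))
    (I : Ideal R) :
    ∃ δ : ι → Derivation k R (R ⧸ I), ∀ i j, δ i (x j) = if i = j then 1 else 0 := by
  refine ⟨fun i => (I.mkQ ∘ₗ e.coord i).compDer (D k R), fun i j => ?_⟩
  change I.mkQ (e.coord i (D k R (x j))) = _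
  rw [← he, Module.Basis.coord_apply, Module.Basis.repr_self, Finsupp.single_apply]
  simp only [eq_comm (a := j)]
  split_ifs <;> simp

end Coordinates

/-! ### Local rings as subrings of the function field. -/

section LocalRings

variable {X Y : Scheme.{u}} [IsIntegral X] [IsIntegral Y]

theorem genericPoint_mem {U : X.Opens} {x : X} (hx : x ∈ U) : genericPoint X ∈ U :=
  ((genericPoint_spec X).mem_open_set_iff U.isOpen).mpr ⟨x, trivial, hx⟩

/-- Sections over a nonempty open set as rational functions. -/
noncomputable def sectionMap (U : X.Opens) (hU : genericPoint X ∈ U) :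
    Γ(X, U) →+* X.functionField :=
  (X.presheaf.germ U (genericPoint X) hU).hom

theorem algebraMap_germ {U : X.Opens} {x : X} (hx : x ∈ U) (hU : genericPoint X ∈ U) (a : Γ(X, U)) :
    algebraMap (X.presheaf.stalk x) X.functionField ((X.presheaf.germ U x hx).hom a) =
      sectionMap U hU a := by
  have : Nonempty U := ⟨⟨x, hx⟩⟩
  exact Scheme.algebraMap_germ_eq_germToFunctionField X hx a

theorem sectionMap_injective (U : X.Opens) (hU : genericPoint X ∈ U) :
    Function.Injective (sectionMap U hU) :=
  germ_injective_of_isIntegral X (genericPoint X) hU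

theorem sectionMap_map {U V : X.Opens} (h : V ≤ U) (hV : genericPoint X ∈ V) (a : Γ(X, U)) :
    sectionMap V hV ((X.presheaf.map (homOfLE h).op).hom a) = sectionMap U (h hV) a := by
  change (X.presheaf.map (homOfLE h).op ≫ X.presheaf.germ V (genericPoint X) hV).hom a = _
  rw [X.presheaf.germ_res]
  rfl

theorem algebraMap_stalk_injective (x : X) :
    Function.Injective (algebraMap (X.presheaf.stalk x) X.functionField) :=
  IsFractionRing.injective _ _

theorem algebraMap_mem_localRing {x : X} (a : X.presheaf.stalk x) :
    algebraMap (X.presheaf.stalk x) X.functionField a ∈ localRing X x := ⟨a, rfl⟩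

theorem inv_algebraMap_mem_localRing {x : X} {a : X.presheaf.stalk x} (ha : a ≠ 0) :
    (algebraMap (X.presheaf.stalk x) X.functionField a)⁻¹ ∈ localRing X x ↔ IsUnit a := by
  have h0 : algebraMap (X.presheaf.stalk x) X.functionField a ≠ 0 :=
    (map_ne_zero_iff _ (algebraMap_stalk_injective x)).mpr ha
  constructor
  · rintro ⟨b, hb⟩
    refine IsUnit.of_mul_eq_one b (algebraMap_stalk_injective x ?_)
    rw [map_mul, hb, mul_inv_cancel₀ h0, map_one]
  · rintro ⟨v, rfl⟩
    exact ⟨(v⁻¹ : (X.presheaf.stalk x)ˣ), (map_units_inv (algebraMap _ X.functionField) v)⟩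

theorem sectionMap_mem_localRing {U : X.Opens} {x : X} (hx : x ∈ U) (hU : genericPoint X ∈ U)
    (a : Γ(X, U)) : sectionMap U hU a ∈ localRing X x :=
  ⟨_, algebraMap_germ hx hU a⟩

theorem localRing_le_of_specializes {x y : X} (h : x ⤳ y) : localRing X y ≤ localRing X x := by
  rintro _ ⟨a, rfl⟩
  obtain ⟨U, hU, b, rfl⟩ := X.presheaf.exists_germ_eq a
  rw [algebraMap_germ hU (genericPoint_mem hU)]
  exact sectionMap_mem_localRing (h.mem_open U.isOpen hU) _ b

/-- Elements of the local rings of an affine open set are fractions. -/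
theorem exists_fraction_of_mem_localRing {U : X.Opens} (hUa : IsAffineOpen U) {x : X} (hx : x ∈ U)
    (hU : genericPoint X ∈ U) {q : X.functionField} (hq : q ∈ localRing X x) :
    ∃ a s : Γ(X, U), s ≠ 0 ∧ (sectionMap U hU s)⁻¹ ∈ localRing X x ∧
      q * sectionMap U hU s = sectionMap U hU a := by
  obtain ⟨q, rfl⟩ := hq
  let := TopCat.Presheaf.algebra_section_stalk X.presheaf (⟨x, hx⟩ : U)
  have := hUa.isLocalization_stalk ⟨x, hx⟩
  obtain ⟨⟨a, s⟩, h⟩ := IsLocalization.surj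
    (hUa.primeIdealOf ⟨x, hx⟩).asIdeal.primeCompl q
  have hs : IsUnit ((X.presheaf.germ U x hx).hom s.1) := IsLocalization.map_units _ s
  have h' : q * (X.presheaf.germ U x hx).hom s.1 = (X.presheaf.germ U x hx).hom a := h
  refine ⟨a, s, ?_, ?_, ?_⟩
  · intro h0
    rw [h0, map_zero] at hs
    exact not_isUnit_zero hs
  · rw [← algebraMap_germ hx hU]
    exact (inv_algebraMap_mem_localRing hs.ne_zero).mpr hs
  · rw [← algebraMap_germ hx hU, ← algebraMap_germ hx hU, ← map_mul, h']

omit [IsIntegral X] in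
/-- Every prime ideal of the ring of an affine open set comes from a point. -/
theorem exists_point_of_isPrime {U : X.Opens} (hUa : IsAffineOpen U) (P : Ideal Γ(X, U))
    [P.IsPrime] : ∃ (x : X) (hx : x ∈ U), ∀ a : Γ(X, U),
      a ∈ P ↔ ¬ IsUnit ((X.presheaf.germ U x hx).hom a) := by
  set x := hUa.fromSpec ⟨P, ‹_›⟩ with hx
  have hxU : x ∈ U := by
    have : x ∈ Set.range hUa.fromSpec := ⟨_, rfl⟩
    rwa [hUa.range_fromSpec] at this
  have hp : hUa.primeIdealOf ⟨x, hxU⟩ = ⟨P, ‹_›⟩ :=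
    hUa.fromSpec.isOpenEmbedding.injective (by rw [hUa.fromSpec_primeIdealOf])
  refine ⟨x, hxU, fun a => ?_⟩
  let := TopCat.Presheaf.algebra_section_stalk X.presheaf (⟨x, hxU⟩ : U)
  have := hUa.isLocalization_stalk ⟨x, hxU⟩
  have h := IsLocalization.AtPrime.isUnit_to_map_iff (X.presheaf.stalk x)
    (hUa.primeIdealOf ⟨x, hxU⟩).asIdeal a
  rw [hp] at h
  have h' : IsUnit ((X.presheaf.germ U x hxU).hom a) ↔ a ∈ P.primeCompl := h
  rw [h']
  exact not_not.symm

theorem exists_fraction_sectionMap {U : X.Opens} (hUa : IsAffineOpen U) (hU : genericPoint X ∈ U)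
    (q : X.functionField) : ∃ a s : Γ(X, U), s ≠ 0 ∧ q * sectionMap U hU s = sectionMap U hU a := by
  obtain ⟨a, s, hs, -, h⟩ := exists_fraction_of_mem_localRing hUa hU hU (q := q)
    ⟨q, by
      change (X.presheaf.stalkSpecializes _).hom q = q
      rw [TopCat.Presheaf.stalkSpecializes_refl]
      rfl⟩
  exact ⟨a, s, hs, h⟩

/-- A rational function that is regular at every point of an open set is a section. -/
theorem exists_section_of_forall_mem_localRing (U : X.Opens) (hU : genericPoint X ∈ U)
    {q : X.functionField} (hq : ∀ x ∈ U, q ∈ localRing X x) : ∃ a, sectionMap U hU a = q := by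
  have h (x : U) : ∃ (V : X.Opens) (hV : x.1 ∈ V) (hVU : V ≤ U) (a : Γ(X, V)),
      sectionMap V (genericPoint_mem hV) a = q := by
    obtain ⟨a, ha⟩ := hq x.1 x.2
    obtain ⟨V, hV, b, rfl⟩ := X.presheaf.exists_germ_eq a
    refine ⟨V ⊓ U, ⟨hV, x.2⟩, inf_le_right,
      (X.presheaf.map (homOfLE inf_le_left).op).hom b, ?_⟩
    rw [sectionMap_map, ← ha, ← algebraMap_germ hV]
  choose V hV hVU a ha using h
  obtain ⟨b, hb, -⟩ := X.sheaf.existsUnique_gluing' V U (fun x => homOfLE (hVU x))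
    (fun x hx => TopologicalSpace.Opens.mem_iSup.mpr ⟨⟨x, hx⟩, hV ⟨x, hx⟩⟩) a (fun x y => by
      have hxy : genericPoint X ∈ V x ⊓ V y := ⟨genericPoint_mem (hV x), genericPoint_mem (hV y)⟩
      apply sectionMap_injective _ hxy
      refine (sectionMap_map inf_le_left hxy (a x)).trans ?_
      refine Eq.trans ?_ (sectionMap_map inf_le_right hxy (a y)).symm
      rw [ha, ha])
  refine ⟨b, ?_⟩
  have hg := ha ⟨_, hU⟩
  rw [← hb ⟨_, hU⟩] at hg
  exact (sectionMap_map _ _ b).symm.trans hg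

omit [IsIntegral X] in
/-- Two points of an affine open set are equal if the same sections are invertible at both. -/
theorem specializes_of_forall_isUnit_germ {U : X.Opens} (hUa : IsAffineOpen U) {x y : X} (hx : x ∈ U)
    (hy : y ∈ U) (h : ∀ a : Γ(X, U), IsUnit ((X.presheaf.germ U y hy).hom a) →
      IsUnit ((X.presheaf.germ U x hx).hom a)) : x ⤳ y := by
  have key (z : X) (hz : z ∈ U) (a : Γ(X, U)) : IsUnit ((X.presheaf.germ U z hz).hom a) ↔
      a ∉ (hUa.primeIdealOf ⟨z, hz⟩).asIdeal := by
    let := TopCat.Presheaf.algebra_section_stalk X.presheaf (⟨z, hz⟩ : U)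
    have := hUa.isLocalization_stalk ⟨z, hz⟩
    exact IsLocalization.AtPrime.isUnit_to_map_iff (X.presheaf.stalk z)
      (hUa.primeIdealOf ⟨z, hz⟩).asIdeal a
  have hs : hUa.primeIdealOf ⟨x, hx⟩ ⤳ hUa.primeIdealOf ⟨y, hy⟩ := by
    rw [← PrimeSpectrum.le_iff_specializes]
    intro a ha
    by_contra hay
    exact (key x hx a).mp (h a ((key y hy a).mpr hay)) ha
  have := hs.map hUa.fromSpec.continuous
  rwa [hUa.fromSpec_primeIdealOf, hUa.fromSpec_primeIdealOf] at this

/-! Dominant morphisms -/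

variable (f : X ⟶ Y) [IsDominant f]

theorem functionFieldMap_sectionMap {U : Y.Opens} (hU : genericPoint Y ∈ U) (hU' : genericPoint X ∈ f ⁻¹ᵁ U)
    (a : Γ(Y, U)) :
    functionFieldMap f (sectionMap U hU a) = sectionMap (f ⁻¹ᵁ U) hU' ((f.app U).hom a) := by
  change (Y.presheaf.germ U _ hU ≫ Y.presheaf.stalkSpecializes _ ≫ f.stalkMap _).hom a =
    (f.app U ≫ X.presheaf.germ (f ⁻¹ᵁ U) _ hU').hom a
  rw [TopCat.Presheaf.germ_stalkSpecializes_assoc, Scheme.Hom.germ_stalkMap]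

theorem functionFieldMap_algebraMap (x : X) (a : Y.presheaf.stalk (f x)) :
    functionFieldMap f (algebraMap _ Y.functionField a) =
      algebraMap (X.presheaf.stalk x) X.functionField ((f.stalkMap x).hom a) := by
  obtain ⟨U, hU, b, rfl⟩ := Y.presheaf.exists_germ_eq a
  have hU' : x ∈ f ⁻¹ᵁ U := hU
  rw [algebraMap_germ hU (genericPoint_mem hU), functionFieldMap_sectionMap f _ (genericPoint_mem hU')]
  rw [← algebraMap_germ hU']
  congr 1
  exact congr($(f.germ_stalkMap U x hU).hom b).symm

theorem functionFieldMap_mem_localRing {x : X} {q : Y.functionField}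
    (hq : q ∈ localRing Y (f x)) : functionFieldMap f q ∈ localRing X x := by
  obtain ⟨a, rfl⟩ := hq
  exact ⟨_, (functionFieldMap_algebraMap f x a).symm⟩

/-- Stalk maps are local homomorphisms, so a unit upstairs was already a unit downstairs. -/
theorem inv_mem_localRing_of_functionFieldMap {x : X} {q : Y.functionField}
    (hq : q ∈ localRing Y (f x)) (h : (functionFieldMap f q)⁻¹ ∈ localRing X x) :
    q⁻¹ ∈ localRing Y (f x) := by
  obtain ⟨a, rfl⟩ := hq
  by_cases h0 : a = 0
  · rw [h0, map_zero, inv_zero]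
    exact Subring.zero_mem _
  have h1 : algebraMap (Y.presheaf.stalk (f x)) Y.functionField a ≠ 0 :=
    (map_ne_zero_iff _ (algebraMap_stalk_injective _)).mpr h0
  rw [functionFieldMap_algebraMap, inv_algebraMap_mem_localRing] at h
  · exact (inv_algebraMap_mem_localRing h0).mpr (isUnit_of_map_unit (f.stalkMap x).hom a h)
  · intro h2
    have := functionFieldMap_algebraMap f x a
    rw [h2, map_zero] at this
    exact h1 ((map_eq_zero _).mp this)

theorem functionFieldMap_comp {W : Scheme.{u}} [IsIntegral W] (g : Y ⟶ W) [IsDominant g]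
    [IsDominant (f ≫ g)] (q : W.functionField) :
    functionFieldMap (f ≫ g) q = functionFieldMap f (functionFieldMap g q) := by
  obtain ⟨U, hU, hUa, -⟩ := exists_isAffineOpen_mem_and_subset (x := genericPoint W)
    (U := ⊤) trivial
  have h1 : genericPoint Y ∈ g ⁻¹ᵁ U := by
    change g (genericPoint Y) ∈ U
    rwa [map_genericPoint]
  have h2 : genericPoint X ∈ f ⁻¹ᵁ g ⁻¹ᵁ U := by
    change f (genericPoint X) ∈ g ⁻¹ᵁ U
    rwa [map_genericPoint]
  have h (a : Γ(W, U)) : functionFieldMap (f ≫ g) (sectionMap U hUa a) =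
      functionFieldMap f (functionFieldMap g (sectionMap U hUa a)) := by
    rw [functionFieldMap_sectionMap (f ≫ g) hUa (by exact h2), functionFieldMap_sectionMap g hUa h1,
      functionFieldMap_sectionMap f h1 h2]
    rfl
  obtain ⟨a, s, hs, hq⟩ := exists_fraction_sectionMap hU hUa q
  have hs' : functionFieldMap (f ≫ g) (sectionMap U hUa s) ≠ 0 := by
    rw [map_ne_zero, map_ne_zero_iff _ (sectionMap_injective U hUa)]
    exact hs
  apply mul_right_cancel₀ hs'
  rw [← map_mul, hq, h, h, ← map_mul, ← map_mul, hq]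

theorem functionFieldMap_scalarMap {k : Type u} [Field k] (s : Y ⟶ Spec (.of k)) (c : k) :
    functionFieldMap f (scalarMap s c) = scalarMap (f ≫ s) c := by
  exact functionFieldMap_sectionMap f (U := ⊤) trivial trivial _

end LocalRings

/-! ### Stalks of the direct image under an integral morphism. -/

section Pushforward

variable {X Y : Scheme.{u}} [IsIntegral X] [IsIntegral Y] (f : X ⟶ Y) [IsDominant f]

omit [IsIntegral Y] [IsDominant f] in
theorem mem_pushforwardLocalRing {y : Y} {q : X.functionField} :
    q ∈ pushforwardLocalRing f y ↔ ∀ x, f x = y → q ∈ localRing X x := by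
  rw [pushforwardLocalRing, Subring.mem_iInf]
  exact ⟨fun h x hx => h ⟨x, hx⟩, fun h x => h x.1 x.2⟩

theorem genericPoint_mem_preimage {U : Y.Opens} (hU : genericPoint Y ∈ U) :
    genericPoint X ∈ f ⁻¹ᵁ U := by
  change f (genericPoint X) ∈ U
  rwa [map_genericPoint]

theorem functionFieldMap_mem_pushforwardLocalRing {y : Y} {q : Y.functionField}
    (hq : q ∈ localRing Y y) : functionFieldMap f q ∈ pushforwardLocalRing f y := by
  rw [mem_pushforwardLocalRing]
  rintro x rfl
  exact functionFieldMap_mem_localRing f hq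

/-- The denominators of a rational function with respect to a ring of sections. -/
def denominators {U : X.Opens} (hU : genericPoint X ∈ U) (q : X.functionField) : Ideal Γ(X, U) where
  carrier := {s | ∃ a, q * sectionMap U hU s = sectionMap U hU a}
  add_mem' := by
    rintro s s' ⟨a, ha⟩ ⟨a', ha'⟩
    exact ⟨a + a', by rw [map_add, mul_add, ha, ha', map_add]⟩
  zero_mem' := ⟨0, by simp⟩
  smul_mem' := by
    rintro c s ⟨a, ha⟩
    exact ⟨c * a, by rw [smul_eq_mul, map_mul, map_mul, ← ha]; ring⟩

variable [IsIntegralHom f]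

/-- Lying over: if all denominators coming from `Y` vanished at `y`, some prime above that of `y`
would contain the whole ideal of denominators. Then `q` would fail to be regular at the
corresponding point over `y`. -/
theorem exists_denominator_notMem {U : Y.Opens} (hUa : IsAffineOpen U) (hU : genericPoint Y ∈ U)
    {y : Y} (hy : y ∈ U)
    {q : X.functionField} (hq : q ∈ pushforwardLocalRing f y) :
    ∃ s : Γ(Y, U), IsUnit ((Y.presheaf.germ U y hy).hom s) ∧
      (f.app U).hom s ∈ denominators (genericPoint_mem_preimage f hU) q := by
  set c := denominators (genericPoint_mem_preimage f hU) q
  let P : Ideal Γ(Y, U) := (IsLocalRing.maximalIdeal (Y.presheaf.stalk y)).comap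
    (Y.presheaf.germ U y hy).hom
  have hP (a : Γ(Y, U)) : a ∈ P ↔ ¬ IsUnit ((Y.presheaf.germ U y hy).hom a) := Iff.rfl
  by_contra! hcon
  have hcP : c.comap (f.app U).hom ≤ P := fun s hs => (hP s).mpr fun h => hcon s h hs
  let : Algebra Γ(Y, U) Γ(X, f ⁻¹ᵁ U) := (f.app U).hom.toAlgebra
  have hint : (f.app U).hom.IsIntegral := IsIntegralHom.isIntegral_app f U hUa
  have : Algebra.IsIntegral Γ(Y, U) Γ(X, f ⁻¹ᵁ U) := ⟨hint⟩
  obtain ⟨Q, hcQ, hQ, hQP⟩ := Ideal.exists_ideal_over_prime_of_isIntegral P c hcP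
  have hVa : IsAffineOpen (f ⁻¹ᵁ U) := hUa.preimage f
  obtain ⟨x, hx, hxQ⟩ := exists_point_of_isPrime hVa Q
  have hfx : f x = y := by
    have hxy (a : Γ(Y, U)) : IsUnit ((Y.presheaf.germ U (f x) hx).hom a) ↔
        IsUnit ((Y.presheaf.germ U y hy).hom a) := by
      have h1 : a ∈ P ↔ (f.app U).hom a ∈ Q := by rw [← hQP]; rfl
      have h2 : (X.presheaf.germ (f ⁻¹ᵁ U) x hx).hom ((f.app U).hom a) =
          (f.stalkMap x).hom ((Y.presheaf.germ U (f x) hx).hom a) :=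
        congr($(f.germ_stalkMap U x hx).hom a).symm
      have h3 := isUnit_map_iff (f.stalkMap x).hom ((Y.presheaf.germ U (f x) hx).hom a)
      rw [hP, hxQ, h2, not_iff_not] at h1
      exact h3.symm.trans h1.symm
    exact (specializes_of_forall_isUnit_germ hUa hx hy fun a => (hxy a).mpr).antisymm
      (specializes_of_forall_isUnit_germ hUa hy hx fun a => (hxy a).mp) |>.eq
  obtain ⟨a, s, hs, hs', h⟩ := exists_fraction_of_mem_localRing hVa hx
    (genericPoint_mem_preimage f hU) ((mem_pushforwardLocalRing f).mp hq x hfx)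
  refine (hxQ s).mp (hcQ ⟨a, h⟩) ?_
  rw [← algebraMap_germ hx, inv_algebraMap_mem_localRing] at hs'
  · exact hs'
  · intro h0
    apply hs
    apply sectionMap_injective _ (genericPoint_mem_preimage f hU)
    rw [← algebraMap_germ hx, h0, map_zero, map_zero]

/-- Elements of the stalk of `f_* 𝒪_X` are fractions of sections over an affine open set. -/
theorem exists_fraction_of_mem_pushforwardLocalRing {U : Y.Opens} (hUa : IsAffineOpen U)
    (hU : genericPoint Y ∈ U) {y : Y} (hy : y ∈ U)
    {q : X.functionField} (hq : q ∈ pushforwardLocalRing f y) :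
    ∃ (a : Γ(X, f ⁻¹ᵁ U)) (s : Γ(Y, U)), IsUnit ((Y.presheaf.germ U y hy).hom s) ∧
      q * functionFieldMap f (sectionMap U hU s) =
        sectionMap (f ⁻¹ᵁ U) (genericPoint_mem_preimage f hU) a := by
  obtain ⟨s, hs, a, ha⟩ := exists_denominator_notMem f hUa hU hy hq
  exact ⟨a, s, hs, by rw [functionFieldMap_sectionMap f _ (genericPoint_mem_preimage f hU), ha]⟩

omit [IsIntegral Y] [IsDominant f] [IsIntegralHom f] in
theorem sectionMap_mem_pushforwardLocalRing {U : Y.Opens} (hU : genericPoint X ∈ f ⁻¹ᵁ U) {y : Y}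
    (hy : y ∈ U) (a : Γ(X, f ⁻¹ᵁ U)) : sectionMap _ hU a ∈ pushforwardLocalRing f y := by
  rw [mem_pushforwardLocalRing]
  rintro x rfl
  exact sectionMap_mem_localRing (U := f ⁻¹ᵁ U) hy hU a

/-- A rational function that is regular where `t` is invertible has denominator a power of `t`. -/
theorem exists_pow_mul_mem_pushforwardLocalRing {y : Y} {t : Y.functionField}
    (ht : t ∈ localRing Y y) (ht0 : t ≠ 0) {q : X.functionField}
    (hq : ∀ x, f x ⤳ y → t⁻¹ ∈ localRing Y (f x) → q ∈ localRing X x) :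
    ∃ e : ℕ, functionFieldMap f t ^ e * q ∈ pushforwardLocalRing f y := by
  obtain ⟨U, hUa, hy, -⟩ := exists_isAffineOpen_mem_and_subset (x := y) (U := ⊤) trivial
  have hU := genericPoint_mem hy
  obtain ⟨a, s, hs0, hs, h⟩ := exists_fraction_of_mem_localRing hUa hy hU ht
  have hsne : sectionMap U hU s ≠ 0 := (map_ne_zero_iff _ (sectionMap_injective U hU)).mpr hs0
  have ha0 : a ≠ 0 := by
    rintro rfl
    rw [map_zero] at h
    exact mul_ne_zero ht0 hsne h
  set c := denominators (genericPoint_mem_preimage f hU) q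
  let P : Ideal Γ(Y, U) := (IsLocalRing.maximalIdeal (Y.presheaf.stalk y)).comap
    (Y.presheaf.germ U y hy).hom
  have hP (a : Γ(Y, U)) : a ∈ P ↔ ¬ IsUnit ((Y.presheaf.germ U y hy).hom a) := Iff.rfl
  have hinv {z : Y} (hz : z ∈ U) {b : Γ(Y, U)} (hb : IsUnit ((Y.presheaf.germ U z hz).hom b)) :
      (sectionMap U hU b)⁻¹ ∈ localRing Y z := by
    rw [← algebraMap_germ hz]
    exact (inv_algebraMap_mem_localRing hb.ne_zero).mpr hb
  -- If no denominator from `Y` is a power of `a` times a function invertible at `y`, there is a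
  -- prime containing the denominators that avoids both. It is a generization of `y` where `t` is
  -- invertible, and there `q` is regular by hypothesis, a contradiction.
  by_cases hdis : Disjoint ((c.comap (f.app U).hom : Ideal Γ(Y, U)) : Set Γ(Y, U))
      (Submonoid.powers a ⊔ P.primeCompl : Submonoid Γ(Y, U))
  · exfalso
    obtain ⟨p, hp, hcp, hpd⟩ := Ideal.exists_le_prime_disjoint _ _ hdis
    obtain ⟨z, hz, hzp⟩ := exists_point_of_isPrime hUa p
    have hunit {b : Γ(Y, U)} (hb : b ∈ Submonoid.powers a ⊔ P.primeCompl) :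
        IsUnit ((Y.presheaf.germ U z hz).hom b) := by
      by_contra hb'
      exact hpd.le_bot ⟨(hzp b).mpr hb', hb⟩
    have hzy : z ⤳ y := specializes_of_forall_isUnit_germ hUa hz hy fun b hb =>
      hunit (Submonoid.mem_sup_right (show b ∈ P.primeCompl from fun h => (hP b).mp h hb))
    have htz : t⁻¹ ∈ localRing Y z := by
      have h1 := hinv hz (hunit (Submonoid.mem_sup_left (Submonoid.mem_powers a)))
      have h2 : t⁻¹ = sectionMap U hU s * (sectionMap U hU a)⁻¹ := by
        rw [← h]
        field_simp
      rw [h2]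
      exact Subring.mul_mem _ (sectionMap_mem_localRing hz hU s) h1
    have hqz : q ∈ pushforwardLocalRing f z := by
      rw [mem_pushforwardLocalRing]
      rintro x rfl
      exact hq x hzy htz
    obtain ⟨s', hs', hsc⟩ := exists_denominator_notMem f hUa hU hz hqz
    exact (hzp s').mp (hcp hsc) hs'
  · obtain ⟨w, ⟨b, hb⟩, hw⟩ := Set.not_disjoint_iff.mp hdis
    obtain ⟨_, ⟨e, rfl⟩, v, hv, rfl⟩ := Submonoid.mem_sup.mp hw
    have hv' : IsUnit ((Y.presheaf.germ U y hy).hom v) := by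
      by_contra h'
      exact hv h'
    have hv0 : functionFieldMap f (sectionMap U hU v) ≠ 0 := by
      rw [map_ne_zero, map_ne_zero_iff _ (sectionMap_injective U hU)]
      rintro rfl
      rw [map_zero] at hv'
      exact not_isUnit_zero hv'
    refine ⟨e, ?_⟩
    have h1 : functionFieldMap f t ^ e * q =
        sectionMap (f ⁻¹ᵁ U) (genericPoint_mem_preimage f hU) b *
          functionFieldMap f (((sectionMap U hU s)⁻¹) ^ e * (sectionMap U hU v)⁻¹) := by
      have h3 : functionFieldMap f (sectionMap U hU s) ≠ 0 := by rwa [map_ne_zero]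
      rw [← hb, ← functionFieldMap_sectionMap f hU]
      simp only [map_mul, map_pow, map_inv₀, inv_pow, ← h, mul_pow]
      field_simp
    rw [h1]
    refine Subring.mul_mem _ (sectionMap_mem_pushforwardLocalRing f _ hy b)
      (functionFieldMap_mem_pushforwardLocalRing f ?_)
    exact Subring.mul_mem _ (Subring.pow_mem _ hs e) (hinv hy hv')

end Pushforward

/-! ### Free algebras of rank two. -/

section RankTwo

/-- Completing the square in a free algebra of rank two. -/
theorem exists_sq_eq_of_finrank_eq_two {O A : Type*} [CommRing O] [IsLocalRing O] [CommRing A]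
    [Algebra O A] [Module.Free O A] [Module.Finite O A] (h : Module.finrank O A = 2)
    (h2 : IsUnit (2 : O)) : ∃ (z : A) (c : O), z ^ 2 = algebraMap O A c ∧
      (∀ a, ∃ p q : O, a = algebraMap O A p + algebraMap O A q * z) ∧
      (∀ p q : O, algebraMap O A p + algebraMap O A q * z = 0 → p = 0 ∧ q = 0) := by
  let e : Module.Basis (Fin 2) O A := Module.finBasisOfFinrankEq O A h
  obtain ⟨w, hw, hw'⟩ : ∃ w : A, (∀ a, ∃ p q : O, a = algebraMap O A p + algebraMap O A q * w) ∧
      (∀ p q : O, algebraMap O A p + algebraMap O A q * w = 0 → p = 0 ∧ q = 0) := by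
    -- If a coordinate of `1` is a unit, `1` may replace the corresponding basis vector.
    have key (i j : Fin 2) (hij : i ≠ j) (hu : IsUnit (e.repr 1 i)) :
        ∃ w : A, (∀ a, ∃ p q : O, a = algebraMap O A p + algebraMap O A q * w) ∧
        (∀ p q : O, algebraMap O A p + algebraMap O A q * w = 0 → p = 0 ∧ q = 0) := by
      have hsum (f : Fin 2 → A) : ∑ l, f l = f i + f j := by
        fin_cases i <;> fin_cases j <;> simp_all [Fin.sum_univ_two, add_comm]
      obtain ⟨v, hv⟩ := hu.exists_right_inv
      have h1 : (1 : A) = e.repr 1 i • e i + e.repr 1 j • e j := by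
        conv_lhs => rw [← e.sum_repr 1]
        rw [hsum]
      have hei : e i = v • (1 : A) - (v * e.repr 1 j) • e j := by
        have h1' := congr(v • $h1)
        rw [h1', smul_add, smul_smul, smul_smul, mul_comm v, hv, one_smul]
        abel
      refine ⟨e j, fun a => ?_, fun p q hpq => ?_⟩
      · refine ⟨e.repr a i * v, e.repr a j - e.repr a i * v * e.repr 1 j, ?_⟩
        conv_lhs => rw [← e.sum_repr a]
        rw [hsum, hei, ← Algebra.smul_def, Algebra.algebraMap_eq_smul_one]
        simp only [smul_sub, smul_smul, sub_smul]
        rw [mul_assoc]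
        abel
      · rw [← Algebra.smul_def, Algebra.algebraMap_eq_smul_one] at hpq
        have hi := congr(e.repr $hpq i)
        have hj := congr(e.repr $hpq j)
        simp only [map_add, map_smul, Finsupp.add_apply, Finsupp.smul_apply, smul_eq_mul,
          Module.Basis.repr_self, map_zero, Finsupp.zero_apply, Finsupp.single_eq_same,
          Finsupp.single_eq_of_ne hij, mul_zero, add_zero, mul_one] at hi hj
        have hp : p = 0 := hu.mul_left_eq_zero.mp hi
        rw [hp, zero_mul, zero_add] at hj
        exact ⟨hp, hj⟩
    by_cases h0 : IsUnit (e.repr 1 0)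
    · exact key 0 1 (by decide) h0
    by_cases h1 : IsUnit (e.repr 1 1)
    · exact key 1 0 (by decide) h1
    -- If both coordinates of `1` lay in the maximal ideal, so would those of `e 0 = 1 · e 0`, one
    -- of which is `1`.
    exfalso
    have hsum : (1 : A) = e.repr 1 0 • e 0 + e.repr 1 1 • e 1 := by
      conv_lhs => rw [← e.sum_repr 1]
      rw [Fin.sum_univ_two]
    have : e 0 = e.repr 1 0 • (e 0 * e 0) + e.repr 1 1 • (e 0 * e 1) := by
      rw [← mul_smul_comm, ← mul_smul_comm, ← mul_add, ← hsum, mul_one]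
    have h' := congr(e.repr $this 0)
    simp only [map_add, map_smul, Finsupp.add_apply, Finsupp.smul_apply, smul_eq_mul,
      Module.Basis.repr_self, Finsupp.single_eq_same] at h'
    refine (IsLocalRing.maximalIdeal.isMaximal O).ne_top ((Ideal.eq_top_iff_one _).mpr ?_)
    rw [h']
    exact Ideal.add_mem _ (Ideal.mul_mem_right _ _ h0) (Ideal.mul_mem_right _ _ h1)
  obtain ⟨c, b, hcb⟩ := hw (w ^ 2)
  obtain ⟨v, hv⟩ := h2.exists_right_inv
  have hv' : (2 : A) * algebraMap O A v = 1 := by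
    rw [← map_one (algebraMap O A), ← hv, map_mul, map_ofNat]
  -- From `w² = c + b w` and `v = 1/2` one gets `(w - b/2)² = c + b²/4`.
  refine ⟨w - algebraMap O A (b * v), c + (b * v) ^ 2, ?_, fun a => ?_, fun p q hpq => ?_⟩
  · simp only [map_mul, map_add, map_pow]
    linear_combination hcb - algebraMap O A b * w * hv'
  · obtain ⟨p, q, rfl⟩ := hw a
    refine ⟨p + q * (b * v), q, ?_⟩
    simp only [map_mul, map_add]
    ring
  · have := hw' (p - q * (b * v)) q (by
      rw [← hpq]
      simp only [map_mul, map_sub]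
      ring)
    obtain ⟨h1, rfl⟩ := this
    simpa using h1

end RankTwo

/-! ### Local equations of double covers. -/

section Cover

variable {X B : Scheme.{u}} (ρ : X ⟶ B)

theorem isPullback_fromSpec [IsAffineHom ρ] {U : B.Opens} (hU : IsAffineOpen U) :
    IsPullback (hU.preimage ρ).fromSpec (Spec.map (ρ.app U)) ρ hU.fromSpec := by
  refine (isPullback_morphismRestrict ρ U).flip.of_iso (hU.preimage ρ).isoSpec (Iso.refl _)
    hU.isoSpec (Iso.refl _) ?_ ?_ ?_ ?_
  · simp
  · simp only [IsAffineOpen.isoSpec_hom]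
    exact (Scheme.Opens.toSpecΓ_naturality ρ U).symm
  · simp
  · simp

theorem IsDoubleCover.rankAtStalk {ρ : X ⟶ B} (h : IsDoubleCover ρ) {U : B.Opens}
    (hU : IsAffineOpen U) (p : PrimeSpectrum Γ(B, U)) :
    letI := (ρ.app U).hom.toAlgebra
    Module.rankAtStalk (R := Γ(B, U)) Γ(X, ρ ⁻¹ᵁ U) p = 2 := by
  have := h.isFinite
  have := h.flat
  let := (ρ.app U).hom.toAlgebra
  have h1 := Scheme.Hom.finrank_of_isPullback _ _ _ _ (isPullback_fromSpec ρ hU) p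
  rw [h.finrank_eq] at h1
  rw [← h1, Scheme.Hom.finrank_SpecMap_eq_finrank]
  · rfl
  · exact ρ.finite_app U hU
  · rw [Scheme.Hom.app_eq_appLE]
    exact Flat.flat_appLE ρ hU (hU.preimage ρ) le_rfl

theorem IsDoubleCover.surjective {ρ : X ⟶ B} (h : IsDoubleCover ρ) : Surjective ρ := by
  have := h.isFinite
  have := h.flat
  rw [← Scheme.Hom.one_le_finrank_iff_surjective]
  intro b
  rw [h.finrank_eq]
  exact one_le_two

variable [IsIntegral X] [IsIntegral B]

omit [IsIntegral X] [IsIntegral B] in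
theorem IsDoubleCover.isDominant {ρ : X ⟶ B} (h : IsDoubleCover ρ) : IsDominant ρ := by
  have := h.surjective
  infer_instance

/-- Locally, a double cover is given by an equation `z² = h`. -/
theorem IsDoubleCover.exists_equation {ρ : X ⟶ B} (H : IsDoubleCover ρ) [IsDominant ρ] (b : B)
    (h2 : IsUnit (2 : B.presheaf.stalk b)) :
    letI := (functionFieldMap ρ).toAlgebra
    ∃ (z : X.functionField) (h : B.presheaf.stalk b),
      IsSquareRootGenerator z (algebraMap _ B.functionField h) ∧
      (pushforwardLocalRing ρ b : Set X.functionField) = doubleCoverRing (localRing B b) z := by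
  have := H.isFinite
  have := H.flat
  let : Algebra B.functionField X.functionField := (functionFieldMap ρ).toAlgebra
  obtain ⟨U, hUa, hb, -⟩ := exists_isAffineOpen_mem_and_subset (x := b) (U := ⊤) trivial
  have hU := genericPoint_mem hb
  have hV := genericPoint_mem_preimage ρ hU
  set p := hUa.primeIdealOf ⟨b, hb⟩
  let R := Γ(B, U)
  let S := Γ(X, ρ ⁻¹ᵁ U)
  let O := B.presheaf.stalk b
  let A := pushforwardLocalRing ρ b
  let : Algebra R S := (ρ.app U).hom.toAlgebra
  let : Algebra R O := TopCat.Presheaf.algebra_section_stalk B.presheaf (⟨b, hb⟩ : U)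
  have : IsLocalization.AtPrime O p.asIdeal := hUa.isLocalization_stalk ⟨b, hb⟩
  let : Algebra O A := (((functionFieldMap ρ).comp (algebraMap O B.functionField)).codRestrict A
    fun a => functionFieldMap_mem_pushforwardLocalRing ρ ⟨a, rfl⟩).toAlgebra
  let g : S →+* A := (sectionMap (ρ ⁻¹ᵁ U) hV).codRestrict A
    fun a => sectionMap_mem_pushforwardLocalRing ρ hV hb a
  let : Algebra S A := g.toAlgebra
  let : Algebra R A := ((algebraMap O A).comp (algebraMap R O)).toAlgebra
  have : IsScalarTower R O A := .of_algebraMap_eq fun _ => rfl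
  have hval (a : R) : (algebraMap R A a : X.functionField) = functionFieldMap ρ (sectionMap U hU a) :=
    congrArg (functionFieldMap ρ) (algebraMap_germ hb hU a)
  have : IsScalarTower R S A := .of_algebraMap_eq fun a => by
    apply Subtype.ext
    rw [hval, functionFieldMap_sectionMap ρ hU hV]
    rfl
  have hinj : Function.Injective (algebraMap S A) := fun a b hab =>
    sectionMap_injective _ hV congr($hab)
  let f : S →ₗ[R] A := (IsScalarTower.toAlgHom R S A).toLinearMap
  have hunit (s : R) : IsUnit (algebraMap R O s) ↔ s ∈ p.asIdeal.primeCompl :=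
    IsLocalization.AtPrime.isUnit_to_map_iff O p.asIdeal s
  -- The stalk of the direct image, defined as an intersection of local rings, is the localization
  -- of the ring of sections. It is therefore finite, flat and of rank two over the local ring of
  -- `B`.
  have hloc : IsLocalizedModule p.asIdeal.primeCompl f :=
    { map_units := fun s => by
        have hs : IsUnit (algebraMap R A s) :=
          ((hunit s).mpr s.2).map (algebraMap O A)
        obtain ⟨v, hv⟩ := hs.exists_right_inv
        have hv' : v * algebraMap R A s = 1 := by rw [mul_comm, hv]
        rw [Module.End.isUnit_iff]
        constructor
        · intro a a' haa
          have h : algebraMap R A s * a = algebraMap R A s * a' := by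
            simpa [Algebra.smul_def] using haa
          rw [← one_mul a, ← one_mul a', ← hv', mul_assoc, mul_assoc, h]
        · intro a
          refine ⟨v * a, ?_⟩
          change (s : R) • (v * a) = a
          rw [Algebra.smul_def, ← mul_assoc, hv, one_mul]
      surj := fun q => by
        obtain ⟨a, s, hs, h⟩ := exists_fraction_of_mem_pushforwardLocalRing ρ hUa hU hb q.2
        refine ⟨⟨a, ⟨s, (hunit s).mp hs⟩⟩, Subtype.ext ?_⟩
        change ((algebraMap R A s * q : A) : X.functionField) = _
        rw [mul_comm]
        refine Eq.trans ?_ h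
        rw [← hval]
        rfl
      exists_of_eq := fun {a a'} haa => ⟨1, by rw [hinj haa]⟩ }
  have : Module.Finite R S := ρ.finite_app U hUa
  have : Module.Flat R S := by
    have := Flat.flat_appLE ρ hUa (hUa.preimage ρ) le_rfl
    rw [← Scheme.Hom.app_eq_appLE] at this
    exact this
  have : Module.Finite O A := .of_isLocalizedModule p.asIdeal.primeCompl f
  have : Module.Flat O A := .of_isLocalizedModule O p.asIdeal.primeCompl f
  have : Module.Free O A := Module.free_of_flat_of_isLocalRing
  have hbc : IsBaseChange O f := IsLocalizedModule.isBaseChange p.asIdeal.primeCompl O f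
  have hrank : Module.finrank O A = 2 := by
    have h1 := Module.rankAtStalk_isBaseChange hbc (IsLocalRing.closedPoint O)
    rw [Module.rankAtStalk_eq_finrank_of_free, H.rankAtStalk hUa] at h1
    simpa using h1
  obtain ⟨z, h, hz, hex, huniq⟩ := exists_sq_eq_of_finrank_eq_two hrank h2
  refine ⟨z, h, ⟨congrArg Subtype.val hz, ?_, ?_⟩, ?_⟩
  · intro c hc
    obtain ⟨a, s, hs, rfl⟩ := IsFractionRing.div_surjective (A := O) c
    have hs0 : s ≠ 0 := nonZeroDivisors.ne_zero hs
    have hs1 : functionFieldMap ρ (algebraMap O _ s) ≠ 0 := by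
      rw [map_ne_zero, map_ne_zero_iff _ (algebraMap_stalk_injective b)]
      exact hs0
    have hc' : (z : X.functionField) * functionFieldMap ρ (algebraMap O _ s) =
        functionFieldMap ρ (algebraMap O _ a) := by
      rw [hc]
      change functionFieldMap ρ _ * _ = _
      rw [map_div₀, div_mul_cancel₀ _ hs1]
    refine hs0 (huniq (-a) s (Subtype.ext ?_)).2
    change functionFieldMap ρ (algebraMap O _ (-a)) + functionFieldMap ρ (algebraMap O _ s) * z = 0
    rw [map_neg, map_neg, ← hc']
    ring
  · intro q
    have hV' : IsAffineOpen (ρ ⁻¹ᵁ U) := hUa.preimage ρ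
    obtain ⟨a, s, hs, hq⟩ := exists_fraction_sectionMap hV' hV q
    have : IsDomain S := (sectionMap_injective _ hV).isDomain
    have hRS : Function.Injective (algebraMap R S) := fun u v huv => by
      apply sectionMap_injective U hU
      apply (functionFieldMap ρ).injective
      rw [functionFieldMap_sectionMap ρ hU hV, functionFieldMap_sectionMap ρ hU hV]
      exact congrArg _ huv
    have : FaithfulSMul R S := (faithfulSMul_iff_algebraMap_injective R S).mpr hRS
    have : Nontrivial R := (sectionMap U hU).domain_nontrivial
    have : Algebra.IsIntegral R S := Algebra.IsIntegral.of_finite R S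
    -- By integrality the denominator `s` divides a nonzero function `d` from the base, so every
    -- element of `K(X)` has a denominator in `K(B)`.
    obtain ⟨c, d, hd, hdc⟩ := Algebra.IsAlgebraic.exists_smul_eq_mul R (1 : S) hs
    have hd1 : functionFieldMap ρ (sectionMap U hU d) ≠ 0 := by
      rw [map_ne_zero, map_ne_zero_iff _ (sectionMap_injective U hU)]
      exact hd
    obtain ⟨u, v, huv⟩ := hex (g (a * c))
    have hqd : q * functionFieldMap ρ (sectionMap U hU d) = g (a * c) := by
      rw [functionFieldMap_sectionMap ρ hU hV]
      change q * sectionMap _ hV (algebraMap R S d) = sectionMap _ hV (a * c)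
      rw [Algebra.algebraMap_eq_smul_one, hdc, map_mul, map_mul, ← hq, mul_assoc]
    have huv' : (g (a * c) : X.functionField) = functionFieldMap ρ (algebraMap O _ u) +
      functionFieldMap ρ (algebraMap O _ v) * z := congrArg Subtype.val huv
    refine ⟨algebraMap O _ u / sectionMap U hU d, algebraMap O _ v / sectionMap U hU d, ?_⟩
    change q = functionFieldMap ρ _ + functionFieldMap ρ _ * _
    rw [map_div₀, map_div₀, eq_comm, div_mul_eq_mul_div, ← add_div, div_eq_iff hd1, ← huv', hqd]
  · ext q
    constructor
    · intro hq
      obtain ⟨u, v, huv⟩ := hex ⟨q, hq⟩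
      exact ⟨_, ⟨u, rfl⟩, _, ⟨v, rfl⟩, congrArg Subtype.val huv⟩
    · rintro ⟨_, ⟨u, rfl⟩, _, ⟨v, rfl⟩, rfl⟩
      exact (algebraMap O A u + algebraMap O A v * z).2

end Cover

/-! ### Specialization: passing from a point to the generic point of a subvariety. -/

section Specialization

variable {X B : Scheme.{u}} [IsIntegral X] [IsIntegral B]

theorem algebraMap_stalkSpecializes {y b : B} (h : y ⤳ b) (a : B.presheaf.stalk b) :
    algebraMap _ B.functionField ((B.presheaf.stalkSpecializes h).hom a) =
      algebraMap _ B.functionField a := by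
  obtain ⟨U, hU, c, rfl⟩ := B.presheaf.exists_germ_eq a
  have hy : y ∈ U := h.mem_open U.isOpen hU
  rw [algebraMap_germ hU (genericPoint_mem hU), ← algebraMap_germ hy]
  congr 1
  exact congr($(B.presheaf.germ_stalkSpecializes hU h).hom c)

/-- The ideal of the closure of `y` in the local ring at a specialization of `y`. -/
noncomputable def closureIdeal {y b : B} (h : y ⤳ b) : Ideal (B.presheaf.stalk b) :=
  (IsLocalRing.maximalIdeal (B.presheaf.stalk y)).comap (B.presheaf.stalkSpecializes h).hom

instance {y b : B} (h : y ⤳ b) : (closureIdeal h).IsPrime := by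
  unfold closureIdeal
  infer_instance

theorem isLocalization_stalkSpecializes {y b : B} (h : y ⤳ b) :
    letI := (B.presheaf.stalkSpecializes h).hom.toAlgebra
    IsLocalization.AtPrime (B.presheaf.stalk y) (closureIdeal h) := by
  let := (B.presheaf.stalkSpecializes h).hom.toAlgebra
  have hmap (a : B.presheaf.stalk b) : algebraMap (B.presheaf.stalk b) (B.presheaf.stalk y) a =
    (B.presheaf.stalkSpecializes h).hom a := rfl
  obtain ⟨U, hUa, hb, -⟩ := exists_isAffineOpen_mem_and_subset (x := b) (U := ⊤) trivial
  have hy : y ∈ U := h.mem_open U.isOpen hb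
  have hgerm (s : Γ(B, U)) : (B.presheaf.stalkSpecializes h).hom ((B.presheaf.germ U b hb).hom s) =
      (B.presheaf.germ U y hy).hom s := congr($(B.presheaf.germ_stalkSpecializes hb h).hom s)
  refine ⟨fun s => ?_, fun q => ?_, fun {a c} hac => ⟨1, ?_⟩⟩
  · by_contra hs
    exact s.2 hs
  · obtain ⟨a, s, hs0, hs, hq⟩ := exists_fraction_of_mem_localRing hUa hy (genericPoint_mem hb)
      (algebraMap_mem_localRing q)
    have hs1 : (B.presheaf.germ U y hy).hom s ≠ 0 := fun h0 => hs0 <| by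
      apply sectionMap_injective _ (genericPoint_mem hb)
      rw [← algebraMap_germ hy, h0, map_zero, map_zero]
    rw [← algebraMap_germ hy, inv_algebraMap_mem_localRing hs1] at hs
    have hsp : (B.presheaf.germ U b hb).hom s ∉ closureIdeal h := fun h' => by
      have h'' : ¬ IsUnit ((B.presheaf.stalkSpecializes h).hom
        ((B.presheaf.germ U b hb).hom s)) := h'
      rw [hgerm] at h''
      exact h'' hs
    refine ⟨⟨(B.presheaf.germ U b hb).hom a, ⟨(B.presheaf.germ U b hb).hom s, hsp⟩⟩, ?_⟩
    apply algebraMap_stalk_injective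
    rw [map_mul]
    refine ((congrArg (_ * ·) (algebraMap_stalkSpecializes h _)).trans ?_).trans
      (algebraMap_stalkSpecializes h _).symm
    rw [algebraMap_germ hb (genericPoint_mem hb), algebraMap_germ hb (genericPoint_mem hb)]
    exact hq
  · rw [OneMemClass.coe_one, one_mul, one_mul]
    apply algebraMap_stalk_injective
    rw [← algebraMap_stalkSpecializes h, ← algebraMap_stalkSpecializes h]
    exact congrArg _ hac

/-- Symbolic and ordinary powers agree: elements outside the prime have order zero, so by additivity
inverting them does not change the order. Krull's intersection theorem makes the order finite. -/
theorem mem_pow_closureIdeal {y b : B} (h : y ⤳ b) (hord : HasAdditiveOrder (closureIdeal h))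
    [IsNoetherianRing (B.presheaf.stalk b)] {m : ℕ} {a : B.presheaf.stalk b}
    (ha : (B.presheaf.stalkSpecializes h).hom a ∈
      IsLocalRing.maximalIdeal (B.presheaf.stalk y) ^ m)
    (ha' : (B.presheaf.stalkSpecializes h).hom a ∉
      IsLocalRing.maximalIdeal (B.presheaf.stalk y) ^ (m + 1)) :
    a ∈ closureIdeal h ^ m ∧ a ∉ closureIdeal h ^ (m + 1) := by
  set I := closureIdeal h
  let := (B.presheaf.stalkSpecializes h).hom.toAlgebra
  have := isLocalization_stalkSpecializes h
  have hpow (p : ℕ) : IsLocalRing.maximalIdeal (B.presheaf.stalk y) ^ p =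
      (I ^ p).map (algebraMap _ (B.presheaf.stalk y)) := by
    rw [Ideal.map_pow, IsLocalization.AtPrime.map_eq_maximalIdeal I]
  have hne : a ≠ 0 := by
    rintro rfl
    rw [map_zero] at ha'
    exact ha' (Ideal.zero_mem _)
  obtain ⟨p, hp⟩ : ∃ p, a ∉ I ^ p := by
    by_contra! hall
    have : a ∈ ⨅ i : ℕ, I ^ i := Submodule.mem_iInf _ |>.mpr hall
    rw [Ideal.iInf_pow_eq_bot_of_isLocalRing I (Ideal.IsPrime.ne_top inferInstance)] at this
    exact hne this
  obtain ⟨q, hq, hq'⟩ : ∃ q, a ∈ I ^ q ∧ a ∉ I ^ (q + 1) := by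
    classical
    have hex : ∃ p, a ∉ I ^ p := ⟨p, hp⟩
    let q := Nat.find hex
    have h1 : a ∉ I ^ q := Nat.find_spec hex
    rcases hq0 : q with _ | q'
    · rw [hq0] at h1
      simp at h1
    · refine ⟨q', ?_, hq0 ▸ h1⟩
      by_contra hc
      have := Nat.find_min' hex hc
      change q ≤ q' at this
      omega
  have h1 : (B.presheaf.stalkSpecializes h).hom a ∈
      IsLocalRing.maximalIdeal (B.presheaf.stalk y) ^ q := by
    rw [hpow]
    exact Ideal.mem_map_of_mem _ hq
  have h2 : (B.presheaf.stalkSpecializes h).hom a ∉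
      IsLocalRing.maximalIdeal (B.presheaf.stalk y) ^ (q + 1) := by
    rw [hpow]
    intro hmem
    obtain ⟨⟨c, s⟩, hcs⟩ := (IsLocalization.mem_map_algebraMap_iff I.primeCompl _).mp hmem
    have hcs' : a * s = c := by
      apply algebraMap_stalk_injective
      rw [← algebraMap_stalkSpecializes h, ← algebraMap_stalkSpecializes h, map_mul]
      exact congrArg _ hcs
    -- The denominator `s` is outside the prime, hence of order zero.
    have := hord hq hq' (b := s) (q := 0) (by simp) (by
      rw [zero_add, pow_one]
      exact s.2)
    rw [hcs'] at this
    exact this c.2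
  have hle {i j : ℕ} (hi : (B.presheaf.stalkSpecializes h).hom a ∈
      IsLocalRing.maximalIdeal (B.presheaf.stalk y) ^ i) (hj : (B.presheaf.stalkSpecializes h).hom a ∉
      IsLocalRing.maximalIdeal (B.presheaf.stalk y) ^ (j + 1)) : i ≤ j := by
    by_contra! hij
    exact hj (Ideal.pow_le_pow_right hij hi)
  obtain rfl : m = q := le_antisymm (hle ha h2) (hle h1 ha')
  exact ⟨hq, hq'⟩

variable (ρ : X ⟶ B) [IsDominant ρ] [IsIntegralHom ρ]

theorem pushforwardLocalRing_le {y b : B} (h : y ⤳ b) :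
    pushforwardLocalRing ρ b ≤ pushforwardLocalRing ρ y := by
  intro q hq
  obtain ⟨U, hUa, hb, -⟩ := exists_isAffineOpen_mem_and_subset (x := b) (U := ⊤) trivial
  have hy : y ∈ U := h.mem_open U.isOpen hb
  have hU := genericPoint_mem hb
  obtain ⟨a, s, hs, ha⟩ := exists_fraction_of_mem_pushforwardLocalRing ρ hUa hU hb hq
  have hs0 : functionFieldMap ρ (sectionMap U hU s) ≠ 0 := by
    rw [map_ne_zero, map_ne_zero_iff _ (sectionMap_injective U hU)]
    rintro rfl
    rw [map_zero] at hs
    exact not_isUnit_zero hs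
  rw [← eq_div_iff hs0, div_eq_mul_inv, ← map_inv₀] at ha
  rw [ha]
  refine Subring.mul_mem _ (sectionMap_mem_pushforwardLocalRing ρ _ hy a)
    (functionFieldMap_mem_pushforwardLocalRing ρ (localRing_le_of_specializes h ?_))
  rw [← algebraMap_germ hb, inv_algebraMap_mem_localRing hs.ne_zero]
  exact hs

/-- Elements of the stalk are sections divided by units from the base, so it suffices to expand
sections. -/
theorem pushforwardLocalRing_eq_of_forall {U : B.Opens} (hUa : IsAffineOpen U) {y : B}
    (hy : y ∈ U) {z : X.functionField} (hz : z ∈ pushforwardLocalRing ρ y)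
    (h : ∀ a : Γ(X, ρ ⁻¹ᵁ U), ∃ u ∈ localRing B y, ∃ v ∈ localRing B y,
      sectionMap (ρ ⁻¹ᵁ U) (genericPoint_mem_preimage ρ (genericPoint_mem hy)) a =
        functionFieldMap ρ u + functionFieldMap ρ v * z) :
    letI := (functionFieldMap ρ).toAlgebra
    (pushforwardLocalRing ρ y : Set X.functionField) = doubleCoverRing (localRing B y) z := by
  let := (functionFieldMap ρ).toAlgebra
  have hU := genericPoint_mem hy
  ext q
  constructor
  · intro hq
    obtain ⟨a, s, hs, ha⟩ := exists_fraction_of_mem_pushforwardLocalRing ρ hUa hU hy hq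
    have hs0 : functionFieldMap ρ (sectionMap U hU s) ≠ 0 := by
      rw [map_ne_zero, map_ne_zero_iff _ (sectionMap_injective U hU)]
      rintro rfl
      rw [map_zero] at hs
      exact not_isUnit_zero hs
    have hs' : (sectionMap U hU s)⁻¹ ∈ localRing B y := by
      rw [← algebraMap_germ hy, inv_algebraMap_mem_localRing hs.ne_zero]
      exact hs
    obtain ⟨u, hu, v, hv, huv⟩ := h a
    rw [← eq_div_iff hs0, huv] at ha
    refine ⟨u * (sectionMap U hU s)⁻¹, Subring.mul_mem _ hu hs', v * (sectionMap U hU s)⁻¹,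
      Subring.mul_mem _ hv hs', ?_⟩
    rw [ha]
    change _ = functionFieldMap ρ _ + functionFieldMap ρ _ * z
    simp only [map_mul, map_inv₀]
    field_simp
  · rintro ⟨u, hu, v, hv, rfl⟩
    exact Subring.add_mem _ (functionFieldMap_mem_pushforwardLocalRing ρ hu)
      (Subring.mul_mem _ (functionFieldMap_mem_pushforwardLocalRing ρ hv) hz)

/-- Equations of a double cover are equations at all generizations. -/
theorem pushforwardLocalRing_eq_of_specializes {y b : B} (h : y ⤳ b) {z : X.functionField} :
    letI := (functionFieldMap ρ).toAlgebra
    (pushforwardLocalRing ρ b : Set X.functionField) = doubleCoverRing (localRing B b) z →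
    (pushforwardLocalRing ρ y : Set X.functionField) = doubleCoverRing (localRing B y) z := by
  intro hz
  let := (functionFieldMap ρ).toAlgebra
  obtain ⟨U, hUa, hb, -⟩ := exists_isAffineOpen_mem_and_subset (x := b) (U := ⊤) trivial
  have hy : y ∈ U := h.mem_open U.isOpen hb
  refine pushforwardLocalRing_eq_of_forall ρ hUa hy (pushforwardLocalRing_le ρ h ?_) fun a => ?_
  · rw [← SetLike.mem_coe, hz]
    exact ⟨0, Subring.zero_mem _, 1, Subring.one_mem _, by simp⟩
  · have := sectionMap_mem_pushforwardLocalRing ρ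
      (genericPoint_mem_preimage ρ (genericPoint_mem hy)) hb a
    rw [← SetLike.mem_coe, hz] at this
    obtain ⟨u, hu, v, hv, huv⟩ := this
    exact ⟨u, localRing_le_of_specializes h hu, v, localRing_le_of_specializes h hv, huv⟩

theorem IsBranchEquation.exists_generator {U : B.Opens} {e : Γ(B, U)} (he : IsBranchEquation ρ U e)
    (hUa : IsAffineOpen U) {y : B} (hy : y ∈ U) :
    letI := (functionFieldMap ρ).toAlgebra
    ∃ z : X.functionField, z ^ 2 = functionFieldMap ρ (sectionMap U (genericPoint_mem hy) e) ∧
      (pushforwardLocalRing ρ y : Set X.functionField) = doubleCoverRing (localRing B y) z := by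
  obtain ⟨z, hz, hz'⟩ := he
  have hU := genericPoint_mem hy
  have hV := genericPoint_mem_preimage ρ hU
  refine ⟨sectionMap _ hV z, ?_, ?_⟩
  · rw [← map_pow, hz, functionFieldMap_sectionMap ρ hU hV]
  · refine pushforwardLocalRing_eq_of_forall ρ hUa hy
      (sectionMap_mem_pushforwardLocalRing ρ hV hy z) fun a => ?_
    obtain ⟨⟨p, q⟩, hpq, -⟩ := hz' a
    refine ⟨_, sectionMap_mem_localRing hy hU p, _, sectionMap_mem_localRing hy hU q, ?_⟩
    rw [hpq, map_add, map_mul, functionFieldMap_sectionMap ρ hU hV,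
      functionFieldMap_sectionMap ρ hU hV]

end Specialization

/-! ### Independence of the local equation. -/

section Quadratic

variable {K L : Type*} [Field K] [Field L] [Algebra K L]

/-- Two square root generators of the same ring differ by a unit. -/
theorem IsSquareRootGenerator.exists_unit {z z' : L} {h h' : K} (hz : IsSquareRootGenerator z h)
    (hz' : z' ^ 2 = algebraMap K L h') (h2 : (2 : K) ≠ 0) {R : Subring K}
    (hR : doubleCoverRing R z = doubleCoverRing R z') :
    ∃ q ∈ R, q ≠ 0 ∧ q⁻¹ ∈ R ∧ h' = q ^ 2 * h := by
  have h1 : z' ∈ doubleCoverRing R z' := ⟨0, R.zero_mem, 1, R.one_mem, by simp⟩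
  have h3 : z ∈ doubleCoverRing R z := ⟨0, R.zero_mem, 1, R.one_mem, by simp⟩
  rw [← hR] at h1
  rw [hR] at h3
  obtain ⟨p, hp, q, hq, hpq⟩ := h1
  obtain ⟨p', hp', q', hq', hpq'⟩ := h3
  have hq0 : q ≠ 0 := by
    rintro rfl
    refine hz.notMem (p' + q' * p) ?_
    rw [hpq', hpq]
    simp
  have heq : algebraMap K L h' + algebraMap K L 0 * z =
      algebraMap K L (p ^ 2 + q ^ 2 * h) + algebraMap K L (2 * p * q) * z := by
    rw [← hz', hpq]
    simp only [map_add, map_mul, map_pow, map_zero, ← hz.sq_eq, map_ofNat]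
    ring
  obtain ⟨h4, h5⟩ := hz.eq_and_eq heq
  -- The square of `p + q z` lies in `K`, so `2 p q = 0`, and both `2` and `q` are nonzero.
  have hp0 : p = 0 := by
    rcases mul_eq_zero.mp h5.symm with h6 | h6
    · exact (mul_eq_zero.mp h6).resolve_left h2
    · exact absurd h6 hq0
  subst hp0
  have heq' : algebraMap K L 0 + algebraMap K L 1 * z =
      algebraMap K L p' + algebraMap K L (q' * q) * z := by
    conv_lhs => rw [map_zero, map_one, zero_add, one_mul, hpq', hpq]
    simp only [map_zero, map_mul]
    ring
  have h7 := (hz.eq_and_eq heq').2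
  refine ⟨q, hq, hq0, ?_, by rw [h4]; ring⟩
  rwa [inv_eq_of_mul_eq_one_left h7.symm]

end Quadratic

/-! ### The multiplicity of the branch divisor. -/

section Multiplicity

variable {X B : Scheme.{u}} [IsIntegral X] [IsIntegral B] (ρ : X ⟶ B) [IsDominant ρ]
  [IsIntegralHom ρ]

/-- The multiplicity of the branch divisor can be read off at any point of the subvariety. -/
theorem HasBranchMultiplicity.mem_pow {ζ b : B} (hζ : ζ ⤳ b) {m : ℕ}
    (hm : HasBranchMultiplicity ρ ζ m) (h2 : (2 : B.functionField) ≠ 0)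
    (hord : HasAdditiveOrder (closureIdeal hζ))
    [IsNoetherianRing (B.presheaf.stalk b)] {z : X.functionField} {h : B.presheaf.stalk b} :
    letI := (functionFieldMap ρ).toAlgebra
    IsSquareRootGenerator z (algebraMap _ B.functionField h) →
    (pushforwardLocalRing ρ b : Set X.functionField) = doubleCoverRing (localRing B b) z →
    h ∈ closureIdeal hζ ^ m ∧ h ∉ closureIdeal hζ ^ (m + 1) := by
  intro hz hA
  let := (functionFieldMap ρ).toAlgebra
  obtain ⟨U, hU, e, hUa, he, hem, hem'⟩ := hm
  obtain ⟨z', hz', hA'⟩ := he.exists_generator ρ hUa hU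
  have hA2 := pushforwardLocalRing_eq_of_specializes ρ hζ hA
  -- Two equations differ by the square of a unit, which does not affect membership in powers of the
  -- maximal ideal.
  obtain ⟨_, ⟨q, rfl⟩, hq0, hq', hqe⟩ := hz.exists_unit hz' h2 (hA2.symm.trans hA')
  have hq : IsUnit q := by
    rwa [inv_algebraMap_mem_localRing] at hq'
    rintro rfl
    exact hq0 (map_zero _)
  have hqe' : (B.presheaf.germ U ζ hU).hom e = q ^ 2 * (B.presheaf.stalkSpecializes hζ).hom h := by
    apply algebraMap_stalk_injective
    rw [algebraMap_germ hU (genericPoint_mem hU), hqe, map_mul, map_pow,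
      algebraMap_stalkSpecializes]
  have hiff (p : ℕ) : (B.presheaf.germ U ζ hU).hom e ∈
      IsLocalRing.maximalIdeal (B.presheaf.stalk ζ) ^ p ↔
      (B.presheaf.stalkSpecializes hζ).hom h ∈ IsLocalRing.maximalIdeal (B.presheaf.stalk ζ) ^ p := by
    rw [hqe']
    exact Ideal.unit_mul_mem_iff_mem _ (hq.pow 2)
  rw [hiff] at hem hem'
  exact mem_pow_closureIdeal hζ hord hem hem'

end Multiplicity

/-! ### Local rings of smooth varieties. -/

section Smooth

open KaehlerDifferential

variable {k : Type u} [Field k]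

/-- The structure map from the ground field to a local ring. -/
noncomputable def stalkScalarMap {Y : Scheme.{u}} (s : Y ⟶ Spec (.of k)) (y : Y) :
    k →+* Y.presheaf.stalk y :=
  ((Scheme.ΓSpecIso (.of k)).inv ≫ s.appTop ≫ Y.presheaf.germ ⊤ y trivial).hom

theorem algebraMap_stalkScalarMap {Y : Scheme.{u}} [IsIntegral Y] (s : Y ⟶ Spec (.of k)) (y : Y)
    (c : k) : algebraMap _ Y.functionField (stalkScalarMap s y c) = scalarMap s c :=
  algebraMap_germ (U := ⊤) trivial trivial _

theorem stalkMap_stalkScalarMap {X Y : Scheme.{u}} (f : X ⟶ Y) (s : Y ⟶ Spec (.of k)) (x : X) (c : k) :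
    (f.stalkMap x).hom (stalkScalarMap s (f x) c) = stalkScalarMap (f ≫ s) x c := by
  change (Y.presheaf.germ ⊤ (f x) trivial ≫ f.stalkMap x).hom _ = _
  rw [f.germ_stalkMap ⊤ x trivial]
  rfl

/-- The local rings of a smooth variety. -/
structure IsSmoothLocalRing (k O : Type u) [Field k] [CommRing O] [Algebra k O] (n : ℕ) : Prop where
  isNoetherianRing : IsNoetherianRing O
  formallySmooth : Algebra.FormallySmooth k O
  finite : Module.Finite O (Ω[O⁄k])
  free : Module.Free O (Ω[O⁄k])
  finrank_eq : Module.finrank O (Ω[O⁄k]) = n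

theorem IsSmoothLocalRing.of_isLocalization {S O : Type u} [CommRing S] [Algebra k S]
    [CommRing O] [IsDomain O] [Algebra k O] [Algebra S O] [IsScalarTower k S O] (n : ℕ)
    [Algebra.IsStandardSmoothOfRelativeDimension n k S] (p : Ideal S) [p.IsPrime]
    [IsLocalization.AtPrime O p] : IsSmoothLocalRing k O n := by
  have : Nontrivial S := (algebraMap S O).domain_nontrivial
  have : Algebra.IsStandardSmooth k S :=
    Algebra.IsStandardSmoothOfRelativeDimension.isStandardSmooth n
  have : IsNoetherianRing S := Algebra.FiniteType.isNoetherianRing k S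
  have : Algebra.FormallySmooth S O := .of_isLocalization p.primeCompl
  have hrank : Module.finrank S (Ω[S⁄k]) = n :=
    Module.finrank_eq_of_rank_eq
      (Algebra.IsStandardSmoothOfRelativeDimension.rank_kaehlerDifferential n)
  refine ⟨IsLocalization.isNoetherianRing p.primeCompl O ‹_›, .comp k S O,
    .of_isLocalizedModule p.primeCompl (map k k S O),
    Module.free_of_isLocalizedModule p.primeCompl (map k k S O), ?_⟩
  rw [Module.finrank_of_isLocalizedModule_of_free O p.primeCompl (map k k S O), hrank]

theorem isSmoothLocalRing_stalk {Y : Scheme.{u}} [IsIntegral Y] (s : Y ⟶ Spec (.of k)) (n : ℕ)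
    [SmoothOfRelativeDimension n s] (y : Y) :
    letI := (stalkScalarMap s y).toAlgebra
    IsSmoothLocalRing k (Y.presheaf.stalk y) n := by
  let := (stalkScalarMap s y).toAlgebra
  obtain ⟨U, hU, V, hV, hy, e, hsm⟩ :=
    SmoothOfRelativeDimension.exists_isStandardSmoothOfRelativeDimension (n := n) (f := s) y
  have hUt : U = ⊤ := by
    ext p
    have : p = s y := Subsingleton.elim (α := PrimeSpectrum k) _ _
    rw [this]
    exact ⟨fun _ => trivial, fun _ => e hy⟩
  subst hUt
  let φ : k →+* Γ(Y, V) := ((Scheme.ΓSpecIso (.of k)).inv ≫ s.appLE ⊤ V e).hom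
  let : Algebra k Γ(Y, V) := φ.toAlgebra
  have hφ : φ.IsStandardSmoothOfRelativeDimension n :=
    RingHom.isStandardSmoothOfRelativeDimension_respectsIso.2 (s.appLE ⊤ V e).hom
      (Scheme.ΓSpecIso (.of k)).symm.commRingCatIsoToRingEquiv hsm
  have : Algebra.IsStandardSmoothOfRelativeDimension n k Γ(Y, V) := hφ
  let : Algebra Γ(Y, V) (Y.presheaf.stalk y) :=
    TopCat.Presheaf.algebra_section_stalk Y.presheaf (⟨y, hy⟩ : V)
  have : IsScalarTower k Γ(Y, V) (Y.presheaf.stalk y) := .of_algebraMap_eq fun c => by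
    change ((Scheme.ΓSpecIso (.of k)).inv ≫ s.appTop ≫ Y.presheaf.germ ⊤ y trivial).hom c =
      ((Scheme.ΓSpecIso (.of k)).inv ≫ s.appLE ⊤ V e ≫ Y.presheaf.germ V y hy).hom c
    rw [Scheme.Hom.appLE, Category.assoc, TopCat.Presheaf.germ_res]
    rfl
  have := hV.isLocalization_stalk ⟨y, hy⟩
  exact IsSmoothLocalRing.of_isLocalization n (hV.primeIdealOf ⟨y, hy⟩).asIdeal

end Smooth

/-! ### Coordinates at the points of a smooth subvariety. -/

section Coordinates

open KaehlerDifferential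

variable {k : Type u} [Field k] {B Z : Scheme.{u}} [IsIntegral B] [IsIntegral Z]

omit [IsIntegral B] in
theorem specializes_map_genericPoint (i : Z ⟶ B) (z : Z) : i (genericPoint Z) ⤳ i z :=
  ((genericPoint_spec Z).specializes trivial).map i.continuous

-- Since `Z` is integral, its stalks embed in its function field, so the kernel can be tested at the
-- generic point. There the target of the stalk map is a field, and the kernel is the maximal ideal.
omit [IsIntegral B] in
theorem ker_stalkMap (i : Z ⟶ B) [IsClosedImmersion i] (z : Z) :
    RingHom.ker (i.stalkMap z).hom = closureIdeal (specializes_map_genericPoint i z) := by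
  ext a
  have hz : genericPoint Z ⤳ z := (genericPoint_spec Z).specializes trivial
  have h1 : (i.stalkMap (genericPoint Z)).hom
      ((B.presheaf.stalkSpecializes (specializes_map_genericPoint i z)).hom a) =
      (Z.presheaf.stalkSpecializes hz).hom ((i.stalkMap z).hom a) :=
    Scheme.Hom.stalkSpecializes_stalkMap_apply i _ _ hz a
  have h2 : (Z.presheaf.stalkSpecializes hz).hom ((i.stalkMap z).hom a) = 0 ↔
      (i.stalkMap z).hom a = 0 :=
    map_eq_zero_iff _ (algebraMap_stalk_injective z)
  have h3 (c : B.presheaf.stalk (i (genericPoint Z))) :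
      c ∈ IsLocalRing.maximalIdeal (B.presheaf.stalk (i (genericPoint Z))) ↔
        (i.stalkMap (genericPoint Z)).hom c = 0 := by
    rw [IsLocalRing.mem_maximalIdeal, mem_nonunits_iff,
      ← isUnit_map_iff (i.stalkMap (genericPoint Z)).hom c]
    exact (isUnit_iff_ne_zero (G₀ := Z.functionField)).not_left
  rw [RingHom.mem_ker, ← h2, ← h1, closureIdeal, Ideal.mem_comap, h3]

theorem exists_coordinates_of_mem (s : B ⟶ Spec (.of k)) (i : Z ⟶ B) [IsClosedImmersion i]
    (n d r : ℕ) (hdr : d + r = n) [SmoothOfRelativeDimension n s]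
    [SmoothOfRelativeDimension d (i ≫ s)] (z : Z) :
    letI := (stalkScalarMap s (i z)).toAlgebra
    ∃ (x : Fin n → B.presheaf.stalk (i z))
      (e : Module.Basis (Fin n) (B.presheaf.stalk (i z)) (Ω[B.presheaf.stalk (i z)⁄k])),
      (∀ l, e l = D k (B.presheaf.stalk (i z)) (x l)) ∧
      closureIdeal (specializes_map_genericPoint i z) =
        Ideal.span {y | ∃ l : Fin n, l.val < r ∧ x l = y} := by
  let := (stalkScalarMap s (i z)).toAlgebra
  let := (stalkScalarMap (i ≫ s) z).toAlgebra
  let := (i.stalkMap z).hom.toAlgebra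
  have : IsScalarTower k (B.presheaf.stalk (i z)) (Z.presheaf.stalk z) :=
    .of_algebraMap_eq fun c => (stalkMap_stalkScalarMap i s z c).symm
  have hB := isSmoothLocalRing_stalk s n (i z)
  have hZ := isSmoothLocalRing_stalk (i ≫ s) d z
  have := hB.isNoetherianRing
  have := hB.formallySmooth
  have := hB.finite
  have := hB.free
  have := hZ.formallySmooth
  have := hZ.finite
  have := hZ.free
  rw [← ker_stalkMap]
  exact exists_adapted_coordinates (i.stalkMap_surjective z) hB.finrank_eq hZ.finrank_eq hdr

theorem exists_coordinates (s : B ⟶ Spec (.of k)) (n : ℕ) [SmoothOfRelativeDimension n s] (b : B) :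
    letI := (stalkScalarMap s b).toAlgebra
    ∃ (x : Fin n → B.presheaf.stalk b)
      (e : Module.Basis (Fin n) (B.presheaf.stalk b) (Ω[B.presheaf.stalk b⁄k])),
      (∀ l, e l = D k (B.presheaf.stalk b) (x l)) := by
  let := (stalkScalarMap s b).toAlgebra
  have hB := isSmoothLocalRing_stalk s n b
  have := hB.isNoetherianRing
  have := hB.finite
  have := hB.free
  have := exists_basis_D (k := k) (O := B.presheaf.stalk b)
  rwa [hB.finrank_eq] at this

end Coordinates

/-! ### The charts of the blow-up algebra. -/

section ReesCharts

variable {R : Type u} [CommRing R] (I : Ideal R)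

theorem mem_pow_one {a : R} (ha : a ∈ I) : a ∈ I ^ 1 := by rwa [pow_one]

/-- The element `a tⁿ` of the Rees algebra. -/
noncomputable def reesMonomial {n : ℕ} {a : R} (ha : a ∈ I ^ n) : reesAlgebra I :=
  ⟨Polynomial.monomial n a, reesAlgebra.monomial_mem.mpr ha⟩

theorem reesMonomial_mem {n : ℕ} {a : R} (ha : a ∈ I ^ n) :
    reesMonomial I ha ∈ reesGrading I n := fun i hi => by
  simp [reesMonomial, Polynomial.coeff_monomial, hi.symm]

theorem exists_eq_reesMonomial {n : ℕ} {f : reesAlgebra I} (hf : f ∈ reesGrading I n) :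
    ∃ (a : R) (ha : a ∈ I ^ n), f = reesMonomial I ha := by
  refine ⟨f.1.coeff n, f.2 n, Subtype.ext (Polynomial.ext fun i => ?_)⟩
  by_cases hi : i = n
  · subst hi
    simp [reesMonomial]
  · rw [hf i hi]
    simp [reesMonomial, Polynomial.coeff_monomial, Ne.symm hi]

theorem reesMonomial_mem_span {n : ℕ} {a : R} (ha : a ∈ I ^ (n + 1)) :
    reesMonomial I ha ∈
      Ideal.span (Set.range fun t : I => reesMonomial I (mem_pow_one I t.2)) := by
  set J := Ideal.span (Set.range fun t : I => reesMonomial I (mem_pow_one I t.2))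
  have key : ∀ b ∈ I ^ n * I, ∃ h : b ∈ I ^ (n + 1), reesMonomial I h ∈ J := by
    intro b hb
    induction hb using Submodule.mul_induction_on' with
    | mem_mul_mem x hx y hy =>
      have hxy : x * y ∈ I ^ (n + 1) := by
        rw [pow_succ]
        exact Ideal.mul_mem_mul hx hy
      refine ⟨hxy, ?_⟩
      have : reesMonomial I hxy = reesMonomial I hx *
          reesMonomial I (mem_pow_one I hy) :=
        Subtype.ext (Polynomial.monomial_mul_monomial n 1 x y).symm
      rw [this]
      exact Ideal.mul_mem_left _ _ (Ideal.subset_span ⟨⟨y, hy⟩, rfl⟩)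
    | add x _ y _ hx hy =>
      obtain ⟨hx, hx'⟩ := hx
      obtain ⟨hy, hy'⟩ := hy
      refine ⟨Ideal.add_mem _ hx hy, ?_⟩
      have : reesMonomial I (Ideal.add_mem _ hx hy) = reesMonomial I hx + reesMonomial I hy :=
        Subtype.ext (map_add (Polynomial.monomial (n + 1)) x y)
      rw [this]
      exact Ideal.add_mem _ hx' hy'
  rw [← pow_succ] at key
  exact (key a ha).2

/-- The Rees algebra is generated in degree one, so the charts given by the elements of `I` cover
the blow-up. -/
theorem irrelevant_le_span :
    (HomogeneousIdeal.irrelevant (reesGrading I)).toIdeal ≤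
      Ideal.span (Set.range fun t : I => reesMonomial I (mem_pow_one I t.2)) := by
  classical
  intro f hf
  rw [← DirectSum.sum_support_decompose (reesGrading I) f]
  refine Ideal.sum_mem _ fun i _ => ?_
  rcases i with _ | i
  · have h0 : ((DirectSum.decompose (reesGrading I) f 0 : reesGrading I 0) : reesAlgebra I) = 0 :=
      (HomogeneousIdeal.mem_irrelevant_iff _ _).mp hf
    rw [h0]
    exact Ideal.zero_mem _
  · obtain ⟨a, ha, h⟩ := exists_eq_reesMonomial I (DirectSum.decompose (reesGrading I) f (i + 1)).2
    rw [h]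
    exact reesMonomial_mem_span I ha

/-- The chart `R[I/t]` of the blow-up. -/
abbrev ReesChart (t : I) : Type u :=
  HomogeneousLocalization.Away (reesGrading I) (reesMonomial I (mem_pow_one I t.2))

/-- The structure map of a chart of the blow-up. -/
noncomputable def reesChartMap (t : I) : R →+* ReesChart I t :=
  (HomogeneousLocalization.fromZeroRingHom (reesGrading I) _).comp (algebraMap R (reesGrading I 0))

theorem val_reesChartMap (t : I) (a : R) :
    (reesChartMap I t a).val = Localization.mk (algebraMap R (reesAlgebra I) a) 1 := rfl

/-- The homogeneous fraction of degree zero with numerator `a` in degree `n` plays the role of `a /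
tⁿ`. -/
theorem reesChart_mk_mul (t : I) {n : ℕ} {a : R} (ha : a ∈ I ^ n) :
    HomogeneousLocalization.Away.mk (reesGrading I)
      (reesMonomial_mem I (mem_pow_one I t.2)) n (reesMonomial I ha)
        (by rw [smul_eq_mul, mul_one]; exact reesMonomial_mem I ha) * reesChartMap I t t ^ n =
      reesChartMap I t a := by
  apply HomogeneousLocalization.val_injective
  rw [HomogeneousLocalization.val_mul, HomogeneousLocalization.val_pow, val_reesChartMap,
    val_reesChartMap, HomogeneousLocalization.Away.val_mk, Localization.mk_pow, Localization.mk_mul,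
    Localization.mk_eq_mk_iff, Localization.r_iff_exists]
  refine ⟨1, ?_⟩
  have h : reesMonomial I ha * algebraMap R (reesAlgebra I) t ^ n =
      reesMonomial I (mem_pow_one I t.2) ^ n * algebraMap R (reesAlgebra I) a := by
    apply Subtype.ext
    rw [← map_pow]
    change Polynomial.monomial n a * Polynomial.C ((t : R) ^ n) =
      (Polynomial.monomial 1 (t : R)) ^ n * Polynomial.C a
    rw [Polynomial.monomial_mul_C, Polynomial.monomial_pow, Polynomial.monomial_mul_C, one_mul,
      mul_comm]
  simpa only [Submonoid.coe_mul, OneMemClass.coe_one, one_pow, mul_one, one_mul] using h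

theorem reesChart_exists_mul_eq (t : I) (c : ReesChart I t) :
    ∃ (n : ℕ) (a : R), a ∈ I ^ n ∧ c * reesChartMap I t t ^ n = reesChartMap I t a := by
  obtain ⟨n, f, hf, rfl⟩ := HomogeneousLocalization.Away.mk_surjective _
    (reesMonomial_mem I (mem_pow_one I t.2)) c
  have hf' : f ∈ reesGrading I n := by rwa [smul_eq_mul, mul_one] at hf
  obtain ⟨a, ha, rfl⟩ := exists_eq_reesMonomial I hf'
  exact ⟨n, a, ha, reesChart_mk_mul I t ha⟩

theorem reesChart_exists_of_mem_pow (t : I) {n : ℕ} {a : R} (ha : a ∈ I ^ n) :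
    ∃ c, c * reesChartMap I t t ^ n = reesChartMap I t a := ⟨_, reesChart_mk_mul I t ha⟩

variable [IsDomain R]

instance : IsDomain (reesAlgebra I) := inferInstance

omit [IsDomain R] in
theorem reesMonomial_ne_zero {n : ℕ} {a : R} (ha : a ∈ I ^ n) (h0 : a ≠ 0) :
    reesMonomial I ha ≠ 0 := fun h => h0 <| by
  have := congrArg (fun f : reesAlgebra I => f.1.coeff n) h
  simpa [reesMonomial] using this

/-- The inclusion of a homogeneous localization of the Rees algebra into the localization. -/
noncomputable def awayVal (f : reesAlgebra I) :
    HomogeneousLocalization.Away (reesGrading I) f →+* Localization.Away f where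
  toFun := HomogeneousLocalization.val
  map_one' := HomogeneousLocalization.val_one
  map_mul' := HomogeneousLocalization.val_mul
  map_zero' := HomogeneousLocalization.val_zero
  map_add' := HomogeneousLocalization.val_add

omit [IsDomain R] in
theorem awayVal_injective (f : reesAlgebra I) : Function.Injective (awayVal I f) :=
  HomogeneousLocalization.val_injective _

theorem isReduced_away (f : reesAlgebra I) :
    _root_.IsReduced (HomogeneousLocalization.Away (reesGrading I) f) := by
  have : _root_.IsReduced (Localization.Away f) :=
    isReduced_localizationPreserves (Submonoid.powers f) (Localization.Away f) inferInstance
  exact isReduced_of_injective (awayVal I f) (awayVal_injective I f)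

theorem isDomain_reesChart {t : I} (ht : (t : R) ≠ 0) : IsDomain (ReesChart I t) := by
  have : IsDomain (Localization.Away (reesMonomial I (mem_pow_one I t.2))) :=
    IsLocalization.isDomain_localization
      (powers_le_nonZeroDivisors_of_noZeroDivisors (reesMonomial_ne_zero I _ ht))
  exact (awayVal_injective I _).isDomain _

theorem reesChartMap_injective {t : I} (ht : (t : R) ≠ 0) :
    Function.Injective (reesChartMap I t) := by
  have hinj : Function.Injective (algebraMap (reesAlgebra I)
      (Localization.Away (reesMonomial I (mem_pow_one I t.2)))) :=
    IsLocalization.injective (M := Submonoid.powers (reesMonomial I (mem_pow_one I t.2))) _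
      (powers_le_nonZeroDivisors_of_noZeroDivisors (reesMonomial_ne_zero I _ ht))
  intro a b hab
  have h := congrArg HomogeneousLocalization.val hab
  rw [val_reesChartMap, val_reesChartMap, Localization.mk_one_eq_algebraMap,
    Localization.mk_one_eq_algebraMap] at h
  have := congrArg Subtype.val (hinj h)
  exact Polynomial.C_injective this

end ReesCharts

/-! ### The blow-up of an affine scheme. -/

section ProjRees

variable {R : CommRingCat.{u}} (I : Ideal R)

/-- A chart of the blow-up, as an open immersion. -/
noncomputable def reesChartι (t : I) : Spec (.of (ReesChart I t)) ⟶ Proj (reesGrading I) :=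
  Proj.awayι (reesGrading I) _ (reesMonomial_mem I (mem_pow_one I t.2)) one_pos

instance (t : I) : IsOpenImmersion (reesChartι I t) := by
  unfold reesChartι
  infer_instance

theorem reesChartι_affineBlowup (t : I) :
    reesChartι I t ≫ affineBlowup I = Spec.map (CommRingCat.ofHom (reesChartMap I t)) := by
  change Proj.awayι (reesGrading I) _ (reesMonomial_mem I (mem_pow_one I t.2)) one_pos ≫
    Proj.toSpecZero _ ≫ _ = _
  rw [Proj.awayι_toSpecZero_assoc, ← Spec.map_comp]
  rfl

theorem exists_mem_range_reesChartι (y : Proj (reesGrading I)) :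
    ∃ t : I, y ∈ (reesChartι I t).opensRange := by
  have h : y ∈ (⊤ : (Proj (reesGrading I)).Opens) := trivial
  rw [← Proj.iSup_basicOpen_eq_top (reesGrading I) _ (irrelevant_le_span I),
    TopologicalSpace.Opens.mem_iSup] at h
  obtain ⟨t, ht⟩ := h
  refine ⟨t, ?_⟩
  change y ∈ (Proj.awayι (reesGrading I) _ (reesMonomial_mem I (mem_pow_one I t.2))
    one_pos).opensRange
  rw [Proj.opensRange_awayι]
  exact ht

variable [IsDomain R]

/-- The zero ideal is the generic point. It is relevant because a nonzero `t ∈ I` gives a nonzero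
element of degree one. -/
theorem isIntegral_proj_rees (hI : I ≠ ⊥) : IsIntegral (Proj (reesGrading I)) := by
  obtain ⟨t, ht, ht0⟩ := Submodule.exists_mem_ne_zero_of_ne_bot hI
  let η : ProjectiveSpectrum (reesGrading I) :=
    ⟨⊥, by
      rw [HomogeneousIdeal.toIdeal_bot]
      exact Ideal.isPrime_bot, fun h => by
      have hmem : reesMonomial I (mem_pow_one I ht) ∈
          HomogeneousIdeal.irrelevant (reesGrading I) := by
        rw [HomogeneousIdeal.mem_irrelevant_iff, GradedRing.proj_apply,
          DirectSum.decompose_of_mem_ne _ (reesMonomial_mem I _) one_ne_zero]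
      exact reesMonomial_ne_zero I _ ht0 (h hmem)⟩
  have hη : closure {η} = Set.univ := by
    rw [← ProjectiveSpectrum.zeroLocus_vanishingIdeal_eq_closure, Set.eq_univ_iff_forall]
    intro x f hf
    rw [ProjectiveSpectrum.vanishingIdeal_singleton] at hf
    have : f = 0 := hf
    rw [this]
    exact Ideal.zero_mem _
  have hirr : IrreducibleSpace (Proj (reesGrading I)) := by
    have h := isIrreducible_singleton (x := η) |>.closure
    rw [hη] at h
    exact { isPreirreducible_univ := h.2, toNonempty := ⟨η⟩ }
  have hred : IsReduced (Proj (reesGrading I)) := by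
    have (l : (Proj.affineOpenCover (reesGrading I)).openCover.I₀) :
        IsReduced ((Proj.affineOpenCover (reesGrading I)).openCover.X l) := by
      have := isReduced_away I l.2.1
      change IsReduced (Spec (.of (HomogeneousLocalization.Away (reesGrading I) l.2.1)))
      infer_instance
    exact IsReduced.of_openCover _ (Proj.affineOpenCover (reesGrading I)).openCover
  exact isIntegral_of_irreducibleSpace_of_isReduced _

/-- The blow-up of an affine noetherian scheme is surjective. -/
theorem surjective_affineBlowup [IsNoetherianRing R] (hI : I ≠ ⊥) : Surjective (affineBlowup I) := by
  have hbij : Function.Bijective (algebraMap R (reesGrading I 0)) := by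
    constructor
    · intro a b hab
      exact Polynomial.C_injective congr($hab.1.1)
    · rintro ⟨f, hf⟩
      obtain ⟨a, ha, rfl⟩ := exists_eq_reesMonomial I hf
      exact ⟨a, rfl⟩
  have hiso : IsIso (CommRingCat.ofHom (algebraMap R (reesGrading I 0)) : R ⟶ .of (reesGrading I 0)) := by
    rw [ConcreteCategory.isIso_iff_bijective]
    exact hbij
  have hfg : Algebra.FiniteType R (reesAlgebra I) :=
    (Subalgebra.fg_iff_finiteType _).mp (reesAlgebra.fg (IsNoetherian.noetherian I))
  have : IsScalarTower R (reesGrading I 0) (reesAlgebra I) := ⟨fun a b c => smul_mul_assoc a b.1 c⟩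
  have : Algebra.FiniteType (reesGrading I 0) (reesAlgebra I) :=
    .of_restrictScalars_finiteType R _ _
  -- The Rees algebra is of finite type over its degree zero part, so the morphism is proper and its
  -- image is closed; the image is dense because a single chart is dominant.
  have hproper : IsProper (affineBlowup I) := by
    unfold affineBlowup
    infer_instance
  have hclosed := (affineBlowup I).isClosedMap.isClosed_range
  obtain ⟨t, ht, ht0⟩ := Submodule.exists_mem_ne_zero_of_ne_bot hI
  have := isDomain_reesChart I (t := ⟨t, ht⟩) ht0
  have hdom : IsDominant (Spec.map (CommRingCat.ofHom (reesChartMap I ⟨t, ht⟩))) := by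
    constructor
    exact (PrimeSpectrum.denseRange_comap_iff_ker_le_nilRadical _).mpr (by
      exact ((RingHom.injective_iff_ker_eq_bot _).mp (reesChartMap_injective I ht0)).trans_le
        bot_le)
  have hdense : DenseRange (affineBlowup I) := by
    have h := hdom.denseRange
    rw [← reesChartι_affineBlowup] at h
    refine Dense.mono ?_ h
    rintro _ ⟨x, rfl⟩
    exact ⟨reesChartι I ⟨t, ht⟩ x, rfl⟩
  constructor
  rw [← Set.range_eq_univ, ← hclosed.closure_eq, hdense.closure_range]

end ProjRees

/-- This passes from a chart over an affine open set (`S`, `T`) to local rings (`O`, `R`). -/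
theorem IsBlowupLocalRing.of_chart {S O T K : Type*} [CommRing S] [CommRing O] [CommRing T]
    [Field K] [Algebra O K] (g : S →+* O) (σ : T →+* K) {J : Ideal S} {t : S} (ht : t ∈ J)
    {R : Subring K} (ht0 : algebraMap O K (g t) ≠ 0) (hO : ∀ a, algebraMap O K a ∈ R)
    (hσ : ∀ c, σ c ∈ R)
    (hpow : ∀ a ∈ J, ∃ c, σ c * algebraMap O K (g t) = algebraMap O K (g a))
    (hpow' : ∀ c, ∃ n, ∃ a ∈ J ^ n, σ c * algebraMap O K (g t) ^ n = algebraMap O K (g a))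
    (hR : ∀ q ∈ R, ∃ a s, σ s ≠ 0 ∧ (σ s)⁻¹ ∈ R ∧ q * σ s = σ a) :
    IsBlowupLocalRing (J.map g) (g t) R := by
  have hmem {n : ℕ} {a : S} (ha : a ∈ J ^ n) : g a ∈ J.map g ^ n := by
    rw [← Ideal.map_pow]
    exact Ideal.mem_map_of_mem _ ha
  refine ⟨Ideal.mem_map_of_mem _ ht, ht0, hO, ?_, ?_⟩
  · intro a ha
    induction ha using Submodule.span_induction with
    | mem a ha =>
      obtain ⟨a, ha, rfl⟩ := ha
      obtain ⟨c, hc⟩ := hpow a ha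
      change algebraMap O K (g a) / _ ∈ R
      rw [← hc, mul_div_cancel_right₀ _ ht0]
      exact hσ c
    | zero => rw [map_zero, zero_div]; exact R.zero_mem
    | add a b _ _ ha hb => rw [map_add, add_div]; exact R.add_mem ha hb
    | smul a b _ hb =>
      rw [smul_eq_mul, map_mul, mul_div_assoc]
      exact R.mul_mem (hO a) hb
  · intro q hq
    obtain ⟨a, s, hs0, hsu, h⟩ := hR q hq
    obtain ⟨n, a', ha', ha⟩ := hpow' a
    obtain ⟨p, s', hs', hs''⟩ := hpow' s
    -- The fractions `a' / tⁿ` and `s' / tᵖ` are brought to the common denominator `t ^ (n + p)`.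
    refine ⟨n + p, g (a' * t ^ p), ?_, g (s' * t ^ n), ?_, ?_, ?_, ?_⟩
    · refine hmem ?_
      rw [pow_add]
      exact Ideal.mul_mem_mul ha' (Ideal.pow_mem_pow ht _)
    · refine hmem ?_
      rw [add_comm n p, pow_add]
      exact Ideal.mul_mem_mul hs' (Ideal.pow_mem_pow ht _)
    · rw [map_mul, map_mul, map_pow, map_pow, ← hs'']
      exact mul_ne_zero (mul_ne_zero hs0 (pow_ne_zero _ ht0)) (pow_ne_zero _ ht0)
    · rw [map_mul g, map_mul, map_pow, map_pow, ← hs'', mul_assoc,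
        ← pow_add, add_comm p n, mul_div_cancel_right₀ _ (pow_ne_zero _ ht0)]
      exact hsu
    · rw [map_mul g, map_mul g, map_mul, map_mul, map_pow, map_pow, map_pow, map_pow, ← hs'', ← ha,
        ← h]
      ring

/-! ### Global properties of blow-ups. -/

section BlowupGeometry

variable {B B' : Scheme.{u}} {I : B.IdealSheafData} {j : B' ⟶ B}

theorem exists_sections_equiv (U : B.affineOpens) {C : CommRingCat.{u}} (m : Γ(B, U.1) ⟶ C)
    (c : Spec C ⟶ B') [IsOpenImmersion c] (hc : c ≫ j = Spec.map m ≫ U.2.fromSpec) :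
    ∃ (e : c ''ᵁ ⊤ ≤ j ⁻¹ᵁ U.1) (ψ : C ≅ Γ(B', c ''ᵁ ⊤)),
      m ≫ ψ.hom = j.appLE U.1 (c ''ᵁ ⊤) e := by
  have hU : (⊤ : (Spec Γ(B, U.1)).Opens) ≤ U.2.fromSpec ⁻¹ᵁ U.1 := by
    rw [U.2.fromSpec_preimage_self]
  have hcU : (⊤ : (Spec C).Opens) ≤ (c ≫ j) ⁻¹ᵁ U.1 := by
    rw [hc]
    exact fun _ _ => hU trivial
  have he : c ''ᵁ ⊤ ≤ j ⁻¹ᵁ U.1 := by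
    rintro _ ⟨p, -, rfl⟩
    exact hcU (x := p) trivial
  refine ⟨he, (Scheme.ΓSpecIso _).symm ≪≫ (c.appIso ⊤).symm, ?_⟩
  have h : j.appLE U.1 (c ''ᵁ ⊤) he ≫ (c.appIso ⊤).hom = m ≫ (Scheme.ΓSpecIso _).inv := by
    rw [Scheme.Hom.appIso_hom', Scheme.Hom.appLE_comp_appLE]
    have h3 : (c ≫ j).appLE U.1 ⊤ hcU =
        (Spec.map m ≫ U.2.fromSpec).appLE U.1 ⊤ (fun _ _ => hU trivial) := by
      simp only [hc]
    rw [h3, ← Scheme.Hom.appLE_comp_appLE _ _ U.1 ⊤ ⊤ hU le_top, Scheme.ΓSpecIso_inv_naturality]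
    congr 1
    · rw [Scheme.Hom.appLE, U.2.fromSpec_app_self, Category.assoc, ← Functor.map_comp]
      exact (congrArg _ ((Spec _).presheaf.map_id _)).trans (Category.comp_id _)
  simp only [Iso.trans_hom, Iso.symm_hom]
  rw [← reassoc_of% h, Iso.hom_inv_id, Category.comp_id]

/-- Around every point, the blow-up is given by the chart of some element of the ideal. -/
theorem IsBlowup.exists_chart (hj : IsBlowup I j) (U : B.affineOpens) {y : B'} (hy : j y ∈ U.1) :
    ∃ (V : B'.Opens) (_ : IsAffineOpen V) (_ : y ∈ V) (e : V ≤ j ⁻¹ᵁ U.1) (t : I.ideal U)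
      (ψ : ReesChart (I.ideal U) t ≃+* Γ(B', V)),
      ∀ a, ψ (reesChartMap (I.ideal U) t a) = (j.appLE U.1 V e).hom a := by
  obtain ⟨f, hf⟩ := hj U
  let y' : (j ⁻¹ᵁ U.1).toScheme := ⟨y, hy⟩
  obtain ⟨t, x, hx⟩ := exists_mem_range_reesChartι (I.ideal U) (f.hom y')
  let c : Spec (.of (ReesChart (I.ideal U) t)) ⟶ B' :=
    reesChartι (I.ideal U) t ≫ f.inv ≫ (j ⁻¹ᵁ U.1).ι
  have hc : c ≫ j = Spec.map (CommRingCat.ofHom (reesChartMap (I.ideal U) t)) ≫ U.2.fromSpec := by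
    have h1 : (j ⁻¹ᵁ U.1).ι ≫ j = (j ∣_ U.1) ≫ U.1.ι := (morphismRestrict_ι j U.1).symm
    have h2 : f.inv ≫ (j ∣_ U.1) = affineBlowup (I.ideal U) ≫ U.2.isoSpec.inv := by
      rw [Iso.inv_comp_eq, ← Category.assoc, hf, Category.assoc, Iso.hom_inv_id, Category.comp_id]
    simp only [c, Category.assoc]
    rw [h1, reassoc_of% h2, ← reesChartι_affineBlowup, Category.assoc]
    rfl
  have hcx : c x = y := by
    have h1 : c x = (j ⁻¹ᵁ U.1).ι (f.inv (reesChartι (I.ideal U) t x)) := rfl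
    have h2 : f.inv (f.hom y') = y' := congr($(f.hom_inv_id) y')
    rw [h1]
    exact (congrArg _ ((congrArg _ hx).trans h2))
  obtain ⟨e, ψ, hψ⟩ := exists_sections_equiv U _ c hc
  exact ⟨c ''ᵁ ⊤, (isAffineOpen_top _).image_of_isOpenImmersion c, ⟨x, trivial, hcx⟩, e, t,
    ψ.commRingCatIsoToRingEquiv, fun a => congr($(hψ).hom a)⟩

variable [IsIntegral B]

theorem IsBlowup.surjective [IsLocallyNoetherian B] (hj : IsBlowup I j)
    (hI : ∀ U : B.affineOpens, (U.1 : Set B).Nonempty → I.ideal U ≠ ⊥) : Surjective j := by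
  refine ⟨fun b => ?_⟩
  obtain ⟨U, hU, hb, -⟩ := exists_isAffineOpen_mem_and_subset (x := b) (U := ⊤) trivial
  obtain ⟨f, hf⟩ := hj ⟨U, hU⟩
  have : Nonempty U := ⟨⟨b, hb⟩⟩
  have : IsNoetherianRing Γ(B, U) := IsLocallyNoetherian.component_noetherian ⟨U, hU⟩
  have hs := surjective_affineBlowup _ (hI ⟨U, hU⟩ ⟨b, hb⟩)
  let b' : U.toScheme := ⟨b, hb⟩
  obtain ⟨p, hp⟩ := hs.surj (hU.isoSpec.hom b')
  refine ⟨(j ⁻¹ᵁ U).ι (f.inv p), ?_⟩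
  have h2 : f.inv ≫ (j ∣_ U) = affineBlowup (I.ideal ⟨U, hU⟩) ≫ hU.isoSpec.inv := by
    rw [Iso.inv_comp_eq, ← Category.assoc, hf, Category.assoc, Iso.hom_inv_id, Category.comp_id]
  have h3 : f.inv ≫ (j ⁻¹ᵁ U).ι ≫ j = affineBlowup (I.ideal ⟨U, hU⟩) ≫ hU.isoSpec.inv ≫ U.ι := by
    rw [← morphismRestrict_ι, reassoc_of% h2]
  have h4 : j ((j ⁻¹ᵁ U).ι (f.inv p)) = U.ι (hU.isoSpec.inv (affineBlowup (I.ideal ⟨U, hU⟩) p)) :=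
    congr($h3 p)
  have h5 : hU.isoSpec.inv (hU.isoSpec.hom b') = b' := congr($(hU.isoSpec.hom_inv_id) b')
  exact h4.trans (congrArg U.ι ((congrArg _ hp).trans h5))

/-- The preimages of nonempty affine open sets are integral, and any two of them meet because `B` is
irreducible and `j` is surjective. -/
theorem IsBlowup.isIntegral [IsLocallyNoetherian B] (hj : IsBlowup I j)
    (hI : ∀ U : B.affineOpens, (U.1 : Set B).Nonempty → I.ideal U ≠ ⊥) : IsIntegral B' := by
  have hs := hj.surjective hI
  have hint (U : {U : B.affineOpens // (U.1 : Set B).Nonempty}) :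
      IsIntegral (j ⁻¹ᵁ U.1.1).toScheme := by
    obtain ⟨f, -⟩ := hj U.1
    have : Nonempty U.1.1 := U.2.to_subtype
    have := isIntegral_proj_rees _ (hI U.1 U.2)
    have : Nonempty (j ⁻¹ᵁ U.1.1).toScheme := ⟨f.inv (Nonempty.some inferInstance)⟩
    exact isIntegral_of_isOpenImmersion f.hom
  have hcov : TopologicalSpace.IsOpenCover
      fun U : {U : B.affineOpens // (U.1 : Set B).Nonempty} => j ⁻¹ᵁ U.1.1 := by
    refine top_le_iff.mp fun y _ => ?_
    obtain ⟨U, hU, hb, -⟩ := exists_isAffineOpen_mem_and_subset (x := j y) (U := ⊤) trivial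
    exact TopologicalSpace.Opens.mem_iSup.mpr ⟨⟨⟨U, hU⟩, ⟨_, hb⟩⟩, hb⟩
  have hpre : PreirreducibleSpace B' := by
    refine PreirreducibleSpace.of_isOpenCover (fun U V _ h => ?_) hcov fun U => ?_
    · obtain ⟨b, hb⟩ := nonempty_preirreducible_inter U.1.1.isOpen V.1.1.isOpen U.2 V.2
      obtain ⟨y, rfl⟩ := hs.surj b
      exact (h.le_bot (⟨hb.1, hb.2⟩ : y ∈ j ⁻¹ᵁ U.1.1 ⊓ j ⁻¹ᵁ V.1.1)).elim
    · have := hint U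
      exact (inferInstance : PreirreducibleSpace (j ⁻¹ᵁ U.1.1).toScheme)
  have : Nonempty B' := ⟨(hs.surj (genericPoint B)).choose⟩
  have : IrreducibleSpace B' := ⟨this⟩
  have : IsReduced B' := by
    have (y : B') : _root_.IsReduced (B'.presheaf.stalk y) := by
      obtain ⟨U, hU⟩ := hcov.exists_mem y
      have := hint U
      let y' : (j ⁻¹ᵁ U.1.1).toScheme := ⟨y, hU⟩
      have : _root_.IsReduced ((j ⁻¹ᵁ U.1.1).toScheme.presheaf.stalk y') := inferInstance
      exact isReduced_of_injective _
        (asIso ((j ⁻¹ᵁ U.1.1).ι.stalkMap y')).commRingCatIsoToRingEquiv.injective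
    exact isReduced_of_isReduced_stalk _
  exact isIntegral_of_irreducibleSpace_of_isReduced _

variable [IsIntegral B'] [IsDominant j]

/-- The map from the local ring at the image of a point to the function field. -/
noncomputable def stalkToFunctionField (j : B' ⟶ B) [IsDominant j] (b : B) :
    B.presheaf.stalk b →+* B'.functionField :=
  (functionFieldMap j).comp (algebraMap _ _)

theorem stalkToFunctionField_injective (j : B' ⟶ B) [IsDominant j] (b : B) :
    Function.Injective (stalkToFunctionField j b) :=
  (functionFieldMap j).injective.comp (algebraMap_stalk_injective b)

/-- The extension of an ideal sheaf to a local ring. -/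
noncomputable def stalkIdeal (I : B.IdealSheafData) (U : B.affineOpens) {b : B} (hb : b ∈ U.1) :
    Ideal (B.presheaf.stalk b) :=
  (I.ideal U).map (B.presheaf.germ U.1 b hb).hom

theorem IsBlowup.isBlowupLocalRing (hj : IsBlowup I j) (U : B.affineOpens) {y : B'}
    (hy : j y ∈ U.1) :
    letI := (stalkToFunctionField j (j y)).toAlgebra
    ∃ t, IsBlowupLocalRing (stalkIdeal I U hy) t (localRing B' y) := by
  let := (stalkToFunctionField j (j y)).toAlgebra
  obtain ⟨V, hV, hyV, e, t, ψ, hψ⟩ := hj.exists_chart U hy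
  have hgV := genericPoint_mem hyV
  have hg := genericPoint_mem hy
  have halg (a : Γ(B, U.1)) : algebraMap (B.presheaf.stalk (j y)) B'.functionField
      ((B.presheaf.germ U.1 _ hy).hom a) = sectionMap V hgV (ψ (reesChartMap (I.ideal U) t a)) := by
    rw [hψ]
    change functionFieldMap j (algebraMap _ _ _) = _
    rw [algebraMap_germ hy hg, functionFieldMap_sectionMap j hg (e hgV)]
    exact (sectionMap_map e hgV _).symm
  -- For `t = 0` the chart would be the zero ring, but it contains the point `y`.
  have ht0 : (t : Γ(B, U.1)) ≠ 0 := by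
    intro h1
    have : Nonempty V := ⟨⟨y, hyV⟩⟩
    have h3 : reesMonomial (I.ideal U) (mem_pow_one (I.ideal U) t.2) = 0 :=
      Subtype.ext (by simp [reesMonomial, h1])
    have : Subsingleton (Localization.Away
        (reesMonomial (I.ideal U) (mem_pow_one (I.ideal U) t.2))) :=
      IsLocalization.subsingleton (M := Submonoid.powers _) ⟨1, (pow_one _).trans h3⟩
    have : Subsingleton (ReesChart (I.ideal U) t) := (awayVal_injective _ _).subsingleton
    exact not_subsingleton Γ(B', V) (ψ.symm.injective.subsingleton)
  refine ⟨_, IsBlowupLocalRing.of_chart (B.presheaf.germ U.1 _ hy).hom (sectionMap V hgV) t.2 ?_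
    (fun a => functionFieldMap_mem_localRing j (algebraMap_mem_localRing a))
    (sectionMap_mem_localRing hyV _) ?_ ?_ ?_⟩
  · refine (map_ne_zero_iff _ (stalkToFunctionField_injective j (j y))).mpr ?_
    exact (map_ne_zero_iff _ (germ_injective_of_isIntegral (X := B) (j y) hy)).mpr ht0
  · intro a ha
    obtain ⟨c, hc⟩ := reesChart_exists_of_mem_pow _ t (n := 1) (by rwa [pow_one])
    have hc' : c * reesChartMap _ t t = reesChartMap _ t a :=
      (congrArg (c * ·) (pow_one _).symm).trans hc
    refine ⟨ψ c, ?_⟩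
    rw [halg, halg, ← hc', ← map_mul, ← map_mul]
  · intro c
    obtain ⟨n, a, ha, h⟩ := reesChart_exists_mul_eq _ t (ψ.symm c)
    refine ⟨n, a, ha, ?_⟩
    rw [halg, halg, ← h, map_mul ψ, map_pow ψ, map_mul, map_pow, ψ.apply_symm_apply]
  · intro q hq
    obtain ⟨a, s, hs, hsu, h⟩ := exists_fraction_of_mem_localRing hV hyV hgV hq
    exact ⟨a, s, (map_ne_zero_iff _ (sectionMap_injective V hgV)).mpr hs, hsu, h⟩

theorem mem_localRing_genericPoint (q : B'.functionField) : q ∈ localRing B' (genericPoint B') := by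
  obtain ⟨V, hV, b, rfl⟩ := B'.presheaf.exists_germ_eq q
  exact sectionMap_mem_localRing hV hV b

/-- A blow-up is birational. -/
theorem IsBlowup.functionFieldMap_bijective (hj : IsBlowup I j) :
    Function.Bijective (functionFieldMap j) := by
  refine ⟨(functionFieldMap j).injective, fun q => ?_⟩
  obtain ⟨U, hU, hb, -⟩ := exists_isAffineOpen_mem_and_subset (x := j (genericPoint B')) (U := ⊤)
    trivial
  let := (stalkToFunctionField j (j (genericPoint B'))).toAlgebra
  obtain ⟨t, H⟩ := hj.isBlowupLocalRing ⟨U, hU⟩ hb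
  obtain ⟨e, a, -, s, -, hs, -, h⟩ := H.exists_fraction q (mem_localRing_genericPoint q)
  refine ⟨algebraMap _ _ a / algebraMap _ _ s, ?_⟩
  rw [map_div₀]
  exact (div_eq_iff hs).mpr h.symm

end BlowupGeometry

/-! ### Blow-ups along a subvariety. -/

section BlowupAlongSubvariety

variable {B Z BZ : Scheme.{u}} [IsIntegral B] [IsIntegral Z] (i : Z ⟶ B) [IsClosedImmersion i]

omit [IsIntegral B] in
theorem specializes_iff_mem_range {b : B} : i (genericPoint Z) ⤳ b ↔ b ∈ Set.range i := by
  constructor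
  · intro h
    exact h.mem_closed i.isClosedEmbedding.isClosed_range ⟨_, rfl⟩
  · rintro ⟨z, rfl⟩
    exact specializes_map_genericPoint i z

-- A section vanishes on `Z` near a point of `Z` exactly when its germ does, because `Z` is
-- integral; germs are sections up to units.
omit [IsIntegral B] in
theorem stalkIdeal_ker_eq_closureIdeal (U : B.affineOpens) {b : B} (hb : b ∈ U.1)
    (h : i (genericPoint Z) ⤳ b) : stalkIdeal i.ker U hb = closureIdeal h := by
  obtain ⟨z, rfl⟩ := (specializes_iff_mem_range i).mp h
  have hzU : z ∈ i ⁻¹ᵁ U.1 := hb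
  have key (a : Γ(B, U.1)) : (B.presheaf.germ U.1 (i z) hb).hom a ∈ closureIdeal h ↔
      a ∈ i.ker.ideal U := by
    have : Nonempty (i ⁻¹ᵁ U.1) := ⟨⟨z, hzU⟩⟩
    rw [← ker_stalkMap i z, RingHom.mem_ker, Scheme.Hom.ker_apply, RingHom.mem_ker]
    have h1 : (i.stalkMap z).hom ((B.presheaf.germ U.1 (i z) hb).hom a) =
      (Z.presheaf.germ (i ⁻¹ᵁ U.1) z hzU).hom ((i.app U.1).hom a) :=
      congr($(i.germ_stalkMap U.1 z hb).hom a)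
    rw [h1]
    exact map_eq_zero_iff _ (germ_injective_of_isIntegral (X := Z) z hzU)
  apply le_antisymm
  · rw [stalkIdeal, Ideal.map_le_iff_le_comap]
    exact fun a ha => (key a).mpr ha
  · intro q hq
    let := TopCat.Presheaf.algebra_section_stalk B.presheaf (⟨i z, hb⟩ : U.1)
    have := U.2.isLocalization_stalk ⟨i z, hb⟩
    obtain ⟨⟨a, s⟩, hs⟩ := IsLocalization.surj
      (U.2.primeIdealOf ⟨i z, hb⟩).asIdeal.primeCompl q
    have hsu : IsUnit ((B.presheaf.germ U.1 (i z) hb).hom s.1) := IsLocalization.map_units _ s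
    have h' : q * (B.presheaf.germ U.1 (i z) hb).hom s.1 = (B.presheaf.germ U.1 (i z) hb).hom a := hs
    have ha : a ∈ i.ker.ideal U := (key a).mp (by
      rw [← h']
      exact Ideal.mul_mem_right _ _ hq)
    rw [← Ideal.mul_unit_mem_iff_mem _ hsu, h']
    exact Ideal.mem_map_of_mem _ ha

omit [IsIntegral B] [IsIntegral Z] in
theorem stalkIdeal_ker_eq_top (U : B.affineOpens) {b : B} (hb : b ∈ U.1)
    (h : b ∉ Set.range i) : stalkIdeal i.ker U hb = ⊤ := by
  have h1 : b ∉ i.ker.support := by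
    rw [← SetLike.mem_coe, Scheme.Hom.support_ker]
    rwa [i.isClosedEmbedding.isClosed_range.closure_eq]
  rw [Scheme.IdealSheafData.mem_support_iff_of_mem hb, Scheme.mem_zeroLocus_iff] at h1
  push Not at h1
  obtain ⟨a, ha, hab⟩ := h1
  refine Ideal.eq_top_of_isUnit_mem _ (Ideal.mem_map_of_mem _ ha) ?_
  exact (B.mem_basicOpen a b hb).mp hab

omit [IsIntegral B] in
theorem ker_ideal_ne_bot
    (hne : ∀ z, closureIdeal (specializes_map_genericPoint i z) ≠ ⊥) (U : B.affineOpens)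
    (hU : (U.1 : Set B).Nonempty) : i.ker.ideal U ≠ ⊥ := by
  intro h0
  obtain ⟨b, hb⟩ := hU
  have hbot : stalkIdeal i.ker U hb = ⊥ := by rw [stalkIdeal, h0, Ideal.map_bot]
  by_cases h : b ∈ Set.range i
  · obtain ⟨z, rfl⟩ := h
    rw [stalkIdeal_ker_eq_closureIdeal i U hb (specializes_map_genericPoint i z)] at hbot
    exact hne z hbot
  · rw [stalkIdeal_ker_eq_top i U hb h] at hbot
    exact top_ne_bot hbot

variable {i} {j : BZ ⟶ B} [IsIntegral BZ] [IsDominant j]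

theorem IsBlowup.isBlowupLocalRing_of_specializes (hj : IsBlowup i.ker j) {y : BZ}
    (h : i (genericPoint Z) ⤳ j y) :
    letI := (stalkToFunctionField j (j y)).toAlgebra
    ∃ t, IsBlowupLocalRing (closureIdeal h) t (localRing BZ y) := by
  obtain ⟨U, hU, hb, -⟩ := exists_isAffineOpen_mem_and_subset (x := j y) (U := ⊤) trivial
  rw [← stalkIdeal_ker_eq_closureIdeal i ⟨U, hU⟩ hb h]
  exact hj.isBlowupLocalRing ⟨U, hU⟩ hb

omit [IsIntegral Z] in
/-- A blow-up is an isomorphism outside its centre. -/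
theorem IsBlowup.localRing_eq (hj : IsBlowup i.ker j) {y : BZ} (h : j y ∉ Set.range i) :
    localRing BZ y = (localRing B (j y)).map (functionFieldMap j) := by
  apply le_antisymm
  · obtain ⟨U, hU, hb, -⟩ := exists_isAffineOpen_mem_and_subset (x := j y) (U := ⊤) trivial
    let := (stalkToFunctionField j (j y)).toAlgebra
    obtain ⟨t, H⟩ := hj.isBlowupLocalRing ⟨U, hU⟩ hb
    rw [stalkIdeal_ker_eq_top i ⟨U, hU⟩ hb h] at H
    -- Outside the centre the ideal is the unit ideal, so `1` may serve as the chart and all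
    -- denominators become units of the base.
    have H1 : IsBlowupLocalRing (⊤ : Ideal (B.presheaf.stalk (j y))) 1 (localRing BZ y) := by
      refine H.change_chart trivial (by simp) ?_
      rw [map_one, div_one]
      exact H.algebraMap_mem t
    intro q hq
    obtain ⟨e, a, -, s, -, hs0, hsu, hqs⟩ := H1.exists_fraction q hq
    rw [map_one, one_pow, div_one] at hsu
    have hs : (algebraMap _ B.functionField s)⁻¹ ∈ localRing B (j y) :=
      inv_mem_localRing_of_functionFieldMap j (algebraMap_mem_localRing s) hsu
    refine ⟨algebraMap _ _ a * (algebraMap _ _ s)⁻¹,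
      Subring.mul_mem _ (algebraMap_mem_localRing a) hs, ?_⟩
    rw [map_mul, map_inv₀]
    exact (mul_inv_eq_iff_eq_mul₀ hs0).mpr hqs.symm
  · rintro _ ⟨q, hq, rfl⟩
    exact functionFieldMap_mem_localRing j hq

end BlowupAlongSubvariety

/-! ### Birationality of the normalized base change. -/

section Birational

theorem IsNormalization.isDominant {Y X : Scheme.{u}} {ν : Y ⟶ X} (h : IsNormalization ν) :
    IsDominant ν := by
  obtain ⟨U, hU, hiso⟩ := h.birational
  refine ⟨hU.mono fun x hx => ?_⟩
  let x' : U.toScheme := ⟨x, hx⟩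
  refine ⟨(ν ⁻¹ᵁ U).ι (inv (ν ∣_ U) x'), ?_⟩
  have h1 : inv (ν ∣_ U) ≫ (ν ⁻¹ᵁ U).ι ≫ ν = U.ι := by
    rw [← morphismRestrict_ι, IsIso.inv_hom_id_assoc]
  exact congr($h1 x')

theorem fromSpecStalk_genericPoint_comp {X Y : Scheme.{u}} [IsIntegral X] [IsIntegral Y] (f : X ⟶ Y)
    [IsDominant f] : X.fromSpecStalk (genericPoint X) ≫ f =
      Spec.map (CommRingCat.ofHom (functionFieldMap f)) ≫ Y.fromSpecStalk (genericPoint Y) := by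
  rw [← Scheme.SpecMap_stalkMap_fromSpecStalk]
  rw [← Scheme.SpecMap_stalkSpecializes_fromSpecStalk (specializes_of_eq (map_genericPoint f)),
    ← Spec.map_comp_assoc]
  rfl

theorem functionFieldMap_comm {X Y Y' W : Scheme.{u}} [IsIntegral X] [IsIntegral Y] [IsIntegral Y']
    [IsIntegral W] {f : X ⟶ Y} {g : Y ⟶ W} {f' : X ⟶ Y'} {g' : Y' ⟶ W} [IsDominant f] [IsDominant g]
    [IsDominant f'] [IsDominant g'] (h : f ≫ g = f' ≫ g') (q : W.functionField) :
    functionFieldMap f (functionFieldMap g q) = functionFieldMap f' (functionFieldMap g' q) := by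
  have h' : functionFieldMap (f ≫ g) q = functionFieldMap (f' ≫ g') q := by simp only [h]
  rwa [functionFieldMap_comp, functionFieldMap_comp] at h'

/-- For an epimorphism the two inclusions into `L' ⊗ L'` agree, so `a ⊗ 1 = 1 ⊗ a`. A linear
functional that kills `1` but not `a` contradicts this. -/
theorem surjective_of_epi {L L' : Type u} [Field L] [Field L'] (f : L →+* L')
    [Epi (CommRingCat.ofHom f)] : Function.Surjective f := by
  let := f.toAlgebra
  let i₁ : CommRingCat.of L' ⟶ .of (TensorProduct L L' L') :=
    CommRingCat.ofHom Algebra.TensorProduct.includeLeftRingHom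
  let i₂ : CommRingCat.of L' ⟶ .of (TensorProduct L L' L') :=
    CommRingCat.ofHom (Algebra.TensorProduct.includeRight (R := L) (A := L')).toRingHom
  have h : i₁ = i₂ := by
    rw [← cancel_epi (CommRingCat.ofHom f)]
    ext c
    change algebraMap L L' c ⊗ₜ[L] (1 : L') = (1 : L') ⊗ₜ[L] algebraMap L L' c
    rw [Algebra.algebraMap_eq_smul_one, TensorProduct.smul_tmul]
  intro a
  by_contra ha
  have ha' : a ∉ Submodule.span L {(1 : L')} := fun hmem => by
    obtain ⟨c, hc⟩ := Submodule.mem_span_singleton.mp hmem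
    exact ha ⟨c, by rw [← hc, Algebra.smul_def, mul_one]; rfl⟩
  obtain ⟨l, hl, hl'⟩ := Submodule.exists_le_ker_of_notMem ha'
  have h1 : l 1 = 0 := hl' (Submodule.mem_span_singleton_self 1)
  have h2 : a ⊗ₜ[L] (1 : L') = (1 : L') ⊗ₜ[L] a := congr($(h).hom a)
  have h3 := congrArg ((TensorProduct.lid L L').toLinearMap ∘ₗ (l.rTensor L')) h2
  simp [h1] at h3
  exact hl h3

/-- The generic point lies in the open set over which `ν` is an isomorphism, and the spectrum of a
stalk is a monomorphism into it. -/
theorem IsNormalization.mono_fromSpecStalk {Y X : Scheme.{u}} [IsIntegral Y] {ν : Y ⟶ X}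
    (h : IsNormalization ν) : Mono (Y.fromSpecStalk (genericPoint Y) ≫ ν) := by
  obtain ⟨U, hU, hiso⟩ := h.birational
  have := h.isDominant
  obtain ⟨_, hx, y, rfl⟩ := ν.denseRange.inter_open_nonempty U U.isOpen (by
    have : Nonempty X := ⟨ν (genericPoint Y)⟩
    exact hU.nonempty)
  have hη : genericPoint Y ∈ ν ⁻¹ᵁ U := genericPoint_mem (x := y) hx
  let g := (ν ⁻¹ᵁ U).fromSpecStalkOfMem (genericPoint Y) hη
  have hg : g ≫ (ν ⁻¹ᵁ U).ι = Y.fromSpecStalk (genericPoint Y) :=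
    (ν ⁻¹ᵁ U).fromSpecStalkOfMem_ι _ hη
  have : Mono (g ≫ (ν ⁻¹ᵁ U).ι) := by
    rw [hg]
    infer_instance
  have : Mono g := mono_of_mono g (ν ⁻¹ᵁ U).ι
  rw [← hg, Category.assoc, ← morphismRestrict_ι]
  infer_instance

/-- The normalized base change of `ρ : X ⟶ B` along a birational morphism has the same function
field as `X`. -/
theorem IsNormalization.functionFieldMap_surjective {X B BZ Xt : Scheme.{u}} [IsIntegral X]
    [IsIntegral B] [IsIntegral BZ] [IsIntegral Xt] {ρ : X ⟶ B} {j : BZ ⟶ B} [IsDominant ρ]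
    [IsDominant j] (hj : Function.Bijective (functionFieldMap j)) {ν : Xt ⟶ pullback ρ j}
    (hν : IsNormalization ν) [IsDominant (ν ≫ pullback.fst ρ j)]
    [IsDominant (ν ≫ pullback.snd ρ j)] :
    Function.Surjective (functionFieldMap (ν ≫ pullback.fst ρ j)) := by
  let τ : BZ.functionField →+* X.functionField :=
    (functionFieldMap ρ).comp (RingEquiv.ofBijective _ hj).symm.toRingHom
  have hτ (q) : τ (functionFieldMap j q) = functionFieldMap ρ q :=
    congrArg (functionFieldMap ρ) ((RingEquiv.ofBijective _ hj).symm_apply_apply q)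
  have hτ' (q) : functionFieldMap (ν ≫ pullback.fst ρ j) (τ q) =
      functionFieldMap (ν ≫ pullback.snd ρ j) q := by
    obtain ⟨q, rfl⟩ := hj.2 q
    rw [hτ]
    exact functionFieldMap_comm (by simp only [Category.assoc, pullback.condition]) q
  let T : BZ.functionField ⟶ X.functionField := CommRingCat.ofHom τ
  let Fj : B.functionField ⟶ BZ.functionField := CommRingCat.ofHom (functionFieldMap j)
  let Fρ : B.functionField ⟶ X.functionField := CommRingCat.ofHom (functionFieldMap ρ)
  let Fπ : X.functionField ⟶ Xt.functionField :=
    CommRingCat.ofHom (functionFieldMap (ν ≫ pullback.fst ρ j))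
  let Fσ : BZ.functionField ⟶ Xt.functionField :=
    CommRingCat.ofHom (functionFieldMap (ν ≫ pullback.snd ρ j))
  have hT : Fj ≫ T = Fρ := CommRingCat.hom_ext (RingHom.ext hτ)
  have hT' : T ≫ Fπ = Fσ := CommRingCat.hom_ext (RingHom.ext hτ')
  have hρ : X.fromSpecStalk (genericPoint X) ≫ ρ = Spec.map Fρ ≫ B.fromSpecStalk _ :=
    fromSpecStalk_genericPoint_comp ρ
  have hj' : BZ.fromSpecStalk (genericPoint BZ) ≫ j = Spec.map Fj ≫ B.fromSpecStalk _ :=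
    fromSpecStalk_genericPoint_comp j
  have hπ : Xt.fromSpecStalk (genericPoint Xt) ≫ ν ≫ pullback.fst ρ j =
      Spec.map Fπ ≫ X.fromSpecStalk _ := fromSpecStalk_genericPoint_comp _
  have hσ : Xt.fromSpecStalk (genericPoint Xt) ≫ ν ≫ pullback.snd ρ j =
      Spec.map Fσ ≫ BZ.fromSpecStalk _ := fromSpecStalk_genericPoint_comp _
  -- As `j` is birational, `Spec K(X)` maps to the base change, and the generic point of `Xt`
  -- factors through it. A monomorphism that factors makes its first factor a monomorphism; dually,
  -- `K(X) → K(Xt)` is an epimorphism of fields.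
  let g : Spec X.functionField ⟶ pullback ρ j :=
    pullback.lift (X.fromSpecStalk (genericPoint X))
      (Spec.map T ≫ BZ.fromSpecStalk (genericPoint BZ)) (by
        rw [hρ, Category.assoc, hj', ← hT, Spec.map_comp, Category.assoc])
  have hg : Spec.map Fπ ≫ g = Xt.fromSpecStalk (genericPoint Xt) ≫ ν := by
    apply pullback.hom_ext
    · rw [Category.assoc, pullback.lift_fst, ← hπ, Category.assoc]
    · rw [Category.assoc, pullback.lift_snd, Category.assoc, hσ, ← hT', Spec.map_comp,
        Category.assoc]
  have := hν.mono_fromSpecStalk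
  rw [← hg] at this
  have : Mono (Spec.map Fπ) := mono_of_mono _ g
  have : Epi Fπ := by
    refine ⟨fun a b hab => Spec.map_injective ?_⟩
    rw [← cancel_mono (Spec.map Fπ), ← Spec.map_comp, ← Spec.map_comp, hab]
  exact @surjective_of_epi X.functionField Xt.functionField _ _
    (functionFieldMap (ν ≫ pullback.fst ρ j)) this

end Birational

/-! ### Integral elements and normal points. -/

section Integral

variable {X Y : Scheme.{u}} [IsIntegral X] [IsIntegral Y]

theorem mem_localRing_of_isIntegralElem (x : X) [IsIntegrallyClosed (X.presheaf.stalk x)]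
    {R : Type*} [CommRing R] (g : R →+* X.functionField) (hg : ∀ a, g a ∈ localRing X x)
    {q : X.functionField} (hq : g.IsIntegralElem q) : q ∈ localRing X x := by
  have h1 : IsIntegral (localRing X x) q := by
    obtain ⟨p, hp, hq⟩ := hq
    refine ⟨p.map (g.codRestrict _ hg), hp.map _, ?_⟩
    rw [Polynomial.eval₂_map]
    exact hq
  have h2 : IsIntegral (X.presheaf.stalk x) q := by
    obtain ⟨p, hp, hq⟩ := h1
    let e : X.presheaf.stalk x ≃+* localRing X x := RingEquiv.ofBijective
      ((algebraMap (X.presheaf.stalk x) X.functionField).codRestrict (localRing X x)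
        algebraMap_mem_localRing)
      ⟨fun a b hab => algebraMap_stalk_injective x (congrArg Subtype.val hab),
        fun ⟨a, b, hb⟩ => ⟨b, Subtype.ext hb⟩⟩
    refine ⟨p.map e.symm.toRingHom, hp.map _, ?_⟩
    have h3 : (algebraMap (X.presheaf.stalk x) X.functionField).comp e.symm.toRingHom =
        algebraMap (localRing X x) X.functionField :=
      RingHom.ext fun c => congrArg Subtype.val (e.apply_symm_apply c)
    rw [Polynomial.eval₂_map, h3]
    exact hq
  obtain ⟨a, rfl⟩ := IsIntegrallyClosed.isIntegral_iff.mp h2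
  exact algebraMap_mem_localRing a

variable (f : X ⟶ Y) [IsDominant f] [IsIntegralHom f]

theorem isIntegral_of_mem_pushforwardLocalRing {y : Y} {q : X.functionField}
    (hq : q ∈ pushforwardLocalRing f y) :
    letI := (functionFieldMap f).toAlgebra
    IsIntegral (localRing Y y) q := by
  let := (functionFieldMap f).toAlgebra
  obtain ⟨U, hUa, hy, -⟩ := exists_isAffineOpen_mem_and_subset (x := y) (U := ⊤) trivial
  have hU := genericPoint_mem hy
  have hV := genericPoint_mem_preimage f hU
  obtain ⟨a, s, hs, h⟩ := exists_fraction_of_mem_pushforwardLocalRing f hUa hU hy hq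
  have ha : IsIntegral (localRing Y y) (sectionMap _ hV a) := by
    obtain ⟨p, hp, hpa⟩ := f.isIntegral_app U hUa a
    let g : Γ(Y, U) →+* localRing Y y :=
      (sectionMap U hU).codRestrict _ fun a => sectionMap_mem_localRing hy _ a
    refine ⟨p.map g, hp.map g, ?_⟩
    rw [Polynomial.eval₂_map]
    have h1 : (algebraMap (localRing Y y) X.functionField).comp g =
        (sectionMap _ hV).comp (f.app U).hom := by
      ext c
      exact functionFieldMap_sectionMap f hU hV c
    rw [h1, ← Polynomial.hom_eval₂, hpa, map_zero]
  have hsu : (sectionMap U hU s)⁻¹ ∈ localRing Y y := by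
    rw [← algebraMap_germ hy hU]
    exact (inv_algebraMap_mem_localRing hs.ne_zero).mpr hs
  have hs0 : functionFieldMap f (sectionMap U hU s) ≠ 0 := by
    rw [map_ne_zero, ← algebraMap_germ hy hU]
    exact (map_ne_zero_iff _ (algebraMap_stalk_injective y)).mpr hs.ne_zero
  have h2 : q = algebraMap (localRing Y y) X.functionField ⟨_, hsu⟩ * sectionMap _ hV a := by
    change q = functionFieldMap f (sectionMap U hU s)⁻¹ * _
    rw [← h, map_inv₀, mul_comm, mul_assoc, mul_inv_cancel₀ hs0, mul_one]
  rw [h2]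
  exact isIntegral_algebraMap.mul ha

theorem mem_pushforwardLocalRing_iff_isIntegral {y : Y}
    (hX : ∀ x, f x = y → IsIntegrallyClosed (X.presheaf.stalk x)) {q : X.functionField} :
    letI := (functionFieldMap f).toAlgebra
    q ∈ pushforwardLocalRing f y ↔ IsIntegral (localRing Y y) q := by
  let := (functionFieldMap f).toAlgebra
  refine ⟨isIntegral_of_mem_pushforwardLocalRing f, fun h => ?_⟩
  rw [mem_pushforwardLocalRing]
  rintro x rfl
  have := hX x rfl
  exact mem_localRing_of_isIntegralElem x (algebraMap (localRing Y (f x)) X.functionField)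
    (fun a => functionFieldMap_mem_localRing f a.2) h

end Integral

/-! ### Generators of the dualizing module. -/

section CanonicalGenerator

variable {K L V : Type*} [Field K] [Field L] [Algebra K L] [AddCommGroup V] [Module K V]

/-- `θ` is the element for which `θ φ` is the functional that is zero at `1` and `ω` at `z`. -/
structure IsCanonicalGenerator (φ : L →ₗ[K] V) (z : L) (ω : V) (θ : L) : Prop where
  map_eq_zero : φ θ = 0
  map_mul_eq : φ (θ * z) = ω

variable {φ : L →ₗ[K] V} {z : L} {h : K} {ω : V} {θ : L}

theorem linearMap_add_mul (φ : L →ₗ[K] V) (a b : K) (x z : L) :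
    φ (x * (algebraMap K L a + algebraMap K L b * z)) = a • φ x + b • φ (x * z) := by
  rw [← map_smul, ← map_smul, ← map_add]
  congr 1
  simp only [Algebra.smul_def]
  ring

/-- With `φ 1 = p ω` and `φ z = q ω`, this is a linear system of two equations with determinant `q²
- h p²` up to sign. -/
theorem IsSquareRootGenerator.exists_isCanonicalGenerator (hz : IsSquareRootGenerator z h)
    (hφ : φ ≠ 0) (hω : ∀ v : V, ∃ c : K, v = c • ω) : ∃ θ, IsCanonicalGenerator φ z ω θ := by
  obtain ⟨p, hp⟩ := hω (φ 1)
  obtain ⟨q, hq⟩ := hω (φ z)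
  -- Otherwise either `φ = 0`, or `z = ± q / p` lies in `K`.
  have hΔ : q ^ 2 - h * p ^ 2 ≠ 0 := by
    intro h0
    by_cases hp0 : p = 0
    · have hq0 : q = 0 := by simpa [hp0] using h0
      refine hφ (LinearMap.ext fun x => ?_)
      obtain ⟨a, b, rfl⟩ := hz.exists_eq x
      have := linearMap_add_mul φ a b 1 z
      rw [one_mul, one_mul, hp, hq, hp0, hq0] at this
      rw [this]
      simp
    · have h1 : (z - algebraMap K L (q / p)) * (z + algebraMap K L (q / p)) = 0 := by
        have : h = (q / p) ^ 2 := by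
          rw [div_pow, eq_div_iff (pow_ne_zero 2 hp0)]
          linear_combination -h0
        have h2 := hz.sq_eq
        rw [this, map_pow] at h2
        linear_combination h2
      rcases mul_eq_zero.mp h1 with h1 | h1
      · exact hz.notMem (q / p) (sub_eq_zero.mp h1)
      · refine hz.notMem (-(q / p)) ?_
        rw [map_neg]
        exact eq_neg_of_add_eq_zero_left h1
  refine ⟨algebraMap K L (q / (q ^ 2 - h * p ^ 2)) +
    algebraMap K L (-p / (q ^ 2 - h * p ^ 2)) * z, ?_, ?_⟩
  · have := linearMap_add_mul φ (q / (q ^ 2 - h * p ^ 2)) (-p / (q ^ 2 - h * p ^ 2)) 1 z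
    rw [one_mul, one_mul, hp, hq, smul_smul, smul_smul, ← add_smul] at this
    rw [this, div_mul_eq_mul_div, div_mul_eq_mul_div, ← add_div]
    rw [show q * p + -p * q = 0 by ring, zero_div, zero_smul]
  · have h1 := linearMap_add_mul φ (q / (q ^ 2 - h * p ^ 2)) (-p / (q ^ 2 - h * p ^ 2)) z z
    have h2 : φ (z * z) = h • φ 1 := by
      rw [← map_smul, Algebra.smul_def, mul_one, ← hz.sq_eq, pow_two]
    rw [h2, hp, hq, smul_smul, smul_smul, smul_smul, ← add_smul] at h1
    rw [mul_comm, h1]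
    have : q / (q ^ 2 - h * p ^ 2) * q + -p / (q ^ 2 - h * p ^ 2) * h * p = 1 := by
      field_simp
      ring
    rw [this, one_smul]

namespace IsCanonicalGenerator

theorem ne_zero (hθ : IsCanonicalGenerator φ z ω θ) (hω : ω ≠ 0) : θ ≠ 0 := by
  rintro rfl
  exact hω (by rw [← hθ.map_mul_eq, zero_mul, map_zero])

theorem map_mul (hθ : IsCanonicalGenerator φ z ω θ) (a b : K) :
    φ (θ * (algebraMap K L a + algebraMap K L b * z)) = b • ω := by
  rw [linearMap_add_mul, hθ.map_eq_zero, hθ.map_mul_eq, smul_zero, zero_add]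

theorem map_mul_mul (hz : IsSquareRootGenerator z h) (hθ : IsCanonicalGenerator φ z ω θ) (a b : K) :
    φ (θ * (algebraMap K L a + algebraMap K L b * z) * z) = a • ω := by
  have : θ * (algebraMap K L a + algebraMap K L b * z) * z =
      θ * (algebraMap K L (b * h) + algebraMap K L a * z) := by
    rw [_root_.map_mul, ← hz.sq_eq]
    ring
  rw [this, hθ.map_mul]

theorem eq (hz : IsSquareRootGenerator z h) (hω : ω ≠ 0) {θ' : L}
    (hθ : IsCanonicalGenerator φ z ω θ) (hθ' : IsCanonicalGenerator φ z ω θ') : θ = θ' := by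
  have h0 := hθ.ne_zero hω
  obtain ⟨a, b, hab⟩ := hz.exists_eq (θ' / θ)
  have h1 : θ' = θ * (algebraMap K L a + algebraMap K L b * z) := by
    rw [← hab, mul_div_cancel₀ _ h0]
  have hb : b • ω = 0 := by rw [← hθ.map_mul, ← h1, hθ'.map_eq_zero]
  have ha : (a - 1) • ω = 0 := by
    rw [sub_smul, one_smul, ← hθ.map_mul_mul hz a b, ← h1, hθ'.map_mul_eq, sub_self]
  rw [smul_eq_zero_iff_left hω] at ha hb
  rw [h1, hb, sub_eq_zero.mp ha]
  simp

/-- Rescaling `z` by `a` and `ω` by `b` changes the generator by `b / a`. With `a = t ^ (-⌊m/2⌋)`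
and `b = t ^ (-(r-1))` this is the whole comparison of canonical classes. -/
theorem smul (hθ : IsCanonicalGenerator φ z ω θ) {a b : K} (ha : a ≠ 0) :
    IsCanonicalGenerator φ (algebraMap K L a * z) (b • ω) (algebraMap K L (b / a) * θ) where
  map_eq_zero := by rw [← Algebra.smul_def, map_smul, hθ.map_eq_zero, smul_zero]
  map_mul_eq := by
    rw [← hθ.map_mul_eq, ← map_smul, Algebra.smul_def, map_div₀]
    congr 1
    have : algebraMap K L a ≠ 0 := by simpa using ha
    field_simp

end IsCanonicalGenerator

/-- Any two functionals are proportional over `L`. -/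
theorem IsSquareRootGenerator.exists_linearMap_eq (hz : IsSquareRootGenerator z h) {φ' : L →ₗ[K] V}
    (hφ : φ ≠ 0) (hφ' : φ' ≠ 0) (hω0 : ω ≠ 0) (hω : ∀ v : V, ∃ c : K, v = c • ω) :
    ∃ g : L, g ≠ 0 ∧ ∀ x, φ' x = φ (g * x) := by
  obtain ⟨θ, hθ⟩ := hz.exists_isCanonicalGenerator hφ hω
  obtain ⟨θ', hθ'⟩ := hz.exists_isCanonicalGenerator hφ' hω
  have h0' := hθ'.ne_zero hω0
  refine ⟨θ / θ', div_ne_zero (hθ.ne_zero hω0) h0', fun x => ?_⟩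
  obtain ⟨a, b, hab⟩ := hz.exists_eq (x / θ')
  have h1 : x = θ' * (algebraMap K L a + algebraMap K L b * z) := by
    rw [← hab, mul_div_cancel₀ _ h0']
  have h2 : θ / θ' * x = θ * (algebraMap K L a + algebraMap K L b * z) := by
    rw [h1, ← mul_assoc, div_mul_cancel₀ _ h0']
  rw [h2, h1, hθ.map_mul, hθ'.map_mul]

end CanonicalGenerator

section LocalFrame

variable (k : Type u) {K L : Type u} [Field k] [Field K] [Field L] [Algebra k K] [Algebra K L] (n : ℕ)

/-- `A = R ⊕ R z` with `z² = h`, and `ω` generates the lattice of `n`-forms over `R`. -/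
structure IsLocalFrame (R : Subring K) (A : Subring L) (z : L) (h : K) (ω : ⋀[K]^n Ω[K⁄k]) :
    Prop where
  generator : IsSquareRootGenerator z h
  ring_eq : (A : Set L) = doubleCoverRing R z
  ne_zero : ω ≠ 0
  exists_smul : ∀ v : ⋀[K]^n Ω[K⁄k], ∃ c : K, v = c • ω
  formLattice_eq : formLattice k K n R = Submodule.span R {ω}

namespace IsLocalFrame

variable {k n} {R : Subring K} {A : Subring L} {z : L} {h : K} {ω : ⋀[K]^n Ω[K⁄k]}
  (F : IsLocalFrame k n R A z h ω)

include F

theorem mem_iff {x : L} : x ∈ A ↔ ∃ a ∈ R, ∃ b ∈ R, x = algebraMap K L a + algebraMap K L b * z := by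
  rw [← SetLike.mem_coe, F.ring_eq]
  rfl

theorem z_mem : z ∈ A := F.mem_iff.mpr ⟨0, R.zero_mem, 1, R.one_mem, by simp⟩

theorem h_mem : h ∈ R := by
  obtain ⟨a, ha, b, hb, hab⟩ := F.mem_iff.mp (A.mul_mem F.z_mem F.z_mem)
  have : algebraMap K L h + algebraMap K L 0 * z = algebraMap K L a + algebraMap K L b * z := by
    rw [← hab, ← F.generator.sq_eq, map_zero]
    ring
  rw [(F.generator.eq_and_eq this).1]
  exact ha

theorem norm_mem {g : L} (hg : g ∈ A) : Algebra.norm K g ∈ R := by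
  obtain ⟨a, ha, b, hb, rfl⟩ := F.mem_iff.mp hg
  rw [F.generator.norm_eq]
  exact R.sub_mem (R.pow_mem ha 2) (R.mul_mem (R.pow_mem hb 2) F.h_mem)

theorem smul_mem_formLattice_iff {c : K} : c • ω ∈ formLattice k K n R ↔ c ∈ R := by
  rw [F.formLattice_eq, Submodule.mem_span_singleton]
  constructor
  · rintro ⟨a, ha⟩
    have : (a : K) = c := smul_left_injective K F.ne_zero ha
    rw [← this]
    exact a.2
  · intro hc
    exact ⟨⟨c, hc⟩, rfl⟩

/-- For `A = R ⊕ R z` with `z² ∈ R`, the module of functionals is free of rank one over `A`,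
generated by the one that reads off the coefficient of `z`. Testing on `1` and `z` recovers both
coefficients of the multiplier. -/
theorem forall_mem_formLattice_iff {φ : L →ₗ[K] ⋀[K]^n Ω[K⁄k]} {θ θ' : L}
    (hθ : IsCanonicalGenerator φ z ω θ) :
    (∀ a ∈ A, φ (θ' * a) ∈ formLattice k K n R) ↔ ∃ a ∈ A, θ' = a * θ := by
  constructor
  · intro H
    have h0 := hθ.ne_zero F.ne_zero
    obtain ⟨a, b, hab⟩ := F.generator.exists_eq (θ' / θ)
    have h1 : θ' = θ * (algebraMap K L a + algebraMap K L b * z) := by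
      rw [← hab, mul_div_cancel₀ _ h0]
    have hb := H 1 A.one_mem
    rw [mul_one, h1, hθ.map_mul, F.smul_mem_formLattice_iff] at hb
    have ha := H z F.z_mem
    rw [h1, hθ.map_mul_mul F.generator, F.smul_mem_formLattice_iff] at ha
    exact ⟨_, F.mem_iff.mpr ⟨a, ha, b, hb, rfl⟩, by rw [h1, mul_comm]⟩
  · rintro ⟨g, hg, rfl⟩ a ha
    obtain ⟨c, hc, d, hd, hcd⟩ := F.mem_iff.mp (A.mul_mem hg ha)
    rw [show g * θ * a = θ * (g * a) by ring, hcd, hθ.map_mul, F.smul_mem_formLattice_iff]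
    exact hd

theorem span_eq {φ : L →ₗ[K] ⋀[K]^n Ω[K⁄k]} {θ : L} (hθ : IsCanonicalGenerator φ z ω θ)
    {S : Subring L} (hS : A ≤ S) :
    Submodule.span S {θ' | ∀ a ∈ A, φ (θ' * a) ∈ formLattice k K n R} = Submodule.span S {θ} := by
  apply le_antisymm
  · refine Submodule.span_le.mpr fun θ' hθ' => ?_
    obtain ⟨a, ha, rfl⟩ := (F.forall_mem_formLattice_iff hθ).mp hθ'
    exact Submodule.mem_span_singleton.mpr ⟨⟨a, hS ha⟩, rfl⟩
  · refine Submodule.span_mono (Set.singleton_subset_iff.mpr ?_)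
    exact (F.forall_mem_formLattice_iff hθ).mpr ⟨1, A.one_mem, (one_mul θ).symm⟩

end IsLocalFrame

end LocalFrame

/-! ### Divisors with one local generator. -/

section Divisors

theorem span_singleton_eq_iff {L : Type*} [Field L] {S : Subring L} {x y : L} (hx : x ≠ 0) (hy : y ≠ 0) :
    Submodule.span S {x} = Submodule.span S {y} ↔ x / y ∈ S ∧ y / x ∈ S := by
  have key {x y : L} (hy : y ≠ 0) : Submodule.span S {x} ≤ Submodule.span S {y} ↔ x / y ∈ S := by
    rw [Submodule.span_singleton_le_iff_mem, Submodule.mem_span_singleton]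
    constructor
    · rintro ⟨a, ha⟩
      have : x = a * y := ha.symm
      rw [this, mul_div_cancel_right₀ _ hy]
      exact a.2
    · intro h
      exact ⟨⟨_, h⟩, div_mul_cancel₀ x hy⟩
  rw [le_antisymm_iff, key hy, key hx]

theorem pullback_apply_of_eq_span {X Y : Scheme.{u}} [IsIntegral X] [IsIntegral Y] (π : Y ⟶ X)
    [IsDominant π] {D : Divisor X} {y : Y} {g : X.functionField}
    (hD : D (π y) = Submodule.span (localRing X (π y)) {g}) :
    D.pullback π y = Submodule.span (localRing Y y) {functionFieldMap π g} := by
  rw [Divisor.pullback, hD]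
  apply le_antisymm
  · refine Submodule.span_le.mpr ?_
    rintro _ ⟨_, h, rfl⟩
    obtain ⟨a, rfl⟩ := Submodule.mem_span_singleton.mp h
    refine Submodule.mem_span_singleton.mpr ⟨⟨_, functionFieldMap_mem_localRing π a.2⟩, ?_⟩
    exact (map_mul (functionFieldMap π) (a : X.functionField) g).symm
  · refine Submodule.span_mono (Set.singleton_subset_iff.mpr ?_)
    exact ⟨g, Submodule.mem_span_singleton_self g, rfl⟩

end Divisors

section Coordinates

open KaehlerDifferential

variable {k O K : Type u} [Field k] [CommRing O] [Field K] [Algebra k O] [Algebra k K] [Algebra O K]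
  [IsScalarTower k O K] {n r : ℕ} {x : Fin n → O}

theorem exists_derivations_of_coordinates (e : Module.Basis (Fin n) O (Ω[O⁄k]))
    (he : ∀ i, e i = D k O (x i)) (I : Ideal O) :
    ∃ δ : {i : Fin n // i.val < r} → Derivation k O (O ⧸ I),
      ∀ i j, δ i (x j.1) = if i = j then 1 else 0 := by
  classical
  obtain ⟨δ, hδ⟩ := exists_dual_derivations e he I
  refine ⟨fun i => δ i.1, fun i j => ?_⟩
  rw [hδ]
  simp only [Subtype.ext_iff]

theorem span_coordinates_eq (x : Fin n → O) (r : ℕ) :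
    Ideal.span {y | ∃ l : Fin n, l.val < r ∧ x l = y} =
      Ideal.span (Set.range fun l : {l : Fin n // l.val < r} => x l.1) := by
  congr 1
  ext y
  constructor
  · rintro ⟨l, hl, rfl⟩
    exact ⟨⟨l, hl⟩, rfl⟩
  · rintro ⟨l, rfl⟩
    exact ⟨l.1, l.2, rfl⟩

theorem hasAdditiveOrder_of_coordinates (e : Module.Basis (Fin n) O (Ω[O⁄k]))
    (he : ∀ i, e i = D k O (x i)) {I : Ideal O} [I.IsPrime] [Algebra.FormallySmooth k O]
    (hI : I = Ideal.span {y | ∃ l : Fin n, l.val < r ∧ x l = y}) : HasAdditiveOrder I := by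
  obtain ⟨δ, hδ⟩ := exists_derivations_of_coordinates (r := r) e he I
  exact hasAdditiveOrder_of_derivations (hI.trans (span_coordinates_eq x r)) δ hδ

theorem span_D_coordinates_eq_top (e : Module.Basis (Fin n) O (Ω[O⁄k]))
    (he : ∀ i, e i = D k O (x i)) : Submodule.span O (Set.range fun i => D k O (x i)) = ⊤ := by
  rw [← e.span_eq]
  congr 1
  ext v
  simp only [Set.mem_range, he]

theorem ιMulti_coordinates_ne_zero [IsDomain O] [IsFractionRing O K]
    (e : Module.Basis (Fin n) O (Ω[O⁄k])) (he : ∀ i, e i = D k O (x i)) :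
    exteriorPower.ιMulti K n (fun i => D k K (algebraMap O K (x i))) ≠ 0 := by
  have := ιMulti_basis_ne_zero (kaehlerBasis (K := K) e)
  rwa [show ⇑(kaehlerBasis (K := K) e) = fun i => D k K (algebraMap O K (x i)) from
    funext (kaehlerBasis_apply e he)] at this

theorem exists_eq_smul_ιMulti_coordinates [IsDomain O] [IsFractionRing O K]
    (e : Module.Basis (Fin n) O (Ω[O⁄k])) (he : ∀ i, e i = D k O (x i)) (v : ⋀[K]^n Ω[K⁄k]) :
    ∃ c : K, v = c • exteriorPower.ιMulti K n (fun i => D k K (algebraMap O K (x i))) := by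
  have := exteriorPower_eq_smul_ιMulti (kaehlerBasis (K := K) e) v
  rwa [show ⇑(kaehlerBasis (K := K) e) = fun i => D k K (algebraMap O K (x i)) from
    funext (kaehlerBasis_apply e he)] at this

/-- The points of a blow-up lie on the charts given by generators of the ideal. -/
theorem IsBlowupLocalRing.exists_generator {O K : Type*} [CommRing O] [Field K] [Algebra O K]
    {I : Ideal O} {t : O} {R : Subring K} [IsLocalRing R] (H : IsBlowupLocalRing I t R) {S : Set O}
    (hI : I = Ideal.span S) : ∃ x ∈ S, IsBlowupLocalRing I x R := by
  -- If the point lay on no such chart, all quotients `x / t` with `x ∈ S`, hence all `a / t` with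
  -- `a ∈ I`, would be nonunits. But `t / t = 1`.
  by_contra! hcon
  have hne (x : O) (hx : x ∈ S) :
      ∃ m ∈ IsLocalRing.maximalIdeal R, (m : K) = algebraMap O K x / algebraMap O K t := by
    have hxI : x ∈ I := hI ▸ Ideal.subset_span hx
    refine ⟨⟨_, H.div_mem x hxI⟩, ?_, rfl⟩
    rw [IsLocalRing.mem_maximalIdeal, mem_nonunits_iff]
    intro hu
    obtain ⟨w, hw⟩ := hu.exists_right_inv
    have hw' : algebraMap O K x / algebraMap O K t * (w : K) = 1 := congrArg Subtype.val hw
    have hx0 : algebraMap O K x ≠ 0 := by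
      intro h0
      rw [h0, zero_div, zero_mul] at hw'
      exact zero_ne_one hw'
    refine hcon x hx (H.change_chart hxI hx0 ?_)
    have : algebraMap O K t / algebraMap O K x = w := by
      rw [← inv_div]
      exact inv_eq_of_mul_eq_one_right hw'
    rw [this]
    exact w.2
  have key : ∀ a ∈ I,
      ∃ m ∈ IsLocalRing.maximalIdeal R, (m : K) = algebraMap O K a / algebraMap O K t := by
    intro a ha
    rw [hI] at ha
    induction ha using Submodule.span_induction with
    | mem a ha => exact hne a ha
    | zero => exact ⟨0, Ideal.zero_mem _, by simp⟩
    | add a b _ _ ha hb =>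
      obtain ⟨p, hp, hp'⟩ := ha
      obtain ⟨q, hq, hq'⟩ := hb
      exact ⟨p + q, Ideal.add_mem _ hp hq, by rw [map_add, add_div, ← hp', ← hq']; rfl⟩
    | smul c a _ ha =>
      obtain ⟨p, hp, hp'⟩ := ha
      exact ⟨⟨_, H.algebraMap_mem c⟩ * p, Ideal.mul_mem_left _ _ hp, by
        rw [smul_eq_mul, map_mul, mul_div_assoc, ← hp']; rfl⟩
  obtain ⟨p, hp, hp'⟩ := key t H.mem
  rw [div_self H.ne_zero] at hp'
  have : p = 1 := Subtype.ext hp'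
  rw [this] at hp
  exact (Ideal.ne_top_iff_one _).mp (IsLocalRing.maximalIdeal.isMaximal R).ne_top hp

end Coordinates

/-! ### Local frames on the double cover. -/

section SchemeFrames

open KaehlerDifferential

theorem localRing_isLocalRing (Y : Scheme.{u}) [IsIntegral Y] (y : Y) :
    IsLocalRing (localRing Y y) :=
  IsLocalRing.of_surjective'
    ((algebraMap (Y.presheaf.stalk y) Y.functionField).codRestrict (localRing Y y)
      algebraMap_mem_localRing) fun ⟨_, b, hb⟩ => ⟨b, Subtype.ext hb⟩

theorem isFractionRing_stalkToFunctionField {B B' : Scheme.{u}} [IsIntegral B] [IsIntegral B']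
    (j : B' ⟶ B) [IsDominant j] (hj : Function.Bijective (functionFieldMap j)) (b : B) :
    letI := (stalkToFunctionField j b).toAlgebra
    IsFractionRing (B.presheaf.stalk b) B'.functionField := by
  let := (stalkToFunctionField j b).toAlgebra
  have : FaithfulSMul (B.presheaf.stalk b) B'.functionField :=
    (faithfulSMul_iff_algebraMap_injective _ _).mpr (stalkToFunctionField_injective j b)
  refine IsFractionRing.of_field _ _ fun q => ?_
  obtain ⟨q, rfl⟩ := hj.2 q
  obtain ⟨a, s, -, rfl⟩ := IsFractionRing.div_surjective (A := B.presheaf.stalk b) q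
  exact ⟨a, s, (map_div₀ (functionFieldMap j) _ _)⟩

variable {k : Type u} [Field k] {B X : Scheme.{u}} [IsIntegral B] [IsIntegral X]
  (s : B ⟶ Spec (.of k)) (ρ : X ⟶ B) [IsDominant ρ] (n : ℕ)

theorem isLocalFrame_of_coordinates {b : B} :
    letI := (scalarMap s).toAlgebra
    letI := (functionFieldMap ρ).toAlgebra
    letI := (stalkScalarMap s b).toAlgebra
    ∀ {x : Fin n → B.presheaf.stalk b}
      (e : Module.Basis (Fin n) (B.presheaf.stalk b) (Ω[B.presheaf.stalk b⁄k]))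
      (_ : ∀ l, e l = D k (B.presheaf.stalk b) (x l))
      {z : X.functionField} {h : B.presheaf.stalk b}
      (_ : IsSquareRootGenerator z (algebraMap _ B.functionField h))
      (_ : (pushforwardLocalRing ρ b : Set X.functionField) = doubleCoverRing (localRing B b) z),
      IsLocalFrame k n (localRing B b) (pushforwardLocalRing ρ b) z
        (algebraMap _ B.functionField h)
        (exteriorPower.ιMulti B.functionField n
          fun i => D k B.functionField (algebraMap (B.presheaf.stalk b) B.functionField (x i))) := by
  let := (scalarMap s).toAlgebra
  let := (functionFieldMap ρ).toAlgebra
  let := (stalkScalarMap s b).toAlgebra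
  have : IsScalarTower k (B.presheaf.stalk b) B.functionField :=
    .of_algebraMap_eq fun c => (algebraMap_stalkScalarMap s b c).symm
  intro x e he z h hz hA
  exact ⟨hz, hA, ιMulti_coordinates_ne_zero e he, exists_eq_smul_ιMulti_coordinates e he,
    formLattice_range_eq (fun a => Iff.rfl) (span_D_coordinates_eq_top e he)⟩

end SchemeFrames

/-! ### The normalized base change over the blow-up. -/

section NormalizedBaseChange

open KaehlerDifferential

variable {B X BZ Xt : Scheme.{u}} [IsIntegral B] [IsIntegral X] [IsIntegral BZ] [IsIntegral Xt]
  {ρ : X ⟶ B} {j : BZ ⟶ B} {π : Xt ⟶ X} {σ : Xt ⟶ BZ} [IsDominant ρ] [IsDominant j] [IsDominant π]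
  [IsDominant σ] (hcomm : π ≫ ρ = σ ≫ j) (hπ : Function.Surjective (functionFieldMap π))

include hcomm hπ

theorem mem_localRing_of_isIntegralElem_map (x : X) [IsIntegrallyClosed (X.presheaf.stalk x)]
    {R : Type*} [CommRing R] (g : R →+* BZ.functionField)
    (hg : ∀ c, ∃ p ∈ localRing B (ρ x), functionFieldMap j p = g c) {q : X.functionField}
    (hq : ((functionFieldMap σ).comp g).IsIntegralElem (functionFieldMap π q)) :
    q ∈ localRing X x := by
  let e := RingEquiv.ofBijective (functionFieldMap π) ⟨(functionFieldMap π).injective, hπ⟩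
  refine mem_localRing_of_isIntegralElem x (e.symm.toRingHom.comp ((functionFieldMap σ).comp g))
    (fun c => ?_) ?_
  · obtain ⟨p, hp, hpc⟩ := hg c
    have : e.symm.toRingHom.comp ((functionFieldMap σ).comp g) c = functionFieldMap ρ p := by
      change e.symm (functionFieldMap σ (g c)) = _
      rw [← hpc, ← functionFieldMap_comm hcomm]
      exact e.symm_apply_apply _
    rw [this]
    exact functionFieldMap_mem_localRing ρ hp
  · obtain ⟨p, hp, hpq⟩ := hq
    refine ⟨p, hp, ?_⟩
    have h1 := congrArg e.symm.toRingHom hpq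
    rw [Polynomial.hom_eval₂, map_zero] at h1
    have h2 : e.symm.toRingHom (functionFieldMap π q) = q := e.symm_apply_apply q
    rwa [h2] at h1

theorem IsSquareRootGenerator.map_functionFieldMap (hj : Function.Bijective (functionFieldMap j))
    {z : X.functionField} {h : B.functionField} :
    letI := (functionFieldMap ρ).toAlgebra
    letI := (functionFieldMap σ).toAlgebra
    IsSquareRootGenerator z h →
    IsSquareRootGenerator (functionFieldMap π z) (functionFieldMap j h) := by
  let := (functionFieldMap ρ).toAlgebra
  let := (functionFieldMap σ).toAlgebra
  intro H
  refine ⟨?_, fun a ha => ?_, fun x => ?_⟩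
  · rw [← map_pow, H.sq_eq]
    exact functionFieldMap_comm hcomm h
  · obtain ⟨a, rfl⟩ := hj.2 a
    exact H.notMem a ((functionFieldMap π).injective
      (ha.trans (functionFieldMap_comm hcomm a).symm))
  · obtain ⟨x, rfl⟩ := hπ x
    obtain ⟨a, b, rfl⟩ := H.exists_eq x
    refine ⟨functionFieldMap j a, functionFieldMap j b, ?_⟩
    rw [map_add, map_mul]
    change functionFieldMap π (functionFieldMap ρ a) + functionFieldMap π (functionFieldMap ρ b) * _ =
      functionFieldMap σ _ + functionFieldMap σ _ * _
    rw [functionFieldMap_comm hcomm, functionFieldMap_comm hcomm]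

variable [IsIntegralHom σ] (hXt : ∀ x : Xt, IsIntegrallyClosed (Xt.presheaf.stalk x))

include hXt

/-- Where `X` is normal and `BZ ⟶ B` is an isomorphism, the cover is unchanged. -/
theorem pushforwardLocalRing_eq_of_localRing_eq {y : BZ}
    (hy : localRing BZ y = (localRing B (j y)).map (functionFieldMap j))
    (hX : ∀ x, ρ x = j y → IsIntegrallyClosed (X.presheaf.stalk x)) {z : X.functionField} :
    letI := (functionFieldMap ρ).toAlgebra
    letI := (functionFieldMap σ).toAlgebra
    (pushforwardLocalRing ρ (j y) : Set X.functionField) = doubleCoverRing (localRing B (j y)) z →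
    (pushforwardLocalRing σ y : Set Xt.functionField) =
      doubleCoverRing (localRing BZ y) (functionFieldMap π z) := by
  let := (functionFieldMap ρ).toAlgebra
  let := (functionFieldMap σ).toAlgebra
  intro hA
  ext q
  rw [SetLike.mem_coe]
  constructor
  · intro hq
    rw [mem_pushforwardLocalRing_iff_isIntegral σ (fun x _ => hXt x)] at hq
    obtain ⟨q, rfl⟩ := hπ q
    have hq' : q ∈ pushforwardLocalRing ρ (j y) := by
      rw [mem_pushforwardLocalRing]
      intro x hx
      have := hX x hx
      refine mem_localRing_of_isIntegralElem_map hcomm hπ x (localRing BZ y).subtype (fun c => ?_) hq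
      obtain ⟨p, hp, hpc⟩ := hy.le c.2
      exact ⟨p, by rwa [hx], hpc⟩
    rw [← SetLike.mem_coe, hA] at hq'
    obtain ⟨a, ha, b, hb, rfl⟩ := hq'
    refine ⟨_, functionFieldMap_mem_localRing j ha, _, functionFieldMap_mem_localRing j hb, ?_⟩
    rw [map_add, map_mul]
    change functionFieldMap π (functionFieldMap ρ a) + functionFieldMap π (functionFieldMap ρ b) * _ =
      functionFieldMap σ _ + functionFieldMap σ _ * _
    rw [functionFieldMap_comm hcomm, functionFieldMap_comm hcomm]
  · rintro ⟨a, ha, b, hb, rfl⟩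
    refine Subring.add_mem _ (functionFieldMap_mem_pushforwardLocalRing σ ha)
      (Subring.mul_mem _ (functionFieldMap_mem_pushforwardLocalRing σ hb) ?_)
    rw [mem_pushforwardLocalRing]
    rintro x rfl
    have hz : z ∈ pushforwardLocalRing ρ (j (σ x)) := by
      rw [← SetLike.mem_coe, hA]
      exact ⟨0, Subring.zero_mem _, 1, Subring.one_mem _, by simp⟩
    rw [mem_pushforwardLocalRing] at hz
    exact functionFieldMap_mem_localRing π (hz (π x) congr($hcomm x))

/-- The normalization of the cover at a point of the blow-up over the centre. -/
theorem pushforwardLocalRing_eq_of_isBlowupLocalRing {Z : Set B} [IsIntegralHom ρ]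
    (hj : Function.Bijective (functionFieldMap j))
    (hX : ∀ x, ρ x ∉ Z → IsIntegrallyClosed (X.presheaf.stalk x)) {y : BZ}
    {I : Ideal (B.presheaf.stalk (j y))}
    (hZ : ∀ b : B, ∀ hb : b ⤳ j y, b ∈ Z →
      I ≤ closureIdeal hb) (h2 : IsUnit (2 : B.presheaf.stalk (j y))) (hI : HasAdditiveOrder I)
    {z : X.functionField} {h : B.presheaf.stalk (j y)} {m : ℕ} (hm : h ∈ I ^ m)
    (hm' : h ∉ I ^ (m + 1)) {t : B.presheaf.stalk (j y)} :
    letI := (functionFieldMap ρ).toAlgebra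
    letI := (functionFieldMap σ).toAlgebra
    letI := (stalkToFunctionField j (j y)).toAlgebra
    IsSquareRootGenerator z (algebraMap _ B.functionField h) →
    (pushforwardLocalRing ρ (j y) : Set X.functionField) = doubleCoverRing (localRing B (j y)) z →
    IsBlowupLocalRing I t (localRing BZ y) →
    (pushforwardLocalRing σ y : Set Xt.functionField) =
      doubleCoverRing (localRing BZ y) (algebraMap BZ.functionField Xt.functionField
        (algebraMap _ BZ.functionField t ^ (m / 2))⁻¹ * functionFieldMap π z) := by
  let := (functionFieldMap ρ).toAlgebra
  let := (functionFieldMap σ).toAlgebra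
  let := (stalkToFunctionField j (j y)).toAlgebra
  intro hz hA H
  have h2' : IsUnit (2 : BZ.functionField) := by
    have := h2.map (algebraMap (B.presheaf.stalk (j y)) BZ.functionField)
    rwa [map_ofNat] at this
  have h2m : (2 : BZ.functionField)⁻¹ ∈ localRing BZ y := by
    obtain ⟨c, hc⟩ := h2.exists_right_inv
    have h1 := congrArg (algebraMap (B.presheaf.stalk (j y)) BZ.functionField) hc
    rw [map_mul, map_one, map_ofNat] at h1
    rw [inv_eq_of_mul_eq_one_right h1]
    exact H.algebraMap_mem c
  have hz' : IsSquareRootGenerator (functionFieldMap π z)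
      (algebraMap (B.presheaf.stalk (j y)) BZ.functionField h) :=
    hz.map_functionFieldMap hcomm hπ hj
  have ht0 : t ≠ 0 := by
    rintro rfl
    exact H.ne_zero (map_zero _)
  have ht1 : algebraMap (B.presheaf.stalk (j y)) B.functionField t ≠ 0 :=
    (map_ne_zero_iff _ (algebraMap_stalk_injective _)).mpr ht0
  ext q
  rw [SetLike.mem_coe, mem_pushforwardLocalRing_iff_isIntegral σ (fun x _ => hXt x)]
  refine H.isIntegral_iff (stalkToFunctionField_injective j (j y)) hI hz' hm hm' h2m h2'.ne_zero
    (fun q hq => ?_) q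
  obtain ⟨q, rfl⟩ := hπ q
  -- Since `t` lies in the ideal of the centre, points where `t` is invertible lie outside the
  -- centre. There `X` is normal, so an element integral over `O[1/t]` is regular.
  obtain ⟨e, he⟩ := exists_pow_mul_mem_pushforwardLocalRing ρ
    (algebraMap_mem_localRing t) ht1 (q := q) (fun x hx ht => by
      have hxZ : ρ x ∉ Z := by
        intro hxZ
        have h1 : (B.presheaf.stalkSpecializes hx).hom t ∈
          IsLocalRing.maximalIdeal _ := hZ _ hx hxZ H.mem
        rw [IsLocalRing.mem_maximalIdeal, mem_nonunits_iff] at h1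
        refine h1 ((inv_algebraMap_mem_localRing ?_).mp ?_)
        · intro h0
          have := algebraMap_stalkSpecializes hx t
          rw [h0, map_zero] at this
          exact ht1 this.symm
        · rwa [algebraMap_stalkSpecializes]
      have := hX x hxZ
      refine mem_localRing_of_isIntegralElem_map hcomm hπ x
        (invSubring BZ.functionField t).subtype (fun c => ?_) hq
      obtain ⟨e, a, hea⟩ := c.2
      refine ⟨algebraMap _ _ a * ((algebraMap _ _ t)⁻¹) ^ e,
        Subring.mul_mem _ (localRing_le_of_specializes hx (algebraMap_mem_localRing a))
          (Subring.pow_mem _ ht e), ?_⟩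
      have hea' : functionFieldMap j (algebraMap _ _ t) ^ e * (c : BZ.functionField) =
        functionFieldMap j (algebraMap _ _ a) := hea
      have ht2 : functionFieldMap j (algebraMap _ _ t) ≠ 0 := (map_ne_zero _).mpr ht1
      rw [map_mul, map_pow, map_inv₀, ← hea', inv_pow, mul_comm,
        inv_mul_cancel_left₀ (pow_ne_zero _ ht2)]
      rfl)
  rw [← SetLike.mem_coe, hA] at he
  obtain ⟨_, ⟨a, rfl⟩, _, ⟨b, rfl⟩, hab⟩ := he
  refine ⟨e, a, b, ?_⟩
  have h1 := congrArg (functionFieldMap π) hab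
  rw [map_mul, map_pow, map_add, map_mul, functionFieldMap_comm hcomm] at h1
  refine h1.trans ?_
  change functionFieldMap π (functionFieldMap ρ _) + functionFieldMap π (functionFieldMap ρ _) * _ =
    functionFieldMap σ (functionFieldMap j _) + functionFieldMap σ (functionFieldMap j _) * _
  rw [functionFieldMap_comm hcomm, functionFieldMap_comm hcomm]

end NormalizedBaseChange

/-! ### Compatible local frames on the cover and on its transform. -/

section Frames

open KaehlerDifferential

section Algebra

variable {k O K L : Type u} [Field k] [CommRing O] [IsDomain O] [Field K] [Field L] [Algebra k O]
  [Algebra k K] [Algebra O K] [Algebra K L] [IsScalarTower k O K] [IsFractionRing O K] {n : ℕ}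
  {x : Fin n → O} {R : Subring K} {A : Subring L} {z : L} {h : K}

theorem IsLocalFrame.of_range (e : Module.Basis (Fin n) O (Ω[O⁄k])) (he : ∀ l, e l = D k O (x l))
    (hz : IsSquareRootGenerator z h) (hA : (A : Set L) = doubleCoverRing R z)
    (hR : ∀ a, a ∈ R ↔ ∃ b : O, algebraMap O K b = a) : IsLocalFrame k n R A z h
      (exteriorPower.ιMulti K n fun l => D k K (algebraMap O K (x l))) :=
  ⟨hz, hA, ιMulti_coordinates_ne_zero e he, exists_eq_smul_ιMulti_coordinates e he,
    formLattice_range_eq hR (span_D_coordinates_eq_top e he)⟩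

theorem IsLocalFrame.of_isBlowupLocalRing (e : Module.Basis (Fin n) O (Ω[O⁄k]))
    (he : ∀ l, e l = D k O (x l)) (hz : IsSquareRootGenerator z h)
    (hA : (A : Set L) = doubleCoverRing R z) {I : Ideal O} {r : ℕ} {l : Fin n} (hlr : l.val < r)
    (hrn : r ≤ n) (H : IsBlowupLocalRing I (x l) R)
    (hI : I = Ideal.span {y | ∃ i : Fin n, i.val < r ∧ x i = y}) : IsLocalFrame k n R A z h
      ((algebraMap O K (x l) ^ (r - 1))⁻¹ •
        exteriorPower.ιMulti K n fun l => D k K (algebraMap O K (x l))) := by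
  have h0 := pow_ne_zero (r - 1) H.ne_zero
  refine ⟨hz, hA, smul_ne_zero (inv_ne_zero h0) (ιMulti_coordinates_ne_zero e he), fun v => ?_,
    H.formLattice_eq hlr hrn hI (span_D_coordinates_eq_top e he)⟩
  obtain ⟨c, rfl⟩ := exists_eq_smul_ιMulti_coordinates e he v
  refine ⟨c * algebraMap O K (x l) ^ (r - 1), ?_⟩
  rw [smul_smul, mul_assoc, mul_inv_cancel₀ h0, mul_one]

end Algebra

theorem exists_coordinates_of_specializes {k : Type u} [Field k] {B Z : Scheme.{u}} [IsIntegral B]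
    [IsIntegral Z] (s : B ⟶ Spec (.of k)) (i : Z ⟶ B) [IsClosedImmersion i]
    (n d r : ℕ) (hdr : d + r = n) [SmoothOfRelativeDimension n s]
    [SmoothOfRelativeDimension d (i ≫ s)] {b : B} (hb : i (genericPoint Z) ⤳ b) :
    letI := (stalkScalarMap s b).toAlgebra
    ∃ (x : Fin n → B.presheaf.stalk b)
      (e : Module.Basis (Fin n) (B.presheaf.stalk b) (Ω[B.presheaf.stalk b⁄k])),
      (∀ l, e l = D k (B.presheaf.stalk b) (x l)) ∧
      closureIdeal hb = Ideal.span {y | ∃ l : Fin n, l.val < r ∧ x l = y} := by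
  obtain ⟨w, rfl⟩ := (specializes_iff_mem_range i).mp hb
  exact exists_coordinates_of_mem s i n d r hdr w

theorem closureIdeal_trans_le {B : Scheme.{u}} {ζ b c : B} (h : ζ ⤳ c) (hζ : ζ ⤳ b) (hb : b ⤳ c) :
    closureIdeal h ≤ closureIdeal hb := by
  intro a ha
  change (B.presheaf.stalkSpecializes hb).hom a ∈ IsLocalRing.maximalIdeal _
  have ha' : (B.presheaf.stalkSpecializes h).hom a ∈ IsLocalRing.maximalIdeal _ := ha
  rw [IsLocalRing.mem_maximalIdeal, mem_nonunits_iff] at ha' ⊢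
  intro hu
  apply ha'
  have := hu.map (B.presheaf.stalkSpecializes hζ).hom
  have h1 : (B.presheaf.stalkSpecializes hζ).hom ((B.presheaf.stalkSpecializes hb).hom a) =
      (B.presheaf.stalkSpecializes h).hom a :=
    congr($(B.presheaf.stalkSpecializes_comp hζ hb).hom a)
  rwa [h1] at this

variable {k : Type u} [Field k] {B X Z BZ Xt : Scheme.{u}} [IsIntegral B] [IsIntegral X] [IsIntegral Z]
  [IsIntegral BZ] [IsIntegral Xt] (s : B ⟶ Spec (.of k)) (n : ℕ) [SmoothOfRelativeDimension n s]
  {ρ : X ⟶ B} {j : BZ ⟶ B} {π : Xt ⟶ X} {σ : Xt ⟶ BZ} [IsDominant ρ] [IsDominant j] [IsDominant π]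
  [IsDominant σ] [IsIntegralHom σ]

omit [IsIntegral B] in
theorem isUnit_two_stalk (hk : (2 : k) ≠ 0) (s : B ⟶ Spec (.of k)) (b : B) :
    IsUnit (2 : B.presheaf.stalk b) := by
  have := (isUnit_iff_ne_zero.mpr hk).map (stalkScalarMap s b)
  rwa [map_ofNat] at this

theorem isScalarTower_stalkToFunctionField (s : B ⟶ Spec (.of k)) (j : BZ ⟶ B) [IsDominant j]
    (b : B) :
    letI := (stalkScalarMap s b).toAlgebra
    letI := (scalarMap (j ≫ s)).toAlgebra
    letI := (stalkToFunctionField j b).toAlgebra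
    IsScalarTower k (B.presheaf.stalk b) BZ.functionField := by
  let := (stalkScalarMap s b).toAlgebra
  let := (scalarMap (j ≫ s)).toAlgebra
  let := (stalkToFunctionField j b).toAlgebra
  refine .of_algebraMap_eq fun c => ?_
  change scalarMap (j ≫ s) c = functionFieldMap j (algebraMap _ _ (stalkScalarMap s b c))
  rw [algebraMap_stalkScalarMap, functionFieldMap_scalarMap]

/-- Local generators outside the centre of the blow-up. -/
theorem IsDoubleCover.exists_isLocalFrame_of_localRing_eq (hk : (2 : k) ≠ 0) (hρ : IsDoubleCover ρ)
    (hcomm : π ≫ ρ = σ ≫ j) (hπ : Function.Surjective (functionFieldMap π))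
    (hj : Function.Bijective (functionFieldMap j))
    (hXt : ∀ x : Xt, IsIntegrallyClosed (Xt.presheaf.stalk x)) {y : BZ}
    (hy : localRing BZ y = (localRing B (j y)).map (functionFieldMap j))
    (hX : ∀ x, ρ x = j y → IsIntegrallyClosed (X.presheaf.stalk x)) :
    letI := (scalarMap s).toAlgebra
    letI := (scalarMap (j ≫ s)).toAlgebra
    letI := (functionFieldMap ρ).toAlgebra
    letI := (functionFieldMap σ).toAlgebra
    ∃ (x : Fin n → B.functionField) (z : X.functionField) (h : B.functionField),
      IsLocalFrame k n (localRing B (j y)) (pushforwardLocalRing ρ (j y)) z h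
        (exteriorPower.ιMulti B.functionField n fun l => D k B.functionField (x l)) ∧
      IsLocalFrame k n (localRing BZ y) (pushforwardLocalRing σ y) (functionFieldMap π z)
        (functionFieldMap j h) (exteriorPower.ιMulti BZ.functionField n
          fun l => D k BZ.functionField (functionFieldMap j (x l))) := by
  let := (scalarMap s).toAlgebra
  let := (scalarMap (j ≫ s)).toAlgebra
  let := (functionFieldMap ρ).toAlgebra
  let := (functionFieldMap σ).toAlgebra
  let := (stalkScalarMap s (j y)).toAlgebra
  let := (stalkToFunctionField j (j y)).toAlgebra
  have := isScalarTower_stalkToFunctionField s j (j y)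
  have := isFractionRing_stalkToFunctionField j hj (j y)
  obtain ⟨z, h, hz, hA⟩ := hρ.exists_equation (j y) (isUnit_two_stalk hk s _)
  obtain ⟨x, e, he⟩ := exists_coordinates s n (j y)
  refine ⟨fun l => algebraMap _ _ (x l), z, algebraMap _ _ h,
    isLocalFrame_of_coordinates s ρ n e he hz hA, ?_⟩
  refine IsLocalFrame.of_range (O := B.presheaf.stalk (j y)) e he
    (hz.map_functionFieldMap hcomm hπ hj)
    (pushforwardLocalRing_eq_of_localRing_eq hcomm hπ hXt hy hX hA) fun a => ?_
  rw [hy]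
  constructor
  · rintro ⟨_, ⟨b, rfl⟩, rfl⟩
    exact ⟨b, rfl⟩
  · rintro ⟨b, rfl⟩
    exact ⟨_, algebraMap_mem_localRing b, rfl⟩

/-- Local generators over the centre of the blow-up. -/
theorem IsDoubleCover.exists_isLocalFrame_of_specializes (hk : (2 : k) ≠ 0) (hρ : IsDoubleCover ρ)
    {i : Z ⟶ B} [IsClosedImmersion i] {d r : ℕ} (hdr : d + r = n)
    [SmoothOfRelativeDimension d (i ≫ s)] {m : ℕ}
    (hm : HasBranchMultiplicity ρ (i (genericPoint Z)) m)
    (hX : ∀ x : X, ρ x ∉ Set.range i → IsIntegrallyClosed (X.presheaf.stalk x))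
    (hcomm : π ≫ ρ = σ ≫ j) (hπ : Function.Surjective (functionFieldMap π))
    (hj : Function.Bijective (functionFieldMap j)) (hblow : IsBlowup i.ker j)
    (hXt : ∀ x : Xt, IsIntegrallyClosed (Xt.presheaf.stalk x)) {y : BZ}
    (hy : i (genericPoint Z) ⤳ j y) :
    letI := (scalarMap s).toAlgebra
    letI := (scalarMap (j ≫ s)).toAlgebra
    letI := (functionFieldMap ρ).toAlgebra
    letI := (functionFieldMap σ).toAlgebra
    letI := (stalkToFunctionField j (j y)).toAlgebra
    ∃ (x : Fin n → B.functionField) (z : X.functionField) (h : B.functionField)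
      (t : B.presheaf.stalk (j y)),
      IsLocalFrame k n (localRing B (j y)) (pushforwardLocalRing ρ (j y)) z h
        (exteriorPower.ιMulti B.functionField n fun l => D k B.functionField (x l)) ∧
      IsBlowupLocalRing (closureIdeal hy) t (localRing BZ y) ∧
      IsLocalFrame k n (localRing BZ y) (pushforwardLocalRing σ y)
        (algebraMap BZ.functionField Xt.functionField (stalkToFunctionField j (j y) t ^ (m / 2))⁻¹ *
          functionFieldMap π z)
        (((stalkToFunctionField j (j y) t ^ (m / 2))⁻¹) ^ 2 * functionFieldMap j h)
        ((stalkToFunctionField j (j y) t ^ (r - 1))⁻¹ •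
          exteriorPower.ιMulti BZ.functionField n
            fun l => D k BZ.functionField (functionFieldMap j (x l))) := by
  let := (scalarMap s).toAlgebra
  let := (scalarMap (j ≫ s)).toAlgebra
  let := (functionFieldMap ρ).toAlgebra
  let := (functionFieldMap σ).toAlgebra
  let := (stalkScalarMap s (j y)).toAlgebra
  let := (stalkToFunctionField j (j y)).toAlgebra
  have := isScalarTower_stalkToFunctionField s j (j y)
  have := isFractionRing_stalkToFunctionField j hj (j y)
  have := hρ.isFinite
  have hB := isSmoothLocalRing_stalk s n (j y)
  have := hB.isNoetherianRing
  have := hB.formallySmooth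
  have h2 := isUnit_two_stalk hk s (j y)
  have h2' : (2 : B.functionField) ≠ 0 := by
    have := h2.map (algebraMap (B.presheaf.stalk (j y)) B.functionField)
    rw [map_ofNat] at this
    exact this.ne_zero
  obtain ⟨z, h, hz, hA⟩ := hρ.exists_equation (j y) h2
  obtain ⟨x, e, he, hI⟩ := exists_coordinates_of_specializes s i n d r hdr hy
  have hord := hasAdditiveOrder_of_coordinates e he hI
  obtain ⟨hmem, hmem'⟩ := hm.mem_pow ρ hy h2' hord hz hA
  obtain ⟨t', H'⟩ := hblow.isBlowupLocalRing_of_specializes hy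
  have := localRing_isLocalRing BZ y
  -- The equation of the exceptional divisor is taken among the coordinates, as the computation of
  -- forms requires.
  obtain ⟨_, ⟨l, hl, rfl⟩, H⟩ := H'.exists_generator hI
  have hA' := pushforwardLocalRing_eq_of_isBlowupLocalRing (Z := Set.range i) hcomm hπ hXt hj hX
    (fun b hb hbZ => closureIdeal_trans_le hy ((specializes_iff_mem_range i).mpr hbZ) hb)
    h2 hord hmem hmem' hz hA H
  refine ⟨fun l => algebraMap _ _ (x l), z, algebraMap _ _ h, x l,
    isLocalFrame_of_coordinates s ρ n e he hz hA, H, ?_⟩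
  exact IsLocalFrame.of_isBlowupLocalRing e he
    ((hz.map_functionFieldMap hcomm hπ hj).smul (inv_ne_zero (pow_ne_zero _ H.ne_zero)))
    hA' hl (by omega) H hI

end Frames

/-! ### Orders along the exceptional divisor. -/

section Order

/-- The function `f = a / c` has nonnegative order. If `P > M`, then `c / t ^ (e + 1)` would be a
product of elements of `R`, contrary to the exact order of `c`. -/
theorem IsBlowupLocalRing.le_of_div_pow_mem {O K : Type*} [CommRing O] [Field K] [Algebra O K]
    {I : Ideal O} {t : O} {R : Subring K} (H : IsBlowupLocalRing I t R)
    (hinj : Function.Injective (algebraMap O K)) (hI : HasAdditiveOrder I)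
    (ht : (algebraMap O K t)⁻¹ ∉ R) {a c : O} {e : ℕ} (ha : a ∈ I ^ e) (hc : c ∈ I ^ e)
    (hc' : c ∉ I ^ (e + 1)) {f : K} (hf0 : f ≠ 0) (hf : f * algebraMap O K c = algebraMap O K a)
    {P M : ℕ} (hfR : (f * algebraMap O K t ^ P / algebraMap O K t ^ M)⁻¹ ∈ R) : P ≤ M := by
  by_contra! hlt
  refine H.div_pow_succ_notMem hinj hI ht hc hc' ?_
  have ht0 := H.ne_zero
  have h1 := R.mul_mem (R.mul_mem hfR (H.div_pow_mem ha))
    (R.pow_mem (H.algebraMap_mem t) (P - M - 1))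
  convert h1 using 1
  obtain ⟨q, rfl⟩ : ∃ q, P = M + 1 + q := ⟨P - M - 1, by omega⟩
  rw [show M + 1 + q - M - 1 = q by omega, ← hf]
  field_simp
  ring

theorem exists_mem_pow_notMem_pow_succ {O : Type*} [CommRing O] [IsLocalRing O] [IsNoetherianRing O]
    {I : Ideal O} (hI : I ≠ ⊤) {a : O} (ha : a ≠ 0) : ∃ p, a ∈ I ^ p ∧ a ∉ I ^ (p + 1) := by
  by_contra! h
  have hall (p : ℕ) : a ∈ I ^ p := by
    induction p with
    | zero => simp
    | succ p ih => exact h p ih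
  have := Ideal.iInf_pow_eq_bot_of_isLocalRing I hI
  exact ha (by
    rw [← Ideal.mem_bot, ← this, Ideal.mem_iInf]
    exact hall)

theorem pow_notMem_pow_succ {O : Type*} [CommRing O] {I : Ideal O} (hI : HasAdditiveOrder I)
    (hI1 : I ≠ ⊤) {x : O} (hx : x ∈ I) (hx' : x ∉ I ^ 2) (e : ℕ) : x ^ e ∉ I ^ (e + 1) := by
  induction e with
  | zero => simpa using (Ideal.ne_top_iff_one I).mp hI1
  | succ e ih =>
    rw [pow_succ x e]
    exact hI (Ideal.pow_mem_pow hx e) ih (p := e) (q := 1) (by simpa using hx) hx'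

end Order

section Centre

variable {B BZ : Scheme.{u}} [IsIntegral B] [IsIntegral BZ] {j : BZ ⟶ B} [IsDominant j]

theorem inv_stalkToFunctionField_notMem {ζ : B} {y : BZ} (hy : ζ ⤳ j y) {t : B.presheaf.stalk (j y)}
    (ht : t ∈ closureIdeal hy) (ht0 : t ≠ 0) :
    (stalkToFunctionField j (j y) t)⁻¹ ∉ localRing BZ y := by
  intro h
  have h1 := inv_mem_localRing_of_functionFieldMap j (algebraMap_mem_localRing t) h
  rw [inv_algebraMap_mem_localRing ht0] at h1
  exact (inferInstance : (closureIdeal hy).IsPrime).ne_top (Ideal.eq_top_of_isUnit_mem _ ht h1)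

/-- The blow-up in a principal ideal is an isomorphism. -/
theorem localRing_eq_of_isBlowupLocalRing_span_singleton {y : BZ} {x : B.presheaf.stalk (j y)} :
    letI := (stalkToFunctionField j (j y)).toAlgebra
    IsBlowupLocalRing (Ideal.span {x}) x (localRing BZ y) →
    localRing BZ y = (localRing B (j y)).map (functionFieldMap j) := by
  let := (stalkToFunctionField j (j y)).toAlgebra
  intro H
  apply le_antisymm
  · intro q hq
    obtain ⟨e, a, ha, s, hs, hs0, hsu, hqs⟩ := H.exists_fraction q hq
    rw [Ideal.span_singleton_pow, Ideal.mem_span_singleton'] at ha hs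
    obtain ⟨a, rfl⟩ := ha
    obtain ⟨s, rfl⟩ := hs
    have hx0 := pow_ne_zero e H.ne_zero
    rw [map_mul, map_pow, mul_div_cancel_right₀ _ hx0] at hsu
    rw [map_mul, map_pow] at hs0
    rw [map_mul, map_mul, map_pow, ← mul_assoc] at hqs
    have hqs' := mul_right_cancel₀ hx0 hqs
    have hs := inv_mem_localRing_of_functionFieldMap j (algebraMap_mem_localRing s) hsu
    refine ⟨algebraMap _ _ a * (algebraMap _ _ s)⁻¹,
      Subring.mul_mem _ (algebraMap_mem_localRing a) hs, ?_⟩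
    rw [map_mul, map_inv₀]
    exact (mul_inv_eq_iff_eq_mul₀ (left_ne_zero_of_mul hs0)).mpr hqs'.symm
  · rintro _ ⟨q, hq, rfl⟩
    exact functionFieldMap_mem_localRing j hq

theorem exists_pow_mul_mem_localRing {b : B} {t : B.functionField}
    (ht : t ∈ localRing B b) (ht0 : t ≠ 0) {q : B.functionField}
    (hq : ∀ x, x ⤳ b → t⁻¹ ∈ localRing B x → q ∈ localRing B x) :
    ∃ e : ℕ, t ^ e * q ∈ localRing B b := by
  obtain ⟨e, he⟩ := exists_pow_mul_mem_pushforwardLocalRing (𝟙 B) ht ht0 (q := q) hq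
  refine ⟨e, ?_⟩
  have h1 : functionFieldMap (𝟙 B) t = t := by
    obtain ⟨U, hU, a, rfl⟩ := B.presheaf.exists_germ_eq t
    exact (functionFieldMap_sectionMap (𝟙 B) hU hU a)
  rw [h1, mem_pushforwardLocalRing] at he
  exact he b rfl

variable {k : Type u} [Field k] {Z : Scheme.{u}} [IsIntegral Z] (s : B ⟶ Spec (.of k)) {n d r : ℕ}
  [SmoothOfRelativeDimension n s] (hdr : d + r = n) {i : Z ⟶ B} [IsClosedImmersion i]
  [SmoothOfRelativeDimension d (i ≫ s)]

include s hdr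

/-- A rational function that is regular outside a subvariety of codimension at least two has no pole
along the exceptional divisor of the blow-up. -/
theorem le_of_forall_mem_localRing (hr : 2 ≤ r) {y : BZ}
    (hy : i (genericPoint Z) ⤳ j y) {f : B.functionField} (hf0 : f ≠ 0)
    (hf : ∀ b, b ∉ Set.range i → f ∈ localRing B b) {t : B.presheaf.stalk (j y)} {P M : ℕ}
    (hfR : (functionFieldMap j f * stalkToFunctionField j (j y) t ^ P /
      stalkToFunctionField j (j y) t ^ M)⁻¹ ∈ localRing BZ y) :
    letI := (stalkToFunctionField j (j y)).toAlgebra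
    IsBlowupLocalRing (closureIdeal hy) t (localRing BZ y) → P ≤ M := by
  let := (stalkToFunctionField j (j y)).toAlgebra
  let := (stalkScalarMap s (j y)).toAlgebra
  intro H
  obtain ⟨x, e, he, hI⟩ := exists_coordinates_of_specializes s i n d r hdr hy
  have hB := isSmoothLocalRing_stalk s n (j y)
  have := hB.isNoetherianRing
  have := hB.formallySmooth
  obtain ⟨δ, hδ⟩ := exists_derivations_of_coordinates (r := r) e he (closureIdeal hy)
  have hI' := hI.trans (span_coordinates_eq x r)
  have hord := hasAdditiveOrder_of_coordinates e he hI
  have hI1 : closureIdeal hy ≠ ⊤ := (inferInstance : (closureIdeal hy).IsPrime).ne_top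
  have ht0 : t ≠ 0 := by
    rintro rfl
    exact H.ne_zero (map_zero _)
  have hxI (l : {l : Fin n // l.val < r}) : x l.1 ∈ closureIdeal hy :=
    hI' ▸ Ideal.subset_span ⟨l, rfl⟩
  have hx2 (l : {l : Fin n // l.val < r}) : x l.1 ∉ closureIdeal hy ^ 2 :=
    coordinate_notMem_sq hI' δ hδ l
  have hx0 (l : {l : Fin n // l.val < r}) : x l.1 ≠ 0 := fun h0 => hx2 l (by
    rw [h0]
    exact Ideal.zero_mem _)
  -- Each `x l` vanishes on the centre, so `f` is regular where `x l` is invertible and needs only a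
  -- power of `x l` as denominator.
  have hreg (l : {l : Fin n // l.val < r}) : ∃ e : ℕ,
      algebraMap (B.presheaf.stalk (j y)) B.functionField (x l.1) ^ e * f ∈ localRing B (j y) := by
    refine exists_pow_mul_mem_localRing (algebraMap_mem_localRing _)
      ((map_ne_zero_iff _ (algebraMap_stalk_injective _)).mpr (hx0 l)) fun b hb hxb => hf b fun hbZ => ?_
    have h1 := closureIdeal_trans_le hy ((specializes_iff_mem_range i).mpr hbZ) hb (hxI l)
    have h2 : (B.presheaf.stalkSpecializes hb).hom (x l.1) ∈ IsLocalRing.maximalIdeal _ := h1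
    rw [IsLocalRing.mem_maximalIdeal, mem_nonunits_iff] at h2
    refine h2 ((inv_algebraMap_mem_localRing ?_).mp ?_)
    · intro h0
      have := algebraMap_stalkSpecializes hb (x l.1)
      rw [h0, map_zero] at this
      exact hx0 l (algebraMap_stalk_injective _ (this.symm.trans (map_zero _).symm))
    · rwa [algebraMap_stalkSpecializes]
  let l₀ : {l : Fin n // l.val < r} := ⟨⟨0, by omega⟩, by change 0 < r; omega⟩
  let l₁ : {l : Fin n // l.val < r} := ⟨⟨1, by omega⟩, by change 1 < r; omega⟩
  have hl : l₀ ≠ l₁ := fun h => zero_ne_one congr($(h).1.val)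
  obtain ⟨e₀, he₀⟩ := hreg l₀
  obtain ⟨e₁, he₁⟩ := hreg l₁
  have hmono {l : {l : Fin n // l.val < r}} {p q : ℕ} (hpq : p ≤ q)
      (h : algebraMap (B.presheaf.stalk (j y)) B.functionField (x l.1) ^ p * f ∈ localRing B (j y)) :
      algebraMap (B.presheaf.stalk (j y)) B.functionField (x l.1) ^ q * f ∈ localRing B (j y) := by
    obtain ⟨c, rfl⟩ := Nat.exists_eq_add_of_le' hpq
    rw [pow_add, mul_assoc]
    exact Subring.mul_mem _ (Subring.pow_mem _ (algebraMap_mem_localRing _) _) h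
  obtain ⟨a, ha⟩ := hmono (le_max_left e₀ e₁) he₀
  obtain ⟨a', ha'⟩ := hmono (le_max_right e₀ e₁) he₁
  -- Codimension at least two enters here: `f` has both a power of `x l₀` and a power of `x l₁` as
  -- denominator.
  have haa : a * x l₁.1 ^ max e₀ e₁ = a' * x l₀.1 ^ max e₀ e₁ := by
    apply algebraMap_stalk_injective
    rw [map_mul, map_mul, map_pow, map_pow, ha, ha']
    ring
  have ha0 : a ≠ 0 := by
    rintro rfl
    rw [map_zero, eq_comm, mul_eq_zero] at ha
    rcases ha with ha | ha
    · exact pow_ne_zero _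
        ((map_ne_zero_iff _ (algebraMap_stalk_injective _)).mpr (hx0 l₀)) ha
    · exact hf0 ha
  obtain ⟨p, hp, hp'⟩ := exists_mem_pow_notMem_pow_succ hI1 ha0
  have hep := le_order_of_mul_pow_eq hI' δ hδ hl hp hp' haa
  refine H.le_of_div_pow_mem (stalkToFunctionField_injective j (j y)) hord
    (inv_stalkToFunctionField_notMem hy H.mem ht0) (Ideal.pow_le_pow_right hep hp)
    (Ideal.pow_mem_pow (hxI l₀) _) (pow_notMem_pow_succ hord hI1 (hxI l₀) (hx2 l₀) (max e₀ e₁))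
    ((map_ne_zero (functionFieldMap j)).mpr hf0) ?_ hfR
  change functionFieldMap j f * functionFieldMap j (algebraMap _ _ _) =
    functionFieldMap j (algebraMap _ _ a)
  rw [ha, ← map_mul, map_pow, mul_comm]

/-- The blow-up along a subvariety of codimension one is an isomorphism. -/
theorem IsBlowup.localRing_eq_of_codim_one (hj : IsBlowup i.ker j) (hr : r = 1) {y : BZ}
    (hy : i (genericPoint Z) ⤳ j y) :
    localRing BZ y = (localRing B (j y)).map (functionFieldMap j) := by
  let := (stalkToFunctionField j (j y)).toAlgebra
  let := (stalkScalarMap s (j y)).toAlgebra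
  obtain ⟨x, e, he, hI⟩ := exists_coordinates_of_specializes s i n d r hdr hy
  obtain ⟨t, H⟩ := hj.isBlowupLocalRing_of_specializes hy
  have := localRing_isLocalRing BZ y
  have hI' : closureIdeal hy = Ideal.span {x ⟨0, by omega⟩} := by
    rw [hI]
    congr 1
    ext c
    constructor
    · rintro ⟨l, hl, rfl⟩
      have : l = ⟨0, by omega⟩ := Fin.ext (by change l.val = 0; omega)
      rw [this]
      rfl
    · rintro rfl
      exact ⟨⟨0, by omega⟩, by change 0 < r; omega, rfl⟩
  obtain ⟨_, rfl, H⟩ := H.exists_generator hI'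
  rw [hI'] at H
  exact localRing_eq_of_isBlowupLocalRing_span_singleton H

end Centre

/-! ### Global functions on proper varieties. -/

section Global

/-- Everywhere regular functions are global sections, and the global sections of an integral proper
scheme over a field form a field. -/
theorem inv_mem_localRing_of_isProper {k : Type u} [Field k] {B : Scheme.{u}} [IsIntegral B]
    (s : B ⟶ Spec (.of k)) [IsProper s] {f : B.functionField} (hf : ∀ b, f ∈ localRing B b) (b : B) :
    f⁻¹ ∈ localRing B b := by
  by_cases hf0 : f = 0
  · rw [hf0, inv_zero]
    exact Subring.zero_mem _
  have hU : genericPoint B ∈ (⊤ : B.Opens) := trivial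
  obtain ⟨a, rfl⟩ := exists_section_of_forall_mem_localRing ⊤ hU (q := f) fun b _ => hf b
  have ha : a ≠ 0 := by
    rintro rfl
    exact hf0 (map_zero _)
  obtain ⟨c, hc⟩ := (isField_of_universallyClosed k s).mul_inv_cancel ha
  have h1 := congrArg (sectionMap ⊤ hU) hc
  rw [map_mul, map_one] at h1
  rw [inv_eq_of_mul_eq_one_right h1]
  exact sectionMap_mem_localRing (TopologicalSpace.Opens.mem_top b) hU c

end Global

/-! ### Transport of canonical functionals. -/

section Transport

open KaehlerDifferential

variable {k K K' L L' : Type u} [Field k] [Field K] [Field K'] [Field L] [Field L'] [Algebra k K]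
  [Algebra k K'] [Algebra K K'] [IsScalarTower k K K'] [Algebra K L] [Algebra K' L'] (n : ℕ)

/-- Transport of functionals with values in `n`-forms along isomorphisms of fields. -/
noncomputable def transport (τ : L ≃+* L')
    (hτ : ∀ a, τ (algebraMap K L a) = algebraMap K' L' (algebraMap K K' a))
    (hK : Function.Surjective (algebraMap K K')) (φ : L →ₗ[K] ⋀[K]^n Ω[K⁄k]) :
    L' →ₗ[K'] ⋀[K']^n Ω[K'⁄k] where
  toFun l := formMap k K K' n (φ (τ.symm l))
  map_add' a b := by rw [map_add, map_add, map_add]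
  map_smul' a l := by
    obtain ⟨a, rfl⟩ := hK a
    have : τ.symm (algebraMap K K' a • l) = a • τ.symm l := by
      rw [Algebra.smul_def, Algebra.smul_def, ← hτ, map_mul, τ.symm_apply_apply]
    rw [this, map_smul, map_smul, RingHom.id_apply]
    exact (algebraMap_smul K' a _).symm

theorem IsCanonicalGenerator.transport {τ : L ≃+* L'}
    {hτ : ∀ a, τ (algebraMap K L a) = algebraMap K' L' (algebraMap K K' a)}
    {hK : Function.Surjective (algebraMap K K')} {φ : L →ₗ[K] ⋀[K]^n Ω[K⁄k]} {z θ : L} {x : Fin n → K}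
    (h : IsCanonicalGenerator φ z (exteriorPower.ιMulti K n fun l => D k K (x l)) θ) :
    IsCanonicalGenerator (transport n τ hτ hK φ) (τ z)
      (exteriorPower.ιMulti K' n fun l => D k K' (algebraMap K K' (x l))) (τ θ) where
  map_eq_zero := by
    change formMap k K K' n (φ (τ.symm (τ θ))) = 0
    rw [τ.symm_apply_apply, h.map_eq_zero, map_zero]
  map_mul_eq := by
    change formMap k K K' n (φ (τ.symm (τ θ * τ z))) = _
    rw [← _root_.map_mul, τ.symm_apply_apply, h.map_mul_eq, formMap_ιMulti]

theorem IsSquareRootGenerator.norm_algebraMap_mul {K L : Type*} [Field K] [Field L] [Algebra K L]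
    {z : L} {h : K} (H : IsSquareRootGenerator z h) (a : K) (g : L) :
    Algebra.norm K (algebraMap K L a * g) = a ^ 2 * Algebra.norm K g := by
  rw [map_mul, Algebra.norm_algebraMap, Module.finrank_eq_card_basis H.basis, Fintype.card_fin]

theorem IsSquareRootGenerator.exists_linearMap_ne_zero {K L V : Type*} [Field K] [Field L]
    [Algebra K L] [AddCommGroup V] [Module K V] {z : L} {h : K} (H : IsSquareRootGenerator z h)
    {ω : V} (hω : ω ≠ 0) : ∃ φ : L →ₗ[K] V, φ ≠ 0 := by
  refine ⟨(H.basis.coord 0).smulRight ω, fun h0 => hω ?_⟩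
  have := LinearMap.congr_fun h0 (H.basis 0)
  simpa using this

end Transport

section Canonical

open KaehlerDifferential

theorem pushforwardLocalRing_le_localRing {X Y : Scheme.{u}} [IsIntegral X] (f : X ⟶ Y) (x : X) :
    pushforwardLocalRing f (f x) ≤ localRing X x := fun _ hq =>
  (mem_pushforwardLocalRing f).mp hq x rfl

variable {k : Type u} [Field k] {X Y : Scheme.{u}} [IsIntegral X] [IsIntegral Y] (n : ℕ)
  (s : Y ⟶ Spec (.of k)) (f : X ⟶ Y) [IsDominant f]

theorem isCartier_of_exists_isLocalFrame :
    letI := (scalarMap s).toAlgebra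
    letI := (functionFieldMap f).toAlgebra
    (∀ y, ∃ z h ω, IsLocalFrame k n (localRing Y y) (pushforwardLocalRing f y) z h ω) →
    ∀ D ∈ canonicalDivisors n s f, D.IsCartier := by
  let := (scalarMap s).toAlgebra
  let := (functionFieldMap f).toAlgebra
  rintro hF D ⟨φ, hφ, hD⟩ x
  obtain ⟨z, h, ω, F⟩ := hF (f x)
  obtain ⟨θ, hθ⟩ := F.generator.exists_isCanonicalGenerator hφ F.exists_smul
  exact ⟨θ, hθ.ne_zero F.ne_zero,
    (hD x).trans (F.span_eq hθ (pushforwardLocalRing_le_localRing f x))⟩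

end Canonical

/-! ### Comparison of canonical generators. -/

section Comparison

variable {K L V : Type*} [Field K] [Field L] [Algebra K L] [AddCommGroup V] [Module K V]

/-- Both sides are canonical generators of `φ` for the rescaled frame, and such a generator is
unique. -/
theorem IsCanonicalGenerator.mul_eq {φ φ' : L →ₗ[K] V} {z : L} {h : K} {ω : V} {θ θ' g : L}
    (hg : ∀ x, φ' x = φ (g * x)) {u v : K} (hu : u ≠ 0) (hv : v ≠ 0) (hω : ω ≠ 0)
    (hz : IsSquareRootGenerator z h) (hθ : IsCanonicalGenerator φ z ω θ)
    (hθ' : IsCanonicalGenerator φ' (algebraMap K L u⁻¹ * z) (v⁻¹ • ω) θ') :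
    g * θ' = algebraMap K L (u / v) * θ := by
  have h1 := hθ.smul (a := u⁻¹) (b := v⁻¹) (inv_ne_zero hu)
  rw [inv_div_inv] at h1
  refine IsCanonicalGenerator.eq (hz.smul (inv_ne_zero hu))
    (smul_ne_zero (inv_ne_zero hv) hω) ⟨?_, ?_⟩ h1
  · rw [← hg, hθ'.map_eq_zero]
  · rw [mul_assoc, ← hg, hθ'.map_mul_eq]

end Comparison

/-! ### Equality of the two exponents suffices. -/

section Main

open KaehlerDifferential

variable {k : Type u} [Field k] {B X Z BZ Xt : Scheme.{u}} [IsIntegral B] [IsIntegral X] [IsIntegral Z]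
  [IsIntegral BZ] [IsIntegral Xt] (s : B ⟶ Spec (.of k)) (n : ℕ) [SmoothOfRelativeDimension n s]
  {ρ : X ⟶ B} {j : BZ ⟶ B} {π : Xt ⟶ X} {σ : Xt ⟶ BZ} [IsDominant ρ] [IsDominant j] [IsDominant π]
  [IsDominant σ] [IsIntegralHom σ]

/-- At a point `y` of the blow-up, generators for `Xt` arise from those for `X` by dividing by `u`
and `v`. -/
theorem IsDoubleCover.exists_isLocalFrame (hk : (2 : k) ≠ 0) (hρ : IsDoubleCover ρ)
    {i : Z ⟶ B} [IsClosedImmersion i] {d r : ℕ} (hdr : d + r = n)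
    [SmoothOfRelativeDimension d (i ≫ s)] {m : ℕ}
    (hm : HasBranchMultiplicity ρ (i (genericPoint Z)) m)
    (hX : ∀ x : X, ρ x ∉ Set.range i → IsIntegrallyClosed (X.presheaf.stalk x))
    (hcomm : π ≫ ρ = σ ≫ j) (hπ : Function.Surjective (functionFieldMap π))
    (hj : Function.Bijective (functionFieldMap j)) (hblow : IsBlowup i.ker j)
    (hXt : ∀ x : Xt, IsIntegrallyClosed (Xt.presheaf.stalk x)) (y : BZ) :
    letI := (scalarMap s).toAlgebra
    letI := (scalarMap (j ≫ s)).toAlgebra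
    letI := (functionFieldMap ρ).toAlgebra
    letI := (functionFieldMap σ).toAlgebra
    letI := (stalkToFunctionField j (j y)).toAlgebra
    ∃ (x : Fin n → B.functionField) (z : X.functionField) (h : B.functionField)
      (u v h' : BZ.functionField), u ≠ 0 ∧ v ≠ 0 ∧
      IsLocalFrame k n (localRing B (j y)) (pushforwardLocalRing ρ (j y)) z h
        (exteriorPower.ιMulti B.functionField n fun l => D k B.functionField (x l)) ∧
      IsLocalFrame k n (localRing BZ y) (pushforwardLocalRing σ y)
        (algebraMap BZ.functionField Xt.functionField u⁻¹ * functionFieldMap π z) h'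
        (v⁻¹ • exteriorPower.ιMulti BZ.functionField n
            fun l => D k BZ.functionField (functionFieldMap j (x l))) ∧
      ((u = 1 ∧ v = 1 ∧ j y ∉ Set.range i) ∨
        ∃ (hy : i (genericPoint Z) ⤳ j y) (t : B.presheaf.stalk (j y)),
          IsBlowupLocalRing (closureIdeal hy) t (localRing BZ y) ∧
          u = stalkToFunctionField j (j y) t ^ (m / 2) ∧
          v = stalkToFunctionField j (j y) t ^ (r - 1)) := by
  let := (scalarMap s).toAlgebra
  let := (scalarMap (j ≫ s)).toAlgebra
  let := (functionFieldMap ρ).toAlgebra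
  let := (functionFieldMap σ).toAlgebra
  let := (stalkToFunctionField j (j y)).toAlgebra
  by_cases hy : j y ∈ Set.range i
  · have hy' := (specializes_iff_mem_range i).mpr hy
    obtain ⟨x, z, h, t, F, H, F'⟩ :=
      hρ.exists_isLocalFrame_of_specializes s n hk hdr hm hX hcomm hπ hj hblow hXt hy'
    exact ⟨x, z, h, _, _, _, pow_ne_zero _ H.ne_zero, pow_ne_zero _ H.ne_zero, F, F',
      Or.inr ⟨hy', t, H, rfl, rfl⟩⟩
  · obtain ⟨x, z, h, F, F'⟩ := hρ.exists_isLocalFrame_of_localRing_eq s n hk hcomm hπ hj hXt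
      (hblow.localRing_eq hy) fun x hx => hX x (hx ▸ hy)
    refine ⟨x, z, h, 1, 1, functionFieldMap j h, one_ne_zero, one_ne_zero, F, ?_,
      Or.inl ⟨rfl, rfl, hy⟩⟩
    rw [inv_one, map_one, one_mul, one_smul]
    exact F'

omit [SmoothOfRelativeDimension n s] [IsIntegralHom σ] in
/-- The canonical class is preserved if `u` and `v` agree. -/
theorem preservesCanonicalClass_of_exists_isLocalFrame (hcomm : π ≫ ρ = σ ≫ j)
    (hπ : Function.Surjective (functionFieldMap π)) (hj : Function.Bijective (functionFieldMap j)) :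
    letI := (scalarMap s).toAlgebra
    letI := (scalarMap (j ≫ s)).toAlgebra
    letI := (functionFieldMap ρ).toAlgebra
    letI := (functionFieldMap σ).toAlgebra
    (∀ y : BZ, ∃ (x : Fin n → B.functionField) (z : X.functionField) (h : B.functionField)
      (u h' : BZ.functionField), u ≠ 0 ∧
      IsLocalFrame k n (localRing B (j y)) (pushforwardLocalRing ρ (j y)) z h
        (exteriorPower.ιMulti B.functionField n fun l => D k B.functionField (x l)) ∧
      IsLocalFrame k n (localRing BZ y) (pushforwardLocalRing σ y)
        (algebraMap BZ.functionField Xt.functionField u⁻¹ * functionFieldMap π z) h'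
        (u⁻¹ • exteriorPower.ιMulti BZ.functionField n
            fun l => D k BZ.functionField (functionFieldMap j (x l)))) →
    PreservesCanonicalClass n s ρ (j ≫ s) σ π := by
  let := (scalarMap s).toAlgebra
  let := (scalarMap (j ≫ s)).toAlgebra
  let := (functionFieldMap ρ).toAlgebra
  let := (functionFieldMap σ).toAlgebra
  let := (functionFieldMap j).toAlgebra
  have : IsScalarTower k B.functionField BZ.functionField :=
    .of_algebraMap_eq fun c => (functionFieldMap_scalarMap j s c).symm
  intro hF
  let τ := RingEquiv.ofBijective (functionFieldMap π) ⟨(functionFieldMap π).injective, hπ⟩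
  have hτ (a : B.functionField) : τ (algebraMap _ X.functionField a) =
      algebraMap BZ.functionField Xt.functionField (algebraMap _ _ a) := functionFieldMap_comm hcomm a
  obtain ⟨φ, hφ⟩ : ∃ φ : X.functionField →ₗ[B.functionField]
      ⋀[B.functionField]^n Ω[B.functionField⁄k], φ ≠ 0 := by
    obtain ⟨x, z, h, u, h', -, F, -⟩ := hF (genericPoint BZ)
    exact F.generator.exists_linearMap_ne_zero F.ne_zero
  have key (y : BZ) : ∃ z h ω θ z' h' ω',
      IsLocalFrame k n (localRing B (j y)) (pushforwardLocalRing ρ (j y)) z h ω ∧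
      IsCanonicalGenerator φ z ω θ ∧
      IsLocalFrame k n (localRing BZ y) (pushforwardLocalRing σ y) z' h' ω' ∧
      IsCanonicalGenerator (transport n τ hτ hj.2 φ) z' ω' (functionFieldMap π θ) := by
    obtain ⟨x, z, h, u, h', hu, F, F'⟩ := hF y
    obtain ⟨θ, hθ⟩ := F.generator.exists_isCanonicalGenerator hφ F.exists_smul
    refine ⟨z, h, _, θ, _, h', _, F, hθ, F', ?_⟩
    -- As `z` and the form are divided by the same `u`, the generator itself is unchanged.
    have h1 := (hθ.transport n (τ := τ) (hτ := hτ) (hK := hj.2)).smul (a := u⁻¹) (b := u⁻¹)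
      (inv_ne_zero hu)
    rw [div_self (inv_ne_zero hu), map_one, one_mul] at h1
    exact h1
  let D : Divisor X := fun x => Submodule.span (localRing X x)
      {θ | ∀ a ∈ pushforwardLocalRing ρ (ρ x),
        φ (θ * a) ∈ formLattice k B.functionField n (localRing B (ρ x))}
  refine ⟨D, ⟨φ, hφ, fun x => rfl⟩, transport n τ hτ hj.2 φ, ?_, fun x' => ?_⟩
  · obtain ⟨z, h, ω, θ, z', h', ω', -, -, F', hθ'⟩ := key (genericPoint BZ)
    intro h0
    rw [h0] at hθ'
    exact F'.ne_zero hθ'.map_mul_eq.symm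
  · obtain ⟨z, h, ω, θ, z', h', ω', F, hθ, F', hθ'⟩ := key (σ x')
    rw [F'.span_eq hθ' (pushforwardLocalRing_le_localRing σ x')]
    have hx : ρ (π x') = j (σ x') := congr($hcomm x')
    rw [← hx] at F
    exact pullback_apply_of_eq_span π (F.span_eq hθ (pushforwardLocalRing_le_localRing ρ (π x')))

end Main

/-! ### Equality of the two exponents is necessary. -/

section Converse

theorem div_pow_sq_mul {K : Type*} [Field K] (f t : K) (a b : ℕ) :
    (t ^ a / t ^ b) ^ 2 * f = f * t ^ (2 * a) / t ^ (2 * b) := by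
  rw [div_pow, ← pow_mul, ← pow_mul, mul_comm a, mul_comm b, mul_comm, mul_div_assoc]

open KaehlerDifferential

variable {k : Type u} [Field k] {B X Z BZ Xt : Scheme.{u}} [IsIntegral B] [IsIntegral X] [IsIntegral Z]
  [IsIntegral BZ] [IsIntegral Xt] (s : B ⟶ Spec (.of k)) (n : ℕ)
  {ρ : X ⟶ B} {j : BZ ⟶ B} {π : Xt ⟶ X} {σ : Xt ⟶ BZ} [IsDominant ρ] [IsDominant j] [IsDominant π]
  [IsDominant σ]

/-- If the canonical class is preserved, the norm of the quotient of two canonical functionals is a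
rational function with divisor given by `u` and `v`. -/
theorem PreservesCanonicalClass.exists_norm (hcomm : π ≫ ρ = σ ≫ j)
    (hπ : Function.Surjective (functionFieldMap π)) (hj : Function.Bijective (functionFieldMap j))
    {P : BZ → BZ.functionField → BZ.functionField → Prop}
    (H : PreservesCanonicalClass n s ρ (j ≫ s) σ π) :
    letI := (scalarMap s).toAlgebra
    letI := (scalarMap (j ≫ s)).toAlgebra
    letI := (functionFieldMap ρ).toAlgebra
    letI := (functionFieldMap σ).toAlgebra
    (∀ y : BZ, ∃ (x : Fin n → B.functionField) (z : X.functionField) (h : B.functionField)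
      (u v h' : BZ.functionField), u ≠ 0 ∧ v ≠ 0 ∧
      IsLocalFrame k n (localRing B (j y)) (pushforwardLocalRing ρ (j y)) z h
        (exteriorPower.ιMulti B.functionField n fun l => D k B.functionField (x l)) ∧
      IsLocalFrame k n (localRing BZ y) (pushforwardLocalRing σ y)
        (algebraMap BZ.functionField Xt.functionField u⁻¹ * functionFieldMap π z) h'
        (v⁻¹ • exteriorPower.ιMulti BZ.functionField n
            fun l => D k BZ.functionField (functionFieldMap j (x l))) ∧ P y u v) →
    ∃ f : B.functionField, f ≠ 0 ∧ ∀ y, ∃ u v, u ≠ 0 ∧ v ≠ 0 ∧ P y u v ∧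
      (v / u) ^ 2 * functionFieldMap j f ∈ localRing BZ y ∧
      ((v / u) ^ 2 * functionFieldMap j f)⁻¹ ∈ localRing BZ y := by
  let := (scalarMap s).toAlgebra
  let := (scalarMap (j ≫ s)).toAlgebra
  let := (functionFieldMap ρ).toAlgebra
  let := (functionFieldMap σ).toAlgebra
  let := (functionFieldMap j).toAlgebra
  have : IsScalarTower k B.functionField BZ.functionField :=
    .of_algebraMap_eq fun c => (functionFieldMap_scalarMap j s c).symm
  intro hF
  let τ := RingEquiv.ofBijective (functionFieldMap π) ⟨(functionFieldMap π).injective, hπ⟩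
  have hτ (a : B.functionField) : τ (algebraMap _ X.functionField a) =
      algebraMap BZ.functionField Xt.functionField (algebraMap _ _ a) := functionFieldMap_comm hcomm a
  obtain ⟨D, ⟨φ, hφ, hD⟩, φ', hφ', hD'⟩ := H
  have hφ'' : transport n τ hτ hj.2 φ ≠ 0 := by
    obtain ⟨x, z, h, u, v, h', hu, hv, F, F', -⟩ := hF (genericPoint BZ)
    obtain ⟨θ, hθ⟩ := F.generator.exists_isCanonicalGenerator hφ F.exists_smul
    have h1 := hθ.transport n (τ := τ) (hτ := hτ) (hK := hj.2)
    intro h0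
    rw [h0] at h1
    exact right_ne_zero_of_smul F'.ne_zero h1.map_mul_eq.symm
  obtain ⟨g, hg0, hg⟩ : ∃ g : Xt.functionField, g ≠ 0 ∧
      ∀ l, φ' l = transport n τ hτ hj.2 φ (g * l) := by
    obtain ⟨x, z, h, u, v, h', hu, hv, F, F', -⟩ := hF (genericPoint BZ)
    exact F'.generator.exists_linearMap_eq hφ'' hφ' F'.ne_zero F'.exists_smul
  -- The norm of the ratio of the two functionals descends to a rational function on `B`, because
  -- the blow-up is birational.
  obtain ⟨f, hf⟩ := hj.2 (Algebra.norm BZ.functionField g)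
  have : Module.Finite BZ.functionField Xt.functionField := by
    obtain ⟨x, z, h, u, v, h', hu, hv, F, F', -⟩ := hF (genericPoint BZ)
    exact Module.Finite.of_basis F'.generator.basis
  refine ⟨f, fun h0 => ?_, fun y => ?_⟩
  · rw [h0, map_zero] at hf
    exact (Algebra.norm_ne_zero_iff.mpr hg0) hf.symm
  obtain ⟨x, z, h, u, v, h', hu, hv, F, F', hP⟩ := hF y
  refine ⟨u, v, hu, hv, hP, ?_⟩
  obtain ⟨θ, hθ⟩ := F.generator.exists_isCanonicalGenerator hφ F.exists_smul
  obtain ⟨θ', hθ'⟩ := F'.generator.exists_isCanonicalGenerator hφ' F'.exists_smul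
  have h1 := hθ.transport n (τ := τ) (hτ := hτ) (hK := hj.2)
  have hz : IsSquareRootGenerator (τ z) (u ^ 2 * h') := by
    have := F'.generator.smul hu
    rwa [← mul_assoc, ← map_mul, mul_inv_cancel₀ hu, map_one, one_mul] at this
  have hmul := IsCanonicalGenerator.mul_eq hg hu hv (right_ne_zero_of_smul F'.ne_zero) hz h1 hθ'
  have hθ0 : τ θ ≠ 0 := h1.ne_zero (right_ne_zero_of_smul F'.ne_zero)
  have hθ'0 := hθ'.ne_zero F'.ne_zero
  have halg : algebraMap BZ.functionField Xt.functionField (u / v) ≠ 0 :=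
    (map_ne_zero _).mpr (div_ne_zero hu hv)
  -- Equality of the divisors makes `τ θ / θ'` a unit at all points over `y`, so its norm is a unit
  -- of the local ring of the blow-up. The square in the conclusion is the norm of `v / u` in a
  -- quadratic extension.
  have hw : algebraMap BZ.functionField Xt.functionField (v / u) * g = τ θ / θ' := by
    rw [eq_div_iff hθ'0, mul_assoc, hmul, ← mul_assoc, ← map_mul, div_mul_div_cancel₀ hu,
      div_self hv, map_one, one_mul]
  have key (x' : Xt) (hx' : σ x' = y) : τ θ / θ' ∈ localRing Xt x' ∧ θ' / τ θ ∈ localRing Xt x' := by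
    subst hx'
    refine (span_singleton_eq_iff hθ0 hθ'0).mp ?_
    have hx : ρ (π x') = j (σ x') := congr($hcomm x')
    rw [← hx] at F
    have h2 := pullback_apply_of_eq_span π
      ((hD (π x')).trans (F.span_eq hθ (pushforwardLocalRing_le_localRing ρ (π x'))))
    exact h2.symm.trans
      ((hD' x').trans (F'.span_eq hθ' (pushforwardLocalRing_le_localRing σ x')))
  have hn : (v / u) ^ 2 * functionFieldMap j f = Algebra.norm BZ.functionField (τ θ / θ') := by
    rw [← hw, hz.norm_algebraMap_mul, hf]
  have hn' : (Algebra.norm BZ.functionField (τ θ / θ'))⁻¹ = Algebra.norm BZ.functionField (θ' / τ θ) :=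
    inv_eq_of_mul_eq_one_right (by
      rw [← map_mul, div_mul_div_cancel₀ hθ'0, div_self hθ0, map_one])
  rw [hn, hn']
  exact ⟨F'.norm_mem ((mem_pushforwardLocalRing σ).mpr fun x' hx' => (key x' hx').1),
    F'.norm_mem ((mem_pushforwardLocalRing σ).mpr fun x' hx' => (key x' hx').2)⟩

variable {i : Z ⟶ B} [IsClosedImmersion i] {d r m : ℕ}

/-- Comparison of multiplicities along the exceptional divisor in codimension at least two. -/
theorem div_two_eq_of_two_le [SmoothOfRelativeDimension n s] (hdr : d + r = n)
    [SmoothOfRelativeDimension d (i ≫ s)] (hr : 2 ≤ r) (hjs : Function.Surjective j)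
    (hblow : IsBlowup i.ker j) {f : B.functionField} (hf0 : f ≠ 0)
    (hf : ∀ y, ∃ u v, u ≠ 0 ∧ v ≠ 0 ∧ ((u = 1 ∧ v = 1 ∧ j y ∉ Set.range i) ∨
        ∃ (hy : i (genericPoint Z) ⤳ j y) (t : B.presheaf.stalk (j y)),
          @IsBlowupLocalRing _ _ _ _ (stalkToFunctionField j (j y)).toAlgebra
            (closureIdeal hy) t (localRing BZ y) ∧
          u = stalkToFunctionField j (j y) t ^ (m / 2) ∧
          v = stalkToFunctionField j (j y) t ^ (r - 1)) ∧
      (v / u) ^ 2 * functionFieldMap j f ∈ localRing BZ y ∧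
      ((v / u) ^ 2 * functionFieldMap j f)⁻¹ ∈ localRing BZ y) : m / 2 = r - 1 := by
  have hout (b : B) (hb : b ∉ Set.range i) : f ∈ localRing B b ∧ f⁻¹ ∈ localRing B b := by
    obtain ⟨y, rfl⟩ := hjs b
    obtain ⟨u, v, -, -, ⟨rfl, rfl, -⟩ | ⟨hy, -⟩, h1, h2⟩ := hf y
    · rw [div_one, one_pow, one_mul, hblow.localRing_eq hb] at h1 h2
      rw [← map_inv₀] at h2
      obtain ⟨a, ha, ha'⟩ := h1
      obtain ⟨c, hc, hc'⟩ := h2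
      exact ⟨(functionFieldMap j).injective ha' ▸ ha, (functionFieldMap j).injective hc' ▸ hc⟩
    · exact absurd ((specializes_iff_mem_range i).mp hy) hb
  obtain ⟨y, hy⟩ := hjs (i (genericPoint Z))
  obtain ⟨u, v, hu, hv, ⟨-, -, hy'⟩ | ⟨hy, t, H, rfl, rfl⟩, h1, h2⟩ := hf y
  · exact absurd ⟨_, hy.symm⟩ hy'
  let := (stalkToFunctionField j (j y)).toAlgebra
  have ht0 : stalkToFunctionField j (j y) t ≠ 0 := H.ne_zero
  -- The Hartogs bound for `f` gives one inequality between the exponents, and for `f⁻¹` the other.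
  have e1 := le_of_forall_mem_localRing s hdr hr hy hf0 (fun b hb => (hout b hb).1) (t := t)
    (P := 2 * (r - 1)) (M := 2 * (m / 2)) (by
      rwa [← div_pow_sq_mul]) H
  have e2 := le_of_forall_mem_localRing s hdr hr hy (inv_ne_zero hf0) (fun b hb => (hout b hb).2)
    (t := t) (P := 2 * (m / 2)) (M := 2 * (r - 1)) (by
      rwa [map_inv₀, ← div_pow_sq_mul, ← inv_div, inv_pow, ← mul_inv, inv_inv]) H
  omega

/-- In codimension one the blow-up changes nothing and `v = 1`. So `f / t ^ (2⌊m/2⌋)` is a unit at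
the points over `Z`, and `f` is regular everywhere. By properness `f⁻¹` is regular too, so for `m ≥
2` the equation `t` of `Z` would be invertible on `Z`. -/
theorem lt_two_of_codim_one [SmoothOfRelativeDimension n s] (hdr : d + r = n)
    [SmoothOfRelativeDimension d (i ≫ s)] (hr : r = 1) (hB : 2 ≤ m → IsProper s)
    (hjs : Function.Surjective j)
    (hblow : IsBlowup i.ker j) {f : B.functionField} (hf0 : f ≠ 0)
    (hf : ∀ y, ∃ u v, u ≠ 0 ∧ v ≠ 0 ∧ ((u = 1 ∧ v = 1 ∧ j y ∉ Set.range i) ∨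
        ∃ (hy : i (genericPoint Z) ⤳ j y) (t : B.presheaf.stalk (j y)),
          @IsBlowupLocalRing _ _ _ _ (stalkToFunctionField j (j y)).toAlgebra
            (closureIdeal hy) t (localRing BZ y) ∧
          u = stalkToFunctionField j (j y) t ^ (m / 2) ∧
          v = stalkToFunctionField j (j y) t ^ (r - 1)) ∧
      (v / u) ^ 2 * functionFieldMap j f ∈ localRing BZ y ∧
      ((v / u) ^ 2 * functionFieldMap j f)⁻¹ ∈ localRing BZ y) : m < 2 := by
  by_contra! hm
  have := hB hm
  have hM : 1 ≤ m / 2 := by omega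
  have hreg (b : B) : f ∈ localRing B b := by
    obtain ⟨y, rfl⟩ := hjs b
    suffices h : functionFieldMap j f ∈ (localRing B (j y)).map (functionFieldMap j) by
      obtain ⟨a, ha, ha'⟩ := h
      exact (functionFieldMap j).injective ha' ▸ ha
    obtain ⟨u, v, hu, hv, ⟨rfl, rfl, hb⟩ | ⟨hy, t, H, rfl, rfl⟩, h1, -⟩ := hf y
    · rwa [div_one, one_pow, one_mul, hblow.localRing_eq hb] at h1
    · rw [← hblow.localRing_eq_of_codim_one s hdr hr hy]
      let := (stalkToFunctionField j (j y)).toAlgebra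
      have ht0 : stalkToFunctionField j (j y) t ≠ 0 := H.ne_zero
      have h2 := Subring.mul_mem _ h1 (Subring.pow_mem _ (H.algebraMap_mem t) (2 * (m / 2)))
      rw [div_pow_sq_mul, hr, Nat.sub_self, mul_zero, pow_zero, mul_one] at h2
      rwa [← div_mul_cancel₀ (functionFieldMap j f) (pow_ne_zero (2 * (m / 2)) ht0)]
  obtain ⟨y, hy⟩ := hjs (i (genericPoint Z))
  obtain ⟨u, v, hu, hv, ⟨-, -, hy'⟩ | ⟨hy, t, H, rfl, rfl⟩, h1, -⟩ := hf y
  · exact absurd ⟨_, hy.symm⟩ hy'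
  let := (stalkToFunctionField j (j y)).toAlgebra
  have ht0 : stalkToFunctionField j (j y) t ≠ 0 := H.ne_zero
  refine inv_stalkToFunctionField_notMem hy H.mem (fun h => ht0 (by rw [h, map_zero])) ?_
  have h3 := functionFieldMap_mem_localRing j (inv_mem_localRing_of_isProper s hreg (j y))
  have h2 := Subring.mul_mem _ (Subring.mul_mem _ h1 h3)
    (Subring.pow_mem _ (H.algebraMap_mem t) (2 * (m / 2) - 1))
  have hf0' : functionFieldMap j f ≠ 0 := (map_ne_zero _).mpr hf0
  rw [div_pow_sq_mul, hr, Nat.sub_self, mul_zero, pow_zero, mul_one, map_inv₀, div_mul_eq_mul_div,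
    mul_inv_cancel₀ hf0'] at h2
  convert h2 using 1
  change _ = _ * stalkToFunctionField j (j y) t ^ _
  obtain ⟨c, hc⟩ := Nat.exists_eq_add_of_le hM
  rw [show 2 * (m / 2) = 2 * c + 1 + 1 by omega, Nat.add_sub_cancel, pow_succ _ (2 * c + 1), one_div,
    mul_inv, mul_assoc, mul_comm, mul_assoc, mul_inv_cancel₀ (pow_ne_zero _ ht0), mul_one]

end Converse

/-! ### Assembly of the theorem. -/

section Assembly

/-- For `r ≥ 1` the ideal contains the first coordinate, whose differential is a basis element and
hence nonzero. -/
theorem closureIdeal_ne_bot {k : Type u} [Field k] {B Z : Scheme.{u}} [IsIntegral B]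
    [IsIntegral Z] (s : B ⟶ Spec (.of k)) (i : Z ⟶ B) [IsClosedImmersion i]
    (n d r : ℕ) (hr : 1 ≤ r) (hdr : d + r = n) [SmoothOfRelativeDimension n s]
    [SmoothOfRelativeDimension d (i ≫ s)] {b : B} (hb : i (genericPoint Z) ⤳ b) :
    closureIdeal hb ≠ ⊥ := by
  let := (stalkScalarMap s b).toAlgebra
  obtain ⟨x, e, he, hI⟩ := exists_coordinates_of_specializes s i n d r hdr hb
  intro h0
  have hx : x ⟨0, by omega⟩ ∈ closureIdeal hb :=
    hI ▸ Ideal.subset_span ⟨⟨0, by omega⟩, hr, rfl⟩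
  rw [h0, Ideal.mem_bot] at hx
  exact e.ne_zero ⟨0, by omega⟩ (by rw [he, hx, map_zero])

theorem isLocallyNoetherian_of_smooth {k : Type u} [Field k] {B : Scheme.{u}}
    (s : B ⟶ Spec (.of k)) (n : ℕ) [SmoothOfRelativeDimension n s] : IsLocallyNoetherian B := by
  have : Smooth s := SmoothOfRelativeDimension.smooth n s
  exact LocallyOfFiniteType.isLocallyNoetherian s

open KaehlerDifferential

variable {k : Type u} [Field k] {B X Z BZ Xt : Scheme.{u}} [IsIntegral B] [IsIntegral X] [IsIntegral Z]
  [IsIntegral BZ] [IsIntegral Xt] (s : B ⟶ Spec (.of k)) (n : ℕ) [SmoothOfRelativeDimension n s]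
  {ρ : X ⟶ B} {j : BZ ⟶ B} {π : Xt ⟶ X} {σ : Xt ⟶ BZ} [IsDominant ρ] [IsDominant j] [IsDominant π]
  [IsDominant σ] [IsIntegralHom σ]

/-- The comparison of canonical classes for a normal double cover of a blow-up. -/
theorem IsDoubleCover.canonicalClass_blowup (hk : (2 : k) ≠ 0) (hρ : IsDoubleCover ρ)
    {i : Z ⟶ B} [IsClosedImmersion i] {d r : ℕ} (hr : 1 ≤ r) (hdr : d + r = n)
    [SmoothOfRelativeDimension d (i ≫ s)] {m : ℕ}
    (hm : HasBranchMultiplicity ρ (i (genericPoint Z)) m)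
    (hX : ∀ x : X, ρ x ∉ Set.range i → IsIntegrallyClosed (X.presheaf.stalk x))
    (hB : r = 1 → 2 ≤ m → IsProper s)
    (hcomm : π ≫ ρ = σ ≫ j) (hπ : Function.Surjective (functionFieldMap π))
    (hjs : Function.Surjective j) (hblow : IsBlowup i.ker j)
    (hXt : ∀ x : Xt, IsIntegrallyClosed (Xt.presheaf.stalk x)) :
    (∀ D ∈ canonicalDivisors n s ρ, D.IsCartier) ∧
    (∀ D ∈ canonicalDivisors n (j ≫ s) σ, D.IsCartier) ∧
    (PreservesCanonicalClass n s ρ (j ≫ s) σ π ↔ m / 2 = r - 1) := by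
  have hj := hblow.functionFieldMap_bijective
  have hF := hρ.exists_isLocalFrame s n hk hdr hm hX hcomm hπ hj hblow hXt
  refine ⟨isCartier_of_exists_isLocalFrame n s ρ fun b => ?_,
    isCartier_of_exists_isLocalFrame n (j ≫ s) σ fun y => ?_, fun H => ?_, fun h => ?_⟩
  · obtain ⟨y, rfl⟩ := hjs b
    obtain ⟨x, z, h, u, v, h', hu, hv, F, -⟩ := hF y
    exact ⟨_, _, _, F⟩
  · obtain ⟨x, z, h, u, v, h', hu, hv, -, F, -⟩ := hF y
    exact ⟨_, _, _, F⟩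
  · obtain ⟨f, hf0, hf⟩ := H.exists_norm s n hcomm hπ hj hF
    rcases hr.eq_or_lt with hr1 | hr2
    · have := lt_two_of_codim_one s n hdr hr1.symm (hB hr1.symm) hjs hblow hf0 hf
      omega
    · exact div_two_eq_of_two_le s n hdr hr2 hjs hblow hf0 hf
  · refine preservesCanonicalClass_of_exists_isLocalFrame s n hcomm hπ hj fun y => ?_
    obtain ⟨x, z, g, u, v, h', hu, hv, F, F', huv⟩ := hF y
    have huv' : u = v := by
      obtain ⟨rfl, rfl, -⟩ | ⟨-, t, -, rfl, rfl⟩ := huv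
      · rfl
      · rw [h]
    subst huv'
    exact ⟨x, z, g, u, h', hu, F, F'⟩

end Assembly

end DoubleCover

theorem mainTheorem1 {k : Type u} [Field k] (hk : (2 : k) ≠ 0)
    {B X Z BZ Xt : Scheme.{u}}
    (n : ℕ) (s : B ⟶ Spec (.of k)) [IsIntegral B] [IsSeparated s] [QuasiCompact s]
    [SmoothOfRelativeDimension n s]
    (ρ : X ⟶ B) [IsIntegral X] (hρ : DoubleCover.IsDoubleCover ρ)
    (d r : ℕ) (hr : 1 ≤ r) (hdr : d + r = n)
    (i : Z ⟶ B) [IsClosedImmersion i] [IsIntegral Z] [SmoothOfRelativeDimension d (i ≫ s)]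
    (m : ℕ) (hm : DoubleCover.HasBranchMultiplicity ρ (i (genericPoint Z)) m)
    (hX : ∀ x : X, ρ x ∉ Set.range i → IsIntegrallyClosed (X.presheaf.stalk x))
    (hB : r = 1 → 2 ≤ m → IsProper s)
    (j : BZ ⟶ B) (hj : DoubleCover.IsBlowup i.ker j)
    (ν : Xt ⟶ pullback ρ j) [IsIntegral Xt] (hν : DoubleCover.IsNormalization ν) :
    ∃ (_ : IsIntegral BZ) (_ : IsDominant ρ) (_ : IsDominant (ν ≫ pullback.snd ρ j))
      (_ : IsDominant (ν ≫ pullback.fst ρ j)),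
      (∀ D ∈ DoubleCover.canonicalDivisors n s ρ, D.IsCartier) ∧
      (∀ D ∈ DoubleCover.canonicalDivisors n (j ≫ s) (ν ≫ pullback.snd ρ j), D.IsCartier) ∧
      (DoubleCover.PreservesCanonicalClass n s ρ (j ≫ s) (ν ≫ pullback.snd ρ j)
          (ν ≫ pullback.fst ρ j) ↔ m = 2 * r - 2 ∨ m = 2 * r - 1) ∧
      (r = 1 → (DoubleCover.PreservesCanonicalClass n s ρ (j ≫ s) (ν ≫ pullback.snd ρ j)
          (ν ≫ pullback.fst ρ j) ↔ m = 0 ∨ m = 1)) ∧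
      (r = 2 → (DoubleCover.PreservesCanonicalClass n s ρ (j ≫ s) (ν ≫ pullback.snd ρ j)
          (ν ≫ pullback.fst ρ j) ↔ m = 2 ∨ m = 3)) ∧
      (r = 3 → (DoubleCover.PreservesCanonicalClass n s ρ (j ≫ s) (ν ≫ pullback.snd ρ j)
          (ν ≫ pullback.fst ρ j) ↔ m = 4 ∨ m = 5)) := by
  have := DoubleCover.isLocallyNoetherian_of_smooth s n
  have hI := DoubleCover.ker_ideal_ne_bot i fun z =>
    DoubleCover.closureIdeal_ne_bot s i n d r hr hdr (DoubleCover.specializes_map_genericPoint i z)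
  have := hj.isIntegral hI
  have hjs := hj.surjective hI
  have hρs := hρ.surjective
  have hρd := hρ.isDominant
  have := hρ.isFinite
  have := hν.isIntegralHom
  have := hν.isDominant
  have hσ : IsDominant (ν ≫ pullback.snd ρ j) := inferInstance
  have hπ : IsDominant (ν ≫ pullback.fst ρ j) := inferInstance
  have hcomm : (ν ≫ pullback.fst ρ j) ≫ ρ = (ν ≫ pullback.snd ρ j) ≫ j := by
    rw [Category.assoc, Category.assoc, pullback.condition]
  obtain ⟨h1, h2, h3⟩ := hρ.canonicalClass_blowup s n hk hr hdr hm hX hB hcomm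
    (hν.functionFieldMap_surjective hj.functionFieldMap_bijective) hjs.surj hj hν.isIntegrallyClosed
  -- What remains is arithmetic: `m / 2 = r - 1` for the rounded quotient, where `r ≥ 1` keeps the
  -- truncated subtractions honest.
  refine ⟨inferInstance, hρd, hσ, hπ, h1, h2, ?_, ?_, ?_, ?_⟩ <;> intros <;> rw [h3] <;> omega
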